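/- **Model.** Let $m\ge 1$ be an integer, $\delta>0$ a real number, $d\ge 1$ an integer, and $p\in(0,1)$. Let $S\subset\mathbb R^{d+1}$ be the $d$-dimensional sphere of surface area $1$, let $D$ be the Euclidean distance of $\mathbb R^{d+1}$ restricted to $S$, and let $r$ be the radius such that $\{y\in S: D(x,y)\le r\}$ has area $p$ for every $x\in S$. The geometric preferential attachment process starts from the empty graph. For $n\ge 1$, a new vertex $V_n$ is placed uniformly on $S$, independently of the past. Then $m$ edges $e_{n,1},\dots,e_{n,m}$ from $V_n$ are added one after the other. Write $GPM_{n,i}$ for the graph after $e_{n,i}$ has been added, $GPM_n=GPM_{n,m}$, and $\deg_{k}(n,i)$ for the degree of $V_k$ in $GPM_{n,i}$ (a self-loop counts $2$). For $0\le i<m$, conditionally on the whole history up to and including $GPM_{n,i}$, the edge $e_{n,i+1}$ joins $V_n$ to $V_k$ with probability $$\frac{\mathbf 1_{\{D(V_n,V_k)\le r\}}(\deg_k(n,i)+m\delta)}{Z_{n,i}}\ (1\le k\le n-1),\qquad \frac{\deg_n(n,i)+m\delta+m-i}{Z_{n,i}}\ (k=n),$$ $$Z_{n,i}=\sum_{1\le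 j\le n,\ D(V_n,V_j)\le r}(\deg_j(n,i)+m\delta)+m-i .$$ Let $$L(n)=\sum_{1\le j\le n-1,\ D(V_j,V_n)\le r}\bigl(\deg_j(n-1,m)+m\delta\bigr)+m(2+\delta).$$ **Theorem.** Let $m\ge1$, $\delta>0$ and $\varepsilon>0$. (i) There are constants $C_1,C_2,C_3>0$, depending only on $m,\delta,\varepsilon$, such that for all $d\ge 1$, all $p\in(0,1)$ and all $n\ge 1$, $$\mathbb P\bigl((2+\delta-\varepsilon)mpn\le L(n)\le(2+\delta+\varepsilon)mpn\bigr)\ \ge\ 1-C_1\exp\bigl(-C_2(np)^{C_3}\bigr).$$ (ii) For every fixed $d\ge 1$ one can take $C_3=1$: there are constants $C_1,C_2>0$, depending only on $d,m,\delta,\varepsilon$, such that for all $p\in(0,1)$ and all $n\ge 1$, $$\mathbb P\bigl((2+\delta-\varepsilon)mpn\le L(n)\le(2+\delta+\varepsilon)mpn\bigr)\ \ge\ 1-C_1\exp(-C_2np).$$ -/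

import Mathlib

open MeasureTheory

namespace GPM

/-- The ambient Euclidean space `ℝ^(d+1)` of the `d`-dimensional sphere. -/
abbrev Ambient (d : ℕ) : Type := EuclideanSpace ℝ (Fin (d + 1))

/-- Surface area of the unit sphere of `ℝ^(d+1)`. -/
noncomputable def unitSphereArea (d : ℕ) : ℝ :=
  (volume : Measure (Ambient d)).toSphere.real Set.univ

/-- The radius `R` for which the `d`-dimensional sphere of radius `R` has surface area `1`,
that is, `R ^ d * unitSphereArea d = 1`. -/
noncomputable def sphereRadius (d : ℕ) : ℝ := (unitSphereArea d) ^ (-(1 / (d : ℝ)))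

/-- The `d`-dimensional spherical surface `S ⊆ ℝ^(d+1)` of surface area `1`.  It carries the
Euclidean distance of `ℝ^(d+1)` and the Borel sigma-algebra. -/
abbrev Sphere (d : ℕ) : Type := Metric.sphere (0 : Ambient d) (sphereRadius d)

theorem sphereRadius_nonneg (d : ℕ) : 0 ≤ sphereRadius d :=
  Real.rpow_nonneg measureReal_nonneg _

/-- The scaling `x ↦ R x` from the unit sphere onto `S`. -/
noncomputable def scaleSphere (d : ℕ) (x : Metric.sphere (0 : Ambient d) 1) : Sphere d :=
  ⟨sphereRadius d • (x : Ambient d), by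
    simp [norm_smul, abs_of_nonneg (sphereRadius_nonneg d)]⟩

/-- The surface area measure on `S`: the surface measure of the unit sphere, transported by the
scaling `x ↦ R x`, which multiplies `d`-dimensional areas by `R ^ d`. -/
noncomputable def area (d : ℕ) : Measure (Sphere d) :=
  ENNReal.ofReal (sphereRadius d ^ d) •
    ((volume : Measure (Ambient d)).toSphere).map (scaleSphere d)

theorem measurable_scaleSphere (d : ℕ) : Measurable (scaleSphere d) := by
  refine Measurable.subtype_mk ?_
  exact measurable_subtype_coe.const_smul (sphereRadius d)

/-- The total surface area of `S` is `1`; hence `area d` is the uniform distribution on `S`. -/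
theorem area_univ {d : ℕ} (hd : 1 ≤ d) : area d Set.univ = 1 := by
  have hpos : 0 < unitSphereArea d := by
    rw [unitSphereArea, measureReal_def]
    refine ENNReal.toReal_pos ?_ (measure_ne_top _ _)
    rw [Ne, Measure.measure_univ_eq_zero]
    exact Measure.toSphere_ne_zero _
  have hR : sphereRadius d ^ d = (unitSphereArea d)⁻¹ := by
    have hd' : (d : ℝ) ≠ 0 := by positivity
    rw [sphereRadius, ← Real.rpow_natCast, ← Real.rpow_mul hpos.le]
    rw [show -(1 / (d : ℝ)) * (d : ℝ) = -1 by field_simp, Real.rpow_neg_one]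
  have hA : (volume : Measure (Ambient d)).toSphere Set.univ
      = ENNReal.ofReal (unitSphereArea d) := by
    rw [unitSphereArea, measureReal_def, ENNReal.ofReal_toReal (measure_ne_top _ _)]
  rw [area, Measure.smul_apply, Measure.map_apply (measurable_scaleSphere d) MeasurableSet.univ,
    Set.preimage_univ, hA, hR, smul_eq_mul, ← ENNReal.ofReal_mul (inv_nonneg.2 hpos.le),
    inv_mul_cancel₀ hpos.ne', ENNReal.ofReal_one]

/-! In the following definitions `x n` is the position of the vertex `V_n` and `v n i` is the
index of the vertex to which the `i`-th edge of `V_n` connects (`n ≥ 1`, `1 ≤ i ≤ m`). -/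

/-- The number of edges added by the vertex `a ≤ n` in `GPM_{n,i}`: the first `i` edges if
`a = n`, all `m` edges if `a < n`. -/
def edgeCount (m n i a : ℕ) : ℕ := if a < n then m else i

/-- The degree of `V_k` in `GPM_{n,i}`.  Each edge `(V_a, V_{v a l})` contributes `1` for each of
its two ends, so that a self-loop contributes `2`. -/
def degree (m : ℕ) (v : ℕ → ℕ → ℕ) (n i k : ℕ) : ℕ :=
  ∑ a ∈ Finset.Icc 1 n, ∑ l ∈ Finset.Icc 1 (edgeCount m n i a),
    ((if a = k then 1 else 0) + (if v a l = k then 1 else 0))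

/-- The weight of `V_k` in `GPM_{n,i}`: its degree plus `m δ`. -/
def weight (m : ℕ) (δ : ℝ) (v : ℕ → ℕ → ℕ) (n i k : ℕ) : ℝ :=
  (degree m v n i k : ℝ) + m * δ

open Classical in
/-- The probability, given `GPM_{n,i}`, that the edge `e_{n,i+1}` joins `V_n` to `V_k`
(for `1 ≤ k ≤ n`; `k = n` is a self-loop). -/
noncomputable def edgeProb {X : Type*} [Dist X] (m : ℕ) (δ r : ℝ) (x : ℕ → X) (v : ℕ → ℕ → ℕ)
    (n i k : ℕ) : ℝ :=
  (if k = n then weight m δ v n i n + ((m : ℝ) - i)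
    else if dist (x n) (x k) ≤ r then weight m δ v n i k else 0) /
  ((∑ j ∈ Finset.Icc 1 n with dist (x n) (x j) ≤ r, weight m δ v n i j) + ((m : ℝ) - i))

open Classical in
/-- `L(n)`, the total weight in the detection region of the new vertex `V_n`: the weights, in
`GPM_{n-1}`, of the vertices `V_1, …, V_{n-1}` within distance `r` of `V_n`,
plus `m (2 + δ)`. -/
noncomputable def L {X : Type*} [Dist X] (m : ℕ) (δ r : ℝ) (x : ℕ → X) (v : ℕ → ℕ → ℕ)
    (n : ℕ) : ℝ :=
  (∑ j ∈ Finset.Icc 1 (n - 1) with dist (x j) (x n) ≤ r, weight m δ v (n - 1) m j)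
    + m * (2 + δ)

/-- The sigma-algebra `ℱ_{n,i}` generated by the positions of the first `n` vertices and by all
edges up to `e_{n,i}`. -/
abbrev history {Ω X : Type*} [MeasurableSpace X] (m : ℕ) (V : ℕ → Ω → X) (v : ℕ → ℕ → Ω → ℕ)
    (n i : ℕ) : MeasurableSpace Ω :=
  (⨆ a ∈ Finset.Icc 1 n, MeasurableSpace.comap (V a) inferInstance) ⊔
  (⨆ a ∈ Finset.Icc 1 n, ⨆ l ∈ Finset.Icc 1 (edgeCount m n i a),
    MeasurableSpace.comap (v a l) inferInstance)

/-- The random positions `V_1, V_2, …` and edge targets `v_{n,i}` (`n ≥ 1`, `1 ≤ i ≤ m`), defined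
on a probability space `(Ω, P)`, form a geometric preferential attachment process on the
`d`-dimensional sphere `S` of area `1`, with out-degree `m`, fitness parameter `δ` and detection
radius `r`: every new vertex is uniform on `S` and independent of the past, and then its `m` edges
are added one after the other with the conditional probabilities `edgeProb`. -/
structure IsGPM {Ω : Type*} [MeasurableSpace Ω] (P : Measure Ω) (d m : ℕ) (δ r : ℝ)
    (V : ℕ → Ω → Sphere d) (v : ℕ → ℕ → Ω → ℕ) : Prop where
  measurable_position : ∀ n, 1 ≤ n → Measurable (V n)
  measurable_target : ∀ n i, 1 ≤ n → 1 ≤ i → i ≤ m → Measurable (v n i)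
  uniform : ∀ n, 1 ≤ n → P.map (V n) = area d
  indep : ∀ n, 1 ≤ n → ProbabilityTheory.Indep
    (MeasurableSpace.comap (V n) inferInstance) (history m V v (n - 1) m) P
  edge : ∀ n i k, 1 ≤ n → i < m → 1 ≤ k → k ≤ n →
    P[Set.indicator {ω | v n (i + 1) ω = k} (fun _ => (1 : ℝ)) | history m V v n i]
      =ᵐ[P] fun ω => edgeProb m δ r (fun a => V a ω) (fun a l => v a l ω) n i k

end GPM

/-!
Consider a new vertex that is placed uniformly on the sphere, and let `W` be the weight in its
detection region, which is `L(n)` up to the bounded share of the new vertex. A new vertex adds at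
once `m (1 + δ)` to the weight of a region that it falls into, and each of its `m` edges adds `1`
if it ends there. The proportion of the weight in any set is a martingale while the `m` edges are
added (`IsGPM.integral_urn`), so that these `m` choices may be replaced by choices with the
probabilities that prevail before the first one (`IsGPM.integral_increment`).

If all detection regions had a weight of `m p n / w`, the weight in a region would grow in
expectation by `m (1 + δ) p` plus `w / n` times itself, and so would be close to
`m p n (1 + δ) / (1 - w)`. The fixed point is `w = 1 / (2 + δ)`, where the weight is `(2 + δ) m p n`. An upper
bound on the weights, whose reciprocal parameter deviates by `D` from the fixed point, thus gives
a lower bound with a deviation close to `D / (1 + δ)`, and this gives an upper bound with a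
deviation close to `D / (1 + δ) ^ 2`. Iteration gives concentration (`lowerTail_of_upperTail`,
`upperTail_of_lowerTail`, `upperTail_of_lt`).

Each of the two implications is proved with exponential moments, averaged over the centre of the
region (`IsGPM.upper_step`, `IsGPM.lower_step`). The average makes the growth of the moments
exact: the weight common to the regions around two points `x` and `y`, integrated over `y`, is `p`
times the weight of the region around `x`. The bound on the weight is needed for the region of a
typical `y` only; the exceptional `y` contribute error terms, which are products of their
probability and of the number of vertices that they see. For upper bounds, the moments are
truncated at `1` to allow this; for lower bounds, `t * exp (-t) ≤ 1` is used.

The iteration needs some upper bound of the order of `m p n` to begin with. In a fixed dimension,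
all vertices that send edges into a ball lie in the ball of twice the radius, whose area is at
most `5 ^ (d + 1) p`; this has exponentially small exceptions (`upperTail_of_double`). Uniformly
in the dimension, the number of pairs of neighbouring vertices gives a bound that is quadratic in
`p s` (`IsGPM.upper_tail_le_sq`). From a time `s` with `p s` of the order of a small power of
`p n`, it is propagated to time `n` with a growth exponent `θ < 1`, by means of the trivial lower
bound `m (1 + δ) p n` on the weights (`exists_upperTail`); the exceptions are then bounded by a
stretched exponential.
-/

namespace GPM

/-! ### Elementary inequalities -/

theorem exp_le_one_add_mul {κ t : ℝ} (hκ : κ ≤ 1) (ht0 : 0 ≤ t) (ht : t ≤ κ) :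
    Real.exp t ≤ 1 + (1 + κ) * t := by
  have h := Real.abs_exp_sub_one_sub_id_le (x := t) (by rw [abs_of_nonneg ht0]; linarith)
  have h2 := (abs_le.1 h).2
  nlinarith

theorem exp_neg_le_one_sub_mul {κ t : ℝ} (hκ : κ ≤ 1) (ht0 : 0 ≤ t) (ht : t ≤ κ) :
    Real.exp (-t) ≤ 1 - (1 - κ) * t := by
  have h := Real.abs_exp_sub_one_sub_id_le (x := -t) (by rw [abs_neg, abs_of_nonneg ht0]; linarith)
  have h2 := (abs_le.1 h).2
  nlinarith

/-- The growth factor `∏_{j < s} (1 + θ / (j + 1))`, of order `s ^ θ`, by which a quantity with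
relative growth rate `θ / (j + 1)` in the `j`-th step is multiplied in `s` steps. -/
noncomputable def growth (θ : ℝ) (s : ℕ) : ℝ := ∏ j ∈ Finset.range s, (1 + θ / ((j : ℝ) + 1))

theorem growth_succ (θ : ℝ) (s : ℕ) :
    growth θ (s + 1) = growth θ s * (1 + θ / ((s : ℝ) + 1)) := by
  rw [growth, Finset.prod_range_succ, growth]

theorem growth_pos {θ : ℝ} (hθ : 0 ≤ θ) (s : ℕ) : 0 < growth θ s :=
  Finset.prod_pos fun j _ => by positivity

theorem growth_mono {θ : ℝ} (hθ : 0 ≤ θ) : Monotone (growth θ) := by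
  refine monotone_nat_of_le_succ fun s => ?_
  rw [growth_succ]
  have := growth_pos hθ s
  have h : 0 ≤ θ / ((s : ℝ) + 1) := by positivity
  nlinarith

theorem growth_div_le {θ : ℝ} (hθ : 0 ≤ θ) (hθ1 : θ ≤ 1) {s t : ℕ} (hs : 1 ≤ s) (hst : s ≤ t) :
    growth θ t / growth θ s ≤ ((t : ℝ) / s) ^ θ := by
  induction t, hst using Nat.le_induction with
  | base =>
    have hs' : (s : ℝ) ≠ 0 := by positivity
    rw [div_self (growth_pos hθ s).ne', div_self hs', Real.one_rpow]
  | succ t hst ih =>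
    have ht0 : (0 : ℝ) < t := by exact_mod_cast (by omega : 0 < t)
    have hs0 : (0 : ℝ) < s := by exact_mod_cast hs
    have hstep : 1 + θ / ((t : ℝ) + 1) ≤ (((t : ℝ) + 1) / t) ^ θ := by
      have h1 := rpow_one_add_le_one_add_mul_self (s := -(1 / ((t : ℝ) + 1)))
        (by rw [neg_le_neg_iff, div_le_one (by positivity)]; linarith) hθ hθ1
      have h2 : 1 + -(1 / ((t : ℝ) + 1)) = (((t : ℝ) + 1) / t)⁻¹ := by field_simp; ring
      rw [h2, Real.inv_rpow (by positivity)] at h1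
      have hpos : 0 < (((t : ℝ) + 1) / t) ^ θ := by positivity
      set A := (((t : ℝ) + 1) / t) ^ θ
      set x := θ / ((t : ℝ) + 1) with hx
      have h3 : θ * -(1 / ((t : ℝ) + 1)) = -x := by rw [hx]; ring
      rw [h3] at h1
      have hx0 : 0 ≤ x := by positivity
      have h4 : 1 ≤ (1 - x) * A := by
        have := mul_le_mul_of_nonneg_right h1 hpos.le
        rw [inv_mul_cancel₀ hpos.ne'] at this
        linarith
      have h5 := mul_le_mul_of_nonneg_left h4 (by linarith : 0 ≤ 1 + x)
      have h6 : 0 ≤ x ^ 2 * A := by positivity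
      nlinarith
    have heq : ((t + 1 : ℕ) : ℝ) / s = (t : ℝ) / s * (((t : ℝ) + 1) / t) := by
      push_cast; field_simp
    rw [growth_succ, mul_div_right_comm, heq, Real.mul_rpow (by positivity) (by positivity)]
    exact mul_le_mul ih hstep (by positivity) (by positivity)

/-- The sum telescopes, since `(1 - θ) / growth θ (j + 1)` is the increment of
`(j + 1) / growth θ j`. -/
theorem sum_inv_growth {θ : ℝ} (hθ : 0 ≤ θ) {s t : ℕ} (hst : s ≤ t) :
    (1 - θ) * ∑ j ∈ Finset.Ico s t, (growth θ (j + 1))⁻¹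
      = ((t : ℝ) + 1) * (growth θ t)⁻¹ - ((s : ℝ) + 1) * (growth θ s)⁻¹ := by
  induction t, hst using Nat.le_induction with
  | base => simp
  | succ t hst ih =>
    rw [Finset.sum_Ico_succ_top hst, mul_add, ih, growth_succ]
    have h := (growth_pos hθ t).ne'
    have h2 : (1 + θ / ((t : ℝ) + 1)) ≠ 0 := by positivity
    have h3 : (t : ℝ) + 1 + θ ≠ 0 := by positivity
    push_cast
    field_simp
    ring

/-! ### Stretched-exponential decay -/

/-- The quantities `F i` are at most `C * exp (-c * (q i) ^ γ)`, with the same constants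
`C, c > 0` for all `i`. -/
def Decays {ι : Type*} (γ : ℝ) (q F : ι → ℝ) : Prop :=
  ∃ C c : ℝ, 0 < C ∧ 0 < c ∧ ∀ i, F i ≤ C * Real.exp (-c * q i ^ γ)

namespace Decays

variable {ι : Type*} {γ : ℝ} {q F G : ι → ℝ}

theorem add (hq : ∀ i, 0 ≤ q i) (hF : Decays γ q F) (hG : Decays γ q G) :
    Decays γ q (fun i => F i + G i) := by
  obtain ⟨C, c, hC, hc, hb⟩ := hF
  obtain ⟨C', c', hC', hc', hb'⟩ := hG
  refine ⟨C + C', min c c', by positivity, lt_min hc hc', fun i => ?_⟩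
  have hqi : 0 ≤ q i ^ γ := Real.rpow_nonneg (hq i) _
  have h1 : Real.exp (-c * q i ^ γ) ≤ Real.exp (-min c c' * q i ^ γ) :=
    Real.exp_le_exp.2 (by nlinarith [min_le_left c c'])
  have h2 : Real.exp (-c' * q i ^ γ) ≤ Real.exp (-min c c' * q i ^ γ) :=
    Real.exp_le_exp.2 (by nlinarith [min_le_right c c'])
  calc F i + G i ≤ C * Real.exp (-c * q i ^ γ) + C' * Real.exp (-c' * q i ^ γ) :=
        add_le_add (hb i) (hb' i)
    _ ≤ C * Real.exp (-min c c' * q i ^ γ) + C' * Real.exp (-min c c' * q i ^ γ) := by gcongr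
    _ = _ := by ring

theorem const_mul {a : ℝ} (ha : 0 < a) (hF : Decays γ q F) :
    Decays γ q (fun i => a * F i) := by
  obtain ⟨C, c, hC, hc, hb⟩ := hF
  refine ⟨a * C, c, by positivity, hc, fun i => ?_⟩
  rw [mul_assoc]
  exact mul_le_mul_of_nonneg_left (hb i) ha.le

/-- For bounded quantities, only the indices with `q i` large matter. -/
theorem of_large (hγ : 0 ≤ γ) (hq : ∀ i, 0 ≤ q i) {B : ℝ} (hB : ∀ i, F i ≤ B) (K : ℝ)
    (hG : Decays γ q G) (h : ∀ i, K ≤ q i → F i ≤ G i) : Decays γ q F := by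
  obtain ⟨C, c, hC, hc, hb⟩ := hG
  refine ⟨C + |B| * Real.exp (c * |K| ^ γ), c, by positivity, hc, fun i => ?_⟩
  rw [add_mul]
  by_cases hi : K ≤ q i
  · have : 0 ≤ |B| * Real.exp (c * |K| ^ γ) * Real.exp (-c * q i ^ γ) := by positivity
    linarith [h i hi, hb i]
  · have h1 : 0 ≤ C * Real.exp (-c * q i ^ γ) := by positivity
    have h2 : q i ^ γ ≤ |K| ^ γ :=
      Real.rpow_le_rpow (hq i) ((not_le.1 hi).le.trans (le_abs_self K)) hγ
    have h3 : 1 ≤ Real.exp (c * |K| ^ γ) * Real.exp (-c * q i ^ γ) := by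
      rw [← Real.exp_add]
      exact Real.one_le_exp (by nlinarith)
    have h4 := mul_le_mul_of_nonneg_left h3 (abs_nonneg B)
    linarith [hB i, le_abs_self B]

/-- A factor `q i` is absorbed by the exponential. -/
theorem id_mul (hγ : 0 < γ) (hq : ∀ i, 0 ≤ q i) (hF : Decays γ q F) :
    Decays γ q (fun i => q i * F i) := by
  obtain ⟨C, c, hC, hc, hb⟩ := hF
  obtain ⟨k, hk⟩ := exists_nat_ge (1 / γ)
  have hk' : 1 ≤ γ * k := by
    rw [div_le_iff₀ hγ] at hk; linarith
  -- `q ≤ 1 + (q ^ γ) ^ k`, and the `k`-th power is absorbed by half of the exponential.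
  refine ⟨(1 + k.factorial * (2 / c) ^ k) * C, c / 2, by positivity, by positivity, fun i => ?_⟩
  set x := q i ^ γ with hx
  have hx0 : 0 ≤ x := Real.rpow_nonneg (hq i) _
  have h1 : q i ≤ 1 + x ^ k := by
    rcases le_total (q i) 1 with h | h
    · have : 0 ≤ x ^ k := by positivity
      linarith
    · have : q i ≤ x ^ k := by
        rw [hx, ← Real.rpow_natCast, ← Real.rpow_mul (hq i)]
        calc q i = q i ^ (1 : ℝ) := (Real.rpow_one _).symm
          _ ≤ _ := Real.rpow_le_rpow_of_exponent_le h hk'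
      linarith
  have h2 : x ^ k ≤ k.factorial * (2 / c) ^ k * Real.exp (c / 2 * x) := by
    have := Real.pow_div_factorial_le_exp (c / 2 * x) (by positivity) k
    rw [div_le_iff₀ (by positivity), mul_pow] at this
    calc x ^ k = (2 / c) ^ k * ((c / 2) ^ k * x ^ k) := by
          rw [← mul_assoc, ← mul_pow, div_mul_div_cancel₀ hc.ne', div_self two_ne_zero,
            one_pow, one_mul]
      _ ≤ (2 / c) ^ k * (Real.exp (c / 2 * x) * k.factorial) := by gcongr
      _ = _ := by ring
  have h3 : 1 ≤ Real.exp (c / 2 * x) := Real.one_le_exp (by positivity)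
  have h4 : q i ≤ (1 + k.factorial * (2 / c) ^ k) * Real.exp (c / 2 * x) := by linarith
  calc q i * F i ≤ q i * (C * Real.exp (-c * x)) := mul_le_mul_of_nonneg_left (hb i) (hq i)
    _ ≤ (1 + k.factorial * (2 / c) ^ k) * Real.exp (c / 2 * x) * (C * Real.exp (-c * x)) := by
        gcongr
    _ = (1 + k.factorial * (2 / c) ^ k) * C * (Real.exp (c / 2 * x) * Real.exp (-c * x)) := by
        ring
    _ = _ := by rw [← Real.exp_add]; ring_nf

end Decays

/-! ### Weights along a trajectory -/

section Trajectory

variable {X : Type*}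

/-- The indicator that two points are within distance `r`. -/
noncomputable def near [Dist X] (r : ℝ) (x y : X) : ℝ := if dist x y ≤ r then 1 else 0

/-- The total weight in `GPM_{n,i}`, where each vertex is counted with the factor that the
function `φ` takes at its position. -/
def mass (m : ℕ) (δ : ℝ) (x : ℕ → X) (v : ℕ → ℕ → ℕ) (n i : ℕ) (φ : X → ℝ) : ℝ :=
  ∑ k ∈ Finset.Icc 1 n, φ (x k) * weight m δ v n i k

/-- The value of `φ` at the target of the `l`-th edge of `V_n`; it is set to `0` if the target is
not one of `V_1, …, V_n`. -/
def hit (x : ℕ → X) (v : ℕ → ℕ → ℕ) (n l : ℕ) (φ : X → ℝ) : ℝ :=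
  ∑ k ∈ Finset.Icc 1 n, if v n l = k then φ (x k) else 0

/-- The weight, counted with the factor `φ`, that a new vertex placed at `y` sees in its detection
region when its first edge is about to be added to `GPM_s`. Its own share is `m (1 + δ)`. -/
noncomputable def load [Dist X] (m : ℕ) (δ r : ℝ) (x : ℕ → X) (v : ℕ → ℕ → ℕ) (s : ℕ) (y : X)
    (φ : X → ℝ) : ℝ :=
  mass m δ x v s m (fun z => near r y z * φ z) + m * (1 + δ) * φ y

/-- The weight, counted with the factor `φ`, that governs the choice of the target of
`e_{n,i+1}`. -/
noncomputable def urn [Dist X] (m : ℕ) (δ r : ℝ) (x : ℕ → X) (v : ℕ → ℕ → ℕ) (n i : ℕ)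
    (φ : X → ℝ) : ℝ :=
  mass m δ x v n i (fun z => near r (x n) z * φ z) + ((m : ℝ) - i) * φ (x n)

/-- Every edge joins its source to a vertex that is present and in the detection region. -/
def Admissible [Dist X] (m : ℕ) (r : ℝ) (x : ℕ → X) (v : ℕ → ℕ → ℕ) : Prop :=
  ∀ n, 1 ≤ n → ∀ l ∈ Finset.Icc 1 m, 1 ≤ v n l ∧ v n l ≤ n ∧ dist (x n) (x (v n l)) ≤ r

theorem near_nonneg [Dist X] (r : ℝ) (x y : X) : 0 ≤ near r x y := by
  unfold near; split_ifs <;> norm_num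

theorem near_le_one [Dist X] (r : ℝ) (x y : X) : near r x y ≤ 1 := by
  unfold near; split_ifs <;> norm_num

theorem near_comm [PseudoMetricSpace X] (r : ℝ) (x y : X) : near r x y = near r y x := by
  unfold near; rw [dist_comm]

theorem near_self [PseudoMetricSpace X] {r : ℝ} (hr : 0 ≤ r) (x : X) : near r x x = 1 := by
  simp [near, hr]

theorem near_eq_zero_or_one [Dist X] (r : ℝ) (x y : X) : near r x y = 0 ∨ near r x y = 1 := by
  unfold near; split_ifs <;> simp

variable {m : ℕ} {δ : ℝ} {x : ℕ → X} {v : ℕ → ℕ → ℕ}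

theorem weight_nonneg (hδ : 0 < δ) (n i k : ℕ) : 0 ≤ weight m δ v n i k := by
  unfold weight; positivity

theorem degree_le {n i : ℕ} (hi : i ≤ m) (k : ℕ) : degree m v n i k ≤ 2 * m * n := by
  unfold degree
  calc _ ≤ ∑ a ∈ Finset.Icc 1 n, 2 * m := by
        refine Finset.sum_le_sum fun a _ => ?_
        calc _ ≤ ∑ l ∈ Finset.Icc 1 (edgeCount m n i a), 2 :=
              Finset.sum_le_sum fun l _ => by split_ifs <;> omega
          _ = 2 * edgeCount m n i a := by simp [mul_comm]
          _ ≤ 2 * m := by unfold edgeCount; split_ifs <;> omega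
    _ = _ := by simp [mul_comm]

theorem weight_le {n i : ℕ} (hi : i ≤ m) (k : ℕ) :
    weight m δ v n i k ≤ 2 * m * n + m * δ := by
  have := degree_le (v := v) (n := n) hi k
  unfold weight
  have h : (degree m v n i k : ℝ) ≤ 2 * m * n := by exact_mod_cast this
  linarith

theorem mass_nonneg (hδ : 0 < δ) {φ : X → ℝ} (hφ : ∀ z, 0 ≤ φ z) (n i : ℕ) :
    0 ≤ mass m δ x v n i φ :=
  Finset.sum_nonneg fun k _ => mul_nonneg (hφ _) (weight_nonneg hδ n i k)

theorem mass_mono (hδ : 0 < δ) {φ ψ : X → ℝ} (h : ∀ z, φ z ≤ ψ z) (n i : ℕ) :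
    mass m δ x v n i φ ≤ mass m δ x v n i ψ :=
  Finset.sum_le_sum fun k _ => mul_le_mul_of_nonneg_right (h _) (weight_nonneg hδ n i k)

theorem mass_le (hδ : 0 < δ) {φ : X → ℝ} (hφ1 : ∀ z, φ z ≤ 1) {n i : ℕ} (hi : i ≤ m) :
    mass m δ x v n i φ ≤ n * (2 * m * n + m * δ) := by
  calc mass m δ x v n i φ ≤ ∑ k ∈ Finset.Icc 1 n, (2 * m * n + m * δ) := by
        refine Finset.sum_le_sum fun k _ => ?_
        have h1 := weight_le (δ := δ) (v := v) (n := n) hi k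
        have h2 := weight_nonneg (m := m) (v := v) hδ n i k
        nlinarith [hφ1 (x k)]
    _ = _ := by rw [Finset.sum_const, Nat.card_Icc, nsmul_eq_mul, Nat.add_sub_cancel]

theorem load_nonneg [Dist X] (hδ : 0 < δ) {r : ℝ} {φ : X → ℝ} (hφ : ∀ z, 0 ≤ φ z) (s : ℕ)
    (y : X) : 0 ≤ load m δ r x v s y φ :=
  add_nonneg (mass_nonneg hδ (fun z => mul_nonneg (near_nonneg _ _ _) (hφ z)) _ _)
    (mul_nonneg (by positivity) (hφ y))

theorem load_mono [Dist X] (hδ : 0 < δ) {r : ℝ} {φ ψ : X → ℝ} (h : ∀ z, φ z ≤ ψ z) (s : ℕ)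
    (y : X) : load m δ r x v s y φ ≤ load m δ r x v s y ψ :=
  add_le_add (mass_mono hδ (fun z => mul_le_mul_of_nonneg_left (h z) (near_nonneg _ _ _)) _ _)
    (mul_le_mul_of_nonneg_left (h y) (by positivity))

theorem load_one [Dist X] (r : ℝ) (s : ℕ) (y : X) :
    load m δ r x v s y (fun _ => 1) = mass m δ x v s m (near r y) + m * (1 + δ) := by
  simp [load]

theorem hit_nonneg {φ : X → ℝ} (hφ : ∀ z, 0 ≤ φ z) (n l : ℕ) : 0 ≤ hit x v n l φ :=
  Finset.sum_nonneg fun k _ => by split_ifs <;> simp [hφ]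

theorem hit_le_one {φ : X → ℝ} (hφ : ∀ z, φ z ≤ 1) (n l : ℕ) : hit x v n l φ ≤ 1 := by
  unfold hit
  rw [Finset.sum_ite_eq]
  split_ifs <;> simp [hφ]

theorem hit_of_mem (φ : X → ℝ) {n l : ℕ} (h : v n l ∈ Finset.Icc 1 n) :
    hit x v n l φ = φ (x (v n l)) := by
  rw [hit, Finset.sum_ite_eq, if_pos h]

theorem degree_succ_edge {n i : ℕ} (hn : 1 ≤ n) (k : ℕ) :
    degree m v n (i + 1) k
      = degree m v n i k + ((if n = k then 1 else 0) + (if v n (i + 1) = k then 1 else 0)) := by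
  obtain ⟨s, rfl⟩ : ∃ s, n = s + 1 := ⟨n - 1, by omega⟩
  unfold degree
  rw [Finset.sum_Icc_succ_top (by omega), Finset.sum_Icc_succ_top (by omega)]
  have h : ∀ a ∈ Finset.Icc 1 s, edgeCount m (s + 1) (i + 1) a = edgeCount m (s + 1) i a := by
    intro a ha
    have := Finset.mem_Icc.1 ha
    simp [edgeCount, Nat.lt_succ_iff.2 this.2]
  rw [Finset.sum_congr rfl fun a ha => by rw [h a ha]]
  simp only [edgeCount, lt_irrefl, if_false]
  rw [Finset.sum_Icc_succ_top (by omega : 1 ≤ i + 1), add_assoc]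

theorem degree_new_vertex (s k : ℕ) : degree m v (s + 1) 0 k = degree m v s m k := by
  unfold degree
  rw [Finset.sum_Icc_succ_top (by omega)]
  have h : ∀ a ∈ Finset.Icc 1 s, edgeCount m (s + 1) 0 a = edgeCount m s m a := by
    intro a ha
    have := Finset.mem_Icc.1 ha
    simp [edgeCount, Nat.lt_succ_iff.2 this.2]
  rw [Finset.sum_congr rfl fun a ha => by rw [h a ha]]
  simp [edgeCount]

theorem mass_succ_edge {n i : ℕ} (hn : 1 ≤ n) (φ : X → ℝ) :
    mass m δ x v n (i + 1) φ = mass m δ x v n i φ + φ (x n) + hit x v n (i + 1) φ := by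
  have h1 : φ (x n) = ∑ k ∈ Finset.Icc 1 n, if n = k then φ (x k) else 0 := by
    rw [Finset.sum_ite_eq, if_pos (Finset.mem_Icc.2 ⟨hn, le_rfl⟩)]
  rw [h1, mass, mass, hit, ← Finset.sum_add_distrib, ← Finset.sum_add_distrib]
  refine Finset.sum_congr rfl fun k _ => ?_
  rw [weight, weight, degree_succ_edge hn]
  push_cast
  split_ifs <;> ring

theorem urn_succ_edge [PseudoMetricSpace X] {r : ℝ} (hr : 0 ≤ r) (h : Admissible m r x v)
    {n i : ℕ} (hn : 1 ≤ n) (hi : i < m) (φ : X → ℝ) :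
    urn m δ r x v n (i + 1) φ = urn m δ r x v n i φ + hit x v n (i + 1) φ := by
  obtain ⟨h1, h2, h3⟩ := h n hn (i + 1) (Finset.mem_Icc.2 ⟨by omega, hi⟩)
  have hmem := Finset.mem_Icc.2 ⟨h1, h2⟩
  rw [urn, urn, mass_succ_edge hn, hit_of_mem _ hmem, hit_of_mem _ hmem, near_self hr, near,
    if_pos h3]
  push_cast
  ring

section Metric

variable [PseudoMetricSpace X] {r : ℝ}

theorem Admissible.degree_new_vertex_eq_zero (h : Admissible m r x v) (s : ℕ) :
    degree m v s m (s + 1) = 0 := by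
  refine Finset.sum_eq_zero fun a ha => Finset.sum_eq_zero fun l hl => ?_
  rw [Finset.mem_Icc] at ha
  have hl' : l ∈ Finset.Icc 1 m := by
    rw [Finset.mem_Icc] at hl ⊢
    refine ⟨hl.1, hl.2.trans ?_⟩
    unfold edgeCount; split_ifs <;> omega
  have := (h a ha.1 l hl').2.1
  rw [if_neg (by omega), if_neg (by omega), add_zero]

theorem mass_new_vertex (h : Admissible m r x v) (s : ℕ) (φ : X → ℝ) :
    mass m δ x v (s + 1) 0 φ = mass m δ x v s m φ + m * δ * φ (x (s + 1)) := by
  rw [mass, Finset.sum_Icc_succ_top (by omega), mass]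
  congr 1
  · exact Finset.sum_congr rfl fun k _ => by rw [weight, weight, degree_new_vertex]
  · rw [weight, degree_new_vertex, h.degree_new_vertex_eq_zero]
    push_cast; ring

theorem mass_succ (h : Admissible m r x v) (s : ℕ) (φ : X → ℝ) :
    mass m δ x v (s + 1) m φ = mass m δ x v s m φ + m * (1 + δ) * φ (x (s + 1))
      + ∑ l ∈ Finset.range m, hit x v (s + 1) (l + 1) φ := by
  have key : ∀ i, mass m δ x v (s + 1) i φ
      = mass m δ x v (s + 1) 0 φ + i * φ (x (s + 1))
        + ∑ l ∈ Finset.range i, hit x v (s + 1) (l + 1) φ := by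
    intro i
    induction i with
    | zero => simp
    | succ i ih =>
      rw [mass_succ_edge (by omega), ih, Finset.sum_range_succ]
      push_cast; ring
  rw [key, mass_new_vertex h]
  ring

theorem urn_zero (hr : 0 ≤ r) (h : Admissible m r x v) (s : ℕ) (φ : X → ℝ) :
    urn m δ r x v (s + 1) 0 φ = load m δ r x v s (x (s + 1)) φ := by
  rw [urn, mass_new_vertex h, load, near_self hr]
  push_cast; ring

theorem urn_one_eq (hr : 0 ≤ r) (h : Admissible m r x v) (s : ℕ) {i : ℕ} (hi : i ≤ m) :
    urn m δ r x v (s + 1) i (fun _ => 1) = load m δ r x v s (x (s + 1)) (fun _ => 1) + i := by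
  induction i with
  | zero => rw [urn_zero hr h]; simp
  | succ i ih =>
    obtain ⟨h1, h2, -⟩ := h (s + 1) (by omega) (i + 1) (Finset.mem_Icc.2 ⟨by omega, hi⟩)
    rw [urn_succ_edge hr h (by omega) hi, ih (by omega), hit_of_mem _ (Finset.mem_Icc.2 ⟨h1, h2⟩)]
    push_cast; ring

theorem edgeProb_mul (hr : 0 ≤ r) {n i k : ℕ} (hk : k ∈ Finset.Icc 1 n) (φ : X → ℝ) :
    φ (x k) * edgeProb m δ r x v n i k
      = (near r (x n) (x k) * φ (x k) * weight m δ v n i k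
          + if n = k then ((m : ℝ) - i) * φ (x k) else 0) / urn m δ r x v n i (fun _ => 1) := by
  have hZ : urn m δ r x v n i (fun _ => 1)
      = (∑ j ∈ Finset.Icc 1 n, if dist (x n) (x j) ≤ r then weight m δ v n i j else 0)
        + ((m : ℝ) - i) := by
    simp [urn, mass, near]
  rw [hZ, edgeProb, Finset.sum_filter, ← mul_div_assoc]
  congr 1
  by_cases h : k = n
  · subst h
    rw [if_pos rfl, if_pos rfl, near_self hr]; ring
  · rw [if_neg h, if_neg (Ne.symm h), near]
    split_ifs <;> ring

theorem sum_edgeProb_mul (hr : 0 ≤ r) {n : ℕ} (hn : 1 ≤ n) (i : ℕ) (φ : X → ℝ) :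
    ∑ k ∈ Finset.Icc 1 n, φ (x k) * edgeProb m δ r x v n i k
      = urn m δ r x v n i φ / urn m δ r x v n i (fun _ => 1) := by
  rw [Finset.sum_congr rfl fun k hk => edgeProb_mul hr hk φ, ← Finset.sum_div,
    Finset.sum_add_distrib, Finset.sum_ite_eq, if_pos (Finset.mem_Icc.2 ⟨hn, le_rfl⟩)]
  rfl

theorem urn_nonneg (hδ : 0 < δ) {φ : X → ℝ} (hφ : ∀ z, 0 ≤ φ z) {n i : ℕ} (hi : i < m) :
    0 ≤ urn m δ r x v n i φ := by
  have : (i : ℝ) ≤ m := by exact_mod_cast hi.le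
  exact add_nonneg (mass_nonneg hδ (fun z => mul_nonneg (near_nonneg _ _ _) (hφ z)) _ _)
    (mul_nonneg (by linarith) (hφ _))

theorem urn_one_pos (hδ : 0 < δ) {n i : ℕ} (hi : i < m) :
    0 < urn m δ r x v n i (fun _ => 1) := by
  have h1 : 0 ≤ mass m δ x v n i (fun z => near r (x n) z * 1) :=
    mass_nonneg hδ (fun z => mul_nonneg (near_nonneg _ _ _) zero_le_one) _ _
  have : (i : ℝ) < m := by exact_mod_cast hi
  unfold urn
  linarith

theorem urn_div_le_one (hδ : 0 < δ) {φ : X → ℝ} (hφ : ∀ z, φ z ≤ 1) {n i : ℕ}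
    (hi : i < m) : urn m δ r x v n i φ / urn m δ r x v n i (fun _ => 1) ≤ 1 := by
  rw [div_le_one (urn_one_pos hδ hi)]
  have : (i : ℝ) ≤ m := by exact_mod_cast hi.le
  exact add_le_add
    (mass_mono hδ (fun z => mul_le_mul_of_nonneg_left (hφ z) (near_nonneg _ _ _)) _ _)
    (mul_le_mul_of_nonneg_left (hφ _) (by linarith))

theorem load_one_pos (hm : 1 ≤ m) (hδ : 0 < δ) (s : ℕ) (y : X) :
    0 < load m δ r x v s y (fun _ => 1) := by
  have h1 : 0 ≤ mass m δ x v s m (fun z => near r y z * 1) :=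
    mass_nonneg hδ (fun z => mul_nonneg (near_nonneg _ _ _) zero_le_one) _ _
  have hm' : (0 : ℝ) < m := by exact_mod_cast hm
  have : 0 < (m : ℝ) * (1 + δ) * 1 := by positivity
  unfold load
  linarith

/-- All vertices that send an edge into the ball of radius `r` around `y` lie in the ball of
radius `2 r`. -/
theorem mass_le_of_double (hδ : 0 < δ) (hr : 0 ≤ r) (h : Admissible m r x v) (s : ℕ) (y : X) :
    mass m δ x v s m (near r y)
      ≤ m * (2 + δ) * ∑ a ∈ Finset.Icc 1 s, near (2 * r) y (x a) := by
  induction s with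
  | zero => simp [mass]
  | succ s ih =>
    rw [mass_succ h, Finset.sum_Icc_succ_top (by omega), mul_add]
    have h1 : near r y (x (s + 1)) ≤ near (2 * r) y (x (s + 1)) := by
      unfold near; split_ifs <;> linarith
    have h2 : ∑ l ∈ Finset.range m, hit x v (s + 1) (l + 1) (near r y)
        ≤ m * near (2 * r) y (x (s + 1)) := by
      calc _ ≤ ∑ l ∈ Finset.range m, near (2 * r) y (x (s + 1)) := by
            refine Finset.sum_le_sum fun l hl => ?_
            obtain ⟨h1, h2, h3⟩ := h (s + 1) (by omega) (l + 1)
              (Finset.mem_Icc.2 ⟨by omega, Finset.mem_range.1 hl⟩)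
            rw [hit_of_mem _ (Finset.mem_Icc.2 ⟨h1, h2⟩)]
            unfold near
            have := dist_triangle_right y (x (s + 1)) (x (v (s + 1) (l + 1)))
            split_ifs <;> linarith
        _ = _ := by simp
    have h3 : (m : ℝ) * (1 + δ) * near r y (x (s + 1))
        ≤ m * (1 + δ) * near (2 * r) y (x (s + 1)) := by gcongr
    linarith

/-- All neighbours of `V_k` lie in its detection region, so that its weight is at most `m (2 + δ)`
times the number of vertices there. -/
theorem mass_le_sum_pairs (hδ : 0 < δ) (hr : 0 ≤ r) (h : Admissible m r x v) (s : ℕ) (y : X) :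
    mass m δ x v s m (near r y)
      ≤ m * (2 + δ) * ∑ a ∈ Finset.Icc 1 s, ∑ k ∈ Finset.Icc 1 s,
          near r y (x k) * near r (x a) (x k) := by
  have key : mass m δ x v s m (near r y)
      ≤ m * (2 + δ) * ∑ a ∈ Finset.Icc 1 s, ∑ k ∈ Finset.Icc 1 a,
          near r y (x k) * near r (x a) (x k) := by
    induction s with
    | zero => simp [mass]
    | succ s ih =>
      rw [mass_succ h, Finset.sum_Icc_succ_top (by omega), mul_add]
      set R := ∑ k ∈ Finset.Icc 1 (s + 1), near r y (x k) * near r (x (s + 1)) (x k) with hR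
      have hle : ∀ k ∈ Finset.Icc 1 (s + 1), near r y (x k) * near r (x (s + 1)) (x k) ≤ R :=
        fun k hk => Finset.single_le_sum
          (f := fun k => near r y (x k) * near r (x (s + 1)) (x k))
          (fun k _ => mul_nonneg (near_nonneg _ _ _) (near_nonneg _ _ _)) hk
      have h1 : near r y (x (s + 1)) ≤ R := by
        have := hle (s + 1) (Finset.mem_Icc.2 ⟨by omega, le_rfl⟩)
        rwa [near_self hr, mul_one] at this
      have h2 : ∑ l ∈ Finset.range m, hit x v (s + 1) (l + 1) (near r y) ≤ m * R := by
        calc _ ≤ ∑ l ∈ Finset.range m, R := by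
              refine Finset.sum_le_sum fun l hl => ?_
              obtain ⟨h1, h2, h3⟩ := h (s + 1) (by omega) (l + 1)
                (Finset.mem_Icc.2 ⟨by omega, Finset.mem_range.1 hl⟩)
              have hmem := Finset.mem_Icc.2 ⟨h1, h2⟩
              rw [hit_of_mem _ hmem]
              have := hle _ hmem
              rwa [show near r (x (s + 1)) (x (v (s + 1) (l + 1))) = 1 from if_pos h3,
                mul_one] at this
          _ = _ := by simp
      have h3 : (m : ℝ) * (1 + δ) * near r y (x (s + 1)) ≤ m * (1 + δ) * R := by gcongr
      linarith
  refine key.trans (mul_le_mul_of_nonneg_left (Finset.sum_le_sum fun a ha => ?_) (by positivity))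
  refine Finset.sum_le_sum_of_subset_of_nonneg
    (Finset.Icc_subset_Icc_right (Finset.mem_Icc.1 ha).2) fun k _ _ =>
      mul_nonneg (near_nonneg _ _ _) (near_nonneg _ _ _)

/-- The weight common to two balls is at most the weight of one of them times the number of
vertices that they share. -/
theorem load_le_mul_count (hδ : 0 < δ) (s : ℕ) (y z : X) :
    load m δ r x v s z (near r y)
      ≤ (mass m δ x v s m (near r y) + m * (1 + δ))
        * (∑ k ∈ Finset.Icc 1 s, near r z (x k) * near r y (x k) + near r y z) := by
  have h0 := mass_nonneg (m := m) (x := x) (v := v) hδ (near_nonneg r y) s m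
  have hc : 0 ≤ (m : ℝ) * (1 + δ) := by positivity
  rw [load, mul_add (_ + _), Finset.mul_sum]
  refine add_le_add (Finset.sum_le_sum fun k hk => ?_) ?_
  · have h1 : near r y (x k) * weight m δ v s m k ≤ mass m δ x v s m (near r y) :=
      Finset.single_le_sum (f := fun k => near r y (x k) * weight m δ v s m k)
        (fun k _ => mul_nonneg (near_nonneg _ _ _) (weight_nonneg hδ _ _ _)) hk
    rcases near_eq_zero_or_one r z (x k) with h | h <;>
      rcases near_eq_zero_or_one r y (x k) with h' | h' <;> simp only [h, h'] at h1 ⊢ <;> linarith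
  · exact mul_le_mul_of_nonneg_right (by linarith) (near_nonneg _ _ _)

end Metric

end Trajectory

/-! ### Measurability and independence -/

section Measurability

variable {Z X : Type*} [MeasurableSpace Z]

/-- All positions and edges that make up `GPM_{n,i}` are measurable. -/
structure TrajectoryMeasurable [MeasurableSpace X] (m : ℕ) (V : ℕ → Z → X) (v : ℕ → ℕ → Z → ℕ)
    (n i : ℕ) : Prop where
  position : ∀ a ∈ Finset.Icc 1 n, Measurable (V a)
  target : ∀ a ∈ Finset.Icc 1 n, ∀ l ∈ Finset.Icc 1 (edgeCount m n i a), Measurable (v a l)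

theorem TrajectoryMeasurable.comp [MeasurableSpace X] {Y : Type*} [MeasurableSpace Y] {m : ℕ}
    {V : ℕ → Z → X} {v : ℕ → ℕ → Z → ℕ} {n i : ℕ} (h : TrajectoryMeasurable m V v n i) {g : Y → Z}
    (hg : Measurable g) :
    TrajectoryMeasurable m (fun a y => V a (g y)) (fun a l y => v a l (g y)) n i :=
  ⟨fun a ha => (h.position a ha).comp hg, fun a ha l hl => (h.target a ha l hl).comp hg⟩

variable {m : ℕ} {δ r : ℝ} {n i : ℕ}

section Plain

variable [MeasurableSpace X] {V : ℕ → Z → X} {v : ℕ → ℕ → Z → ℕ}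

theorem TrajectoryMeasurable.weight (h : TrajectoryMeasurable m V v n i) (k : ℕ) :
    Measurable fun z => weight m δ (v · · z) n i k := by
  have : Measurable fun z => degree m (v · · z) n i k := by
    unfold degree
    refine Finset.measurable_fun_sum _ fun a ha => Finset.measurable_fun_sum _ fun l hl => ?_
    refine measurable_const.add (Measurable.ite ?_ measurable_const measurable_const)
    exact (h.target a ha l hl) (measurableSet_singleton k)
  exact ((measurable_from_top (f := ((↑) : ℕ → ℝ))).comp this).add_const _

theorem TrajectoryMeasurable.hit (h : TrajectoryMeasurable m V v n i) (hn : 1 ≤ n) {l : ℕ}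
    (hl : l ∈ Finset.Icc 1 i) {φ : Z → X → ℝ}
    (hφ : ∀ f : Z → X, Measurable f → Measurable fun z => φ z (f z)) :
    Measurable fun z => hit (V · z) (v · · z) n l (φ z) := by
  unfold GPM.hit
  refine Finset.measurable_fun_sum _ fun k hk => ?_
  refine Measurable.ite ?_ (hφ _ (h.position k hk)) measurable_const
  refine (h.target n (Finset.mem_Icc.2 ⟨hn, le_rfl⟩) l ?_) (measurableSet_singleton k)
  simpa [edgeCount] using hl

theorem TrajectoryMeasurable.mass (h : TrajectoryMeasurable m V v n i) {φ : Z → X → ℝ}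
    (hφ : ∀ f : Z → X, Measurable f → Measurable fun z => φ z (f z)) :
    Measurable fun z => mass m δ (V · z) (v · · z) n i (φ z) := by
  unfold GPM.mass
  exact Finset.measurable_fun_sum _ fun k hk => (hφ _ (h.position k hk)).mul (h.weight k)

end Plain

variable [PseudoMetricSpace X] [SecondCountableTopology X] [MeasurableSpace X] [BorelSpace X]

theorem measurable_near {r : ℝ} {f g : Z → X} (hf : Measurable f) (hg : Measurable g) :
    Measurable fun z => near r (f z) (g z) :=
  Measurable.ite (measurableSet_le (hf.dist hg) measurable_const) measurable_const
    measurable_const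

variable {V : ℕ → Z → X} {v : ℕ → ℕ → Z → ℕ}

theorem TrajectoryMeasurable.load (h : TrajectoryMeasurable m V v n m) {y : Z → X}
    (hy : Measurable y) {φ : Z → X → ℝ}
    (hφ : ∀ f : Z → X, Measurable f → Measurable fun z => φ z (f z)) :
    Measurable fun z => load m δ r (V · z) (v · · z) n (y z) (φ z) := by
  unfold GPM.load
  exact (h.mass fun f hf => (measurable_near hy hf).mul (hφ f hf)).add ((hφ y hy).const_mul _)

theorem TrajectoryMeasurable.urn (hn : 1 ≤ n) (h : TrajectoryMeasurable m V v n i)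
    {φ : Z → X → ℝ} (hφ : ∀ f : Z → X, Measurable f → Measurable fun z => φ z (f z)) :
    Measurable fun z => urn m δ r (V · z) (v · · z) n i (φ z) := by
  have hVn := h.position n (Finset.mem_Icc.2 ⟨hn, le_rfl⟩)
  unfold GPM.urn
  exact (h.mass fun f hf => (measurable_near hVn hf).mul (hφ f hf)).add
    ((hφ _ hVn).const_mul _)

theorem TrajectoryMeasurable.edgeProb (h : TrajectoryMeasurable m V v n i) (hn : 1 ≤ n) {k : ℕ}
    (hk : k ∈ Finset.Icc 1 n) (hr : 0 ≤ r) :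
    Measurable fun z => edgeProb m δ r (V · z) (v · · z) n i k := by
  have hVn := h.position n (Finset.mem_Icc.2 ⟨hn, le_rfl⟩)
  have := fun z => edgeProb_mul (m := m) (δ := δ) (x := (V · z)) (v := (v · · z)) (i := i)
    hr hk (fun _ => 1)
  simp only [one_mul, mul_one] at this
  simp only [this]
  exact (((measurable_near hVn (h.position k hk)).mul (h.weight k)).add measurable_const).div
    (h.urn hn fun _ _ => measurable_const)

end Measurability

theorem integrable_of_abs_le {Ω : Type*} [MeasurableSpace Ω] {P : Measure Ω} [IsFiniteMeasure P]
    {f : Ω → ℝ} (hf : Measurable f) (B : ℝ) (hB : ∀ ω, |f ω| ≤ B) : Integrable f P :=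
  Integrable.of_bound hf.aestronglyMeasurable B (ae_of_all _ hB)

theorem integral_indepFun {Ω Ω' S : Type*} [MeasurableSpace Ω] [MeasurableSpace Ω']
    [MeasurableSpace S] {P : Measure Ω} [IsProbabilityMeasure P] {ι : Ω → Ω'} {V : Ω → S}
    (hι : Measurable ι) (hV : Measurable V) (h : ProbabilityTheory.IndepFun ι V P)
    {g : Ω' × S → ℝ} (hg : Measurable g) :
    ∫ ω, g (ι ω, V ω) ∂P = ∫ z, g (ι z.1, z.2) ∂(P.prod (P.map V)) := by
  have : IsProbabilityMeasure (P.map V) := Measure.isProbabilityMeasure_map hV.aemeasurable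
  have h1 := (ProbabilityTheory.indepFun_iff_map_prod_eq_prod_map_map hι.aemeasurable
    hV.aemeasurable).1 h
  have h2 : (P.prod (P.map V)).map (Prod.map ι id) = (P.map ι).prod (P.map V) := by
    rw [← Measure.map_prod_map _ _ hι measurable_id, Measure.map_id]
  rw [← integral_map (f := g) (hι.prodMk hV).aemeasurable hg.aestronglyMeasurable, h1, ← h2,
    integral_map (hι.prodMap measurable_id).aemeasurable hg.aestronglyMeasurable]
  rfl

/-- If `V` is independent of the sigma-algebra `𝓗`, then in the expectation of a function of `V`
that is otherwise `𝓗`-measurable, `V` can be replaced by an independent copy. -/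
theorem integral_indep {Ω S : Type*} {𝓗 mΩ : MeasurableSpace Ω} [MeasurableSpace S]
    {P : Measure Ω} [IsProbabilityMeasure P] {V : Ω → S} (hV : Measurable V)
    (h𝓗 : 𝓗 ≤ mΩ)
    (h : ProbabilityTheory.Indep (MeasurableSpace.comap V inferInstance) 𝓗 P)
    {g : Ω × S → ℝ} (hg : Measurable[𝓗.prod inferInstance] g) :
    ∫ ω, g (ω, V ω) ∂P = ∫ z, g z ∂(P.prod (P.map V)) := by
  refine @integral_indepFun Ω Ω S mΩ 𝓗 _ P _ id V (fun s hs => h𝓗 s hs) hV ?_ g hg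
  refine (@ProbabilityTheory.IndepFun_iff_Indep Ω Ω S mΩ 𝓗 _ id V P).2 ?_
  rw [MeasurableSpace.comap_id]
  exact h.symm

/-! ### Expectations along the process -/

namespace IsGPM

variable {Ω : Type*} [mΩ : MeasurableSpace Ω] {P : Measure Ω} {d m : ℕ}
  {δ r : ℝ} {V : ℕ → Ω → Sphere d} {v : ℕ → ℕ → Ω → ℕ}

theorem history_le (h : IsGPM P d m δ r V v) {n i : ℕ} (hi : i ≤ m) :
    history m V v n i ≤ mΩ := by
  refine sup_le (iSup₂_le fun a ha => ?_) (iSup₂_le fun a ha => iSup₂_le fun l hl => ?_)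
  · exact (h.measurable_position a (Finset.mem_Icc.1 ha).1).comap_le
  · rw [Finset.mem_Icc] at ha hl
    refine (h.measurable_target a l ha.1 hl.1 (hl.2.trans ?_)).comap_le
    unfold edgeCount; split_ifs <;> omega

theorem trajectoryMeasurable (h : IsGPM P d m δ r V v) {n i : ℕ} (hi : i ≤ m) :
    TrajectoryMeasurable m V v n i := by
  refine ⟨fun a ha => h.measurable_position a (Finset.mem_Icc.1 ha).1, fun a ha l hl => ?_⟩
  rw [Finset.mem_Icc] at ha hl
  refine h.measurable_target a l ha.1 hl.1 (hl.2.trans ?_)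
  unfold edgeCount; split_ifs <;> omega

end IsGPM

theorem trajectoryMeasurable_history {Ω X : Type*} [MeasurableSpace X] (m : ℕ) (V : ℕ → Ω → X)
    (v : ℕ → ℕ → Ω → ℕ) (n i : ℕ) :
    @TrajectoryMeasurable Ω X (history m V v n i) _ m V v n i := by
  refine @TrajectoryMeasurable.mk Ω X (history m V v n i) _ m V v n i ?_ ?_
  · intro a ha
    rw [measurable_iff_comap_le]
    exact le_sup_of_le_left
      (le_iSup₂ (f := fun a _ => MeasurableSpace.comap (V a) inferInstance) a ha)
  · intro a ha l hl
    rw [measurable_iff_comap_le]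
    refine le_sup_of_le_right ?_
    refine le_trans ?_ (le_iSup₂ (f := fun a _ => ⨆ l ∈ Finset.Icc 1 (edgeCount m n i a),
      MeasurableSpace.comap (v a l) inferInstance) a ha)
    exact le_iSup₂ (f := fun l _ => MeasurableSpace.comap (v a l) inferInstance) l hl

theorem history_mono_edge {Ω X : Type*} [MeasurableSpace X] (m : ℕ) (V : ℕ → Ω → X)
    (v : ℕ → ℕ → Ω → ℕ) (n : ℕ) {i j : ℕ} (hij : i ≤ j) :
    history m V v n i ≤ history m V v n j := by
  refine sup_le_sup le_rfl (iSup₂_mono fun a ha => ?_)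
  refine biSup_mono fun l hl => ?_
  rw [Finset.mem_Icc] at hl ⊢
  refine ⟨hl.1, hl.2.trans ?_⟩
  unfold edgeCount; split_ifs <;> omega

theorem history_le_succ {Ω X : Type*} [MeasurableSpace X] (m : ℕ) (V : ℕ → Ω → X)
    (v : ℕ → ℕ → Ω → ℕ) (s : ℕ) :
    history m V v s m ≤ history m V v (s + 1) 0 := by
  have hsub : ∀ a ∈ Finset.Icc 1 s, a ∈ Finset.Icc 1 (s + 1) := fun a ha => by
    rw [Finset.mem_Icc] at ha ⊢; omega
  refine sup_le_sup (biSup_mono hsub) (iSup₂_le fun a ha => ?_)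
  refine le_trans (biSup_mono fun l hl => ?_)
    (le_iSup₂ (f := fun a _ => ⨆ l ∈ Finset.Icc 1 (edgeCount m (s + 1) 0 a),
      MeasurableSpace.comap (v a l) inferInstance) a (hsub a ha))
  rw [Finset.mem_Icc] at ha hl ⊢
  refine ⟨hl.1, hl.2.trans ?_⟩
  unfold edgeCount; split_ifs <;> omega

namespace IsGPM

variable {Ω : Type*} [mΩ : MeasurableSpace Ω] {P : Measure Ω} [IsProbabilityMeasure P] {d m : ℕ}
  {δ r : ℝ} {V : ℕ → Ω → Sphere d} {v : ℕ → ℕ → Ω → ℕ}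

/-- Given the past of the edge `e_{n,i+1}`, its target is `V_k` with probability `edgeProb`. -/
theorem integral_edge (h : IsGPM P d m δ r V v) {n i k : ℕ} (hi : i < m)
    (hk : k ∈ Finset.Icc 1 n) {f : Ω → ℝ} (hf : Measurable[history m V v n i] f) {B : ℝ}
    (hB : ∀ ω, |f ω| ≤ B) :
    ∫ ω, f ω * (if v n (i + 1) ω = k then 1 else 0) ∂P
      = ∫ ω, f ω * edgeProb m δ r (V · ω) (v · · ω) n i k ∂P := by
  rw [Finset.mem_Icc] at hk
  have hn : 1 ≤ n := hk.1.trans hk.2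
  have hle := h.history_le (n := n) hi.le
  have hset : MeasurableSet {ω | v n (i + 1) ω = k} :=
    h.measurable_target n (i + 1) hn (by omega) hi (measurableSet_singleton k)
  set g : Ω → ℝ := Set.indicator {ω | v n (i + 1) ω = k} (fun _ => (1 : ℝ)) with hg
  have hgm : Measurable g := measurable_const.indicator hset
  have hg1 : ∀ ω, |g ω| ≤ 1 := fun ω => by
    rw [hg, Set.indicator_apply]; split_ifs <;> simp
  have hfm : Measurable f := hf.mono hle le_rfl
  have hfg : Integrable (f * g) P := by
    refine integrable_of_abs_le (hfm.mul hgm) B fun ω => ?_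
    rw [Pi.mul_apply, abs_mul]
    calc |f ω| * |g ω| ≤ |f ω| * 1 := mul_le_mul_of_nonneg_left (hg1 ω) (abs_nonneg _)
      _ ≤ B := by rw [mul_one]; exact hB ω
  have h1 := condExp_mul_of_stronglyMeasurable_left (m := history m V v n i) hf.stronglyMeasurable
    hfg (integrable_of_abs_le hgm 1 hg1)
  have h2 := h.edge n i k hn hi hk.1 hk.2
  calc ∫ ω, f ω * (if v n (i + 1) ω = k then 1 else 0) ∂P = ∫ ω, (f * g) ω ∂P := by
        refine integral_congr_ae (ae_of_all _ fun ω => ?_)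
        simp [hg, Set.indicator_apply]
    _ = ∫ ω, (P[f * g | history m V v n i]) ω ∂P := (integral_condExp hle).symm
    _ = _ := by
        refine integral_congr_ae ?_
        filter_upwards [h1, h2] with ω h1 h2
        rw [h1, Pi.mul_apply, h2]

/-- The expected value of `φ` at the target of an edge is the proportion of the weight counted with
`φ`, jointly with any bounded function of the past. -/
theorem integral_hit (h : IsGPM P d m δ r V v) (hδ : 0 < δ) (hr : 0 ≤ r) {n i : ℕ} (hn : 1 ≤ n)
    (hi : i < m) {φ : Sphere d → ℝ} (hφ : Measurable φ) (hφ0 : ∀ z, 0 ≤ φ z) (hφ1 : ∀ z, φ z ≤ 1)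
    {f : Ω → ℝ} (hf : Measurable[history m V v n i] f) {B : ℝ} (hB : ∀ ω, |f ω| ≤ B) :
    ∫ ω, f ω * hit (V · ω) (v · · ω) n (i + 1) φ ∂P
      = ∫ ω, f ω * (urn m δ r (V · ω) (v · · ω) n i φ
          / urn m δ r (V · ω) (v · · ω) n i (fun _ => 1)) ∂P := by
  have hfφ : ∀ k ∈ Finset.Icc 1 n, Measurable[history m V v n i] fun ω => f ω * φ (V k ω) :=
    fun k hk => hf.mul (hφ.comp
      (@TrajectoryMeasurable.position _ _ (_) _ _ _ _ _ _
        (trajectoryMeasurable_history m V v n i) k hk))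
  have hfφB : ∀ k ω, |f ω * φ (V k ω)| ≤ B := fun k ω => by
    rw [abs_mul, abs_of_nonneg (hφ0 _)]
    calc |f ω| * φ (V k ω) ≤ |f ω| * 1 := mul_le_mul_of_nonneg_left (hφ1 _) (abs_nonneg _)
      _ ≤ B := by rw [mul_one]; exact hB ω
  have hle := h.history_le (n := n) hi.le
  have htm := h.trajectoryMeasurable (n := n) hi.le
  have hint1 : ∀ k ∈ Finset.Icc 1 n, Integrable
      (fun ω => f ω * φ (V k ω) * (if v n (i + 1) ω = k then 1 else 0)) P := fun k hk => by
    refine integrable_of_abs_le (((hfφ k hk).mono hle le_rfl).mul (Measurable.ite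
      (h.measurable_target n (i + 1) hn (by omega) hi (measurableSet_singleton k))
      measurable_const measurable_const)) B fun ω => ?_
    split_ifs
    · rw [mul_one]; exact hfφB k ω
    · rw [mul_zero, abs_zero]; exact (abs_nonneg _).trans (hB ω)
  have hprob : ∀ k ∈ Finset.Icc 1 n, ∀ ω,
      |edgeProb m δ r (V · ω) (v · · ω) n i k| ≤ 1 := fun k hk ω => by
    have h0 : ∀ j ∈ Finset.Icc 1 n, 0 ≤ edgeProb m δ r (V · ω) (v · · ω) n i j := fun j hj => by
      have := edgeProb_mul (m := m) (δ := δ) (x := (V · ω)) (v := (v · · ω)) (i := i) hr hj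
        (fun _ => 1)
      rw [one_mul] at this
      rw [this]
      have hi' : (i : ℝ) ≤ m := by exact_mod_cast hi.le
      refine div_nonneg (add_nonneg (mul_nonneg (mul_nonneg (near_nonneg _ _ _) zero_le_one)
        (weight_nonneg hδ _ _ _)) ?_) (urn_one_pos hδ hi).le
      split_ifs
      · linarith
      · exact le_rfl
    have h1 := sum_edgeProb_mul (m := m) (δ := δ) (x := (V · ω)) (v := (v · · ω)) hr hn i
      (fun _ => 1)
    rw [div_self (urn_one_pos hδ hi).ne'] at h1
    simp only [one_mul] at h1
    rw [abs_of_nonneg (h0 k hk), ← h1]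
    exact Finset.single_le_sum h0 hk
  have hint2 : ∀ k ∈ Finset.Icc 1 n, Integrable
      (fun ω => f ω * φ (V k ω) * edgeProb m δ r (V · ω) (v · · ω) n i k) P := fun k hk => by
    refine integrable_of_abs_le (((hfφ k hk).mono hle le_rfl).mul (htm.edgeProb hn hk hr)) B
      fun ω => ?_
    rw [abs_mul]
    calc _ ≤ |f ω * φ (V k ω)| * 1 :=
          mul_le_mul_of_nonneg_left (hprob k hk ω) (abs_nonneg _)
      _ ≤ B := by rw [mul_one]; exact hfφB k ω
  calc _ = ∫ ω, ∑ k ∈ Finset.Icc 1 n,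
          f ω * φ (V k ω) * (if v n (i + 1) ω = k then 1 else 0) ∂P := by
        refine integral_congr_ae (ae_of_all _ fun ω => ?_)
        simp only [hit, Finset.mul_sum]
        exact Finset.sum_congr rfl fun k _ => by split_ifs <;> simp
    _ = ∑ k ∈ Finset.Icc 1 n,
          ∫ ω, f ω * φ (V k ω) * (if v n (i + 1) ω = k then 1 else 0) ∂P :=
        integral_finsetSum _ hint1
    _ = ∑ k ∈ Finset.Icc 1 n,
          ∫ ω, f ω * φ (V k ω) * edgeProb m δ r (V · ω) (v · · ω) n i k ∂P :=
        Finset.sum_congr rfl fun k hk => h.integral_edge hi hk (hfφ k hk) (hfφB k)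
    _ = ∫ ω, ∑ k ∈ Finset.Icc 1 n,
          f ω * φ (V k ω) * edgeProb m δ r (V · ω) (v · · ω) n i k ∂P :=
        (integral_finsetSum _ hint2).symm
    _ = _ := by
        refine integral_congr_ae (ae_of_all _ fun ω => ?_)
        simp only []
        rw [← sum_edgeProb_mul hr hn, Finset.mul_sum]
        exact Finset.sum_congr rfl fun k _ => mul_assoc _ _ _

/-- Almost surely, every edge ends at a vertex that is present and in the detection region. -/
theorem ae_admissible (h : IsGPM P d m δ r V v) (hδ : 0 < δ) (hr : 0 ≤ r) :
    ∀ᵐ ω ∂P, Admissible m r (V · ω) (v · · ω) := by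
  unfold Admissible
  rw [ae_all_iff]; intro n
  by_cases hn : 1 ≤ n
  swap
  · exact ae_of_all _ fun ω h => absurd h hn
  have hmem : ∀ i < m, ∀ᵐ ω ∂P, v n (i + 1) ω ∈ Finset.Icc 1 n := fun i hi => by
    have h1 := h.integral_hit hδ hr hn hi (φ := fun _ => 1) measurable_const
      (fun _ => zero_le_one) (fun _ => le_rfl) (f := fun _ => 1) measurable_const (B := 1) (by simp)
    have hone : ∀ ω, urn m δ r (V · ω) (v · · ω) n i (fun _ => 1)
          / urn m δ r (V · ω) (v · · ω) n i (fun _ => 1) = 1 :=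
      fun ω => div_self (urn_one_pos hδ hi).ne'
    simp only [hone, one_mul] at h1
    have hhm : Measurable fun ω => hit (V · ω) (v · · ω) n (i + 1) (fun _ => 1) :=
      (h.trajectoryMeasurable (n := n) (i := i + 1) hi).hit hn (Finset.mem_Icc.2 ⟨by omega, le_rfl⟩)
        fun _ _ => measurable_const
    have hh1 := fun ω => hit_le_one (x := (V · ω)) (v := (v · · ω)) (φ := fun _ => 1)
      (fun _ => le_rfl) n (i + 1)
    have hh0 := fun ω => hit_nonneg (x := (V · ω)) (v := (v · · ω)) (φ := fun _ => 1)
      (fun _ => zero_le_one) n (i + 1)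
    have hint : Integrable (fun ω => hit (V · ω) (v · · ω) n (i + 1) (fun _ => 1)) P :=
      integrable_of_abs_le hhm 1 fun ω => by rw [abs_of_nonneg (hh0 ω)]; exact hh1 ω
    -- with `φ = 1`, `hit` indicates that the target is present
    have h2 : ∫ ω, (1 - hit (V · ω) (v · · ω) n (i + 1) (fun _ => 1)) ∂P = 0 := by
      rw [integral_sub (integrable_const _) hint, h1]; simp
    rw [integral_eq_zero_iff_of_nonneg (fun ω => sub_nonneg.2 (hh1 ω))
      ((integrable_const _).sub hint)] at h2
    filter_upwards [h2] with ω hω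
    by_contra hcon
    have : hit (V · ω) (v · · ω) n (i + 1) (fun _ => 1) = 0 :=
      Finset.sum_eq_zero fun k hk => if_neg fun heq => hcon ((show v n (i + 1) ω = k from heq) ▸ hk)
    simp [this] at hω
  have hfar : ∀ i < m, ∀ k ∈ Finset.Icc 1 n,
      ∀ᵐ ω ∂P, v n (i + 1) ω = k → dist (V n ω) (V k ω) ≤ r := fun i hi k hk => by
    have hpos := @TrajectoryMeasurable.position _ _ (_) _ _ _ _ _ _
      (trajectoryMeasurable_history m V v n i)
    have hfm : Measurable[history m V v n i] fun ω => 1 - near r (V n ω) (V k ω) :=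
      measurable_const.sub (@measurable_near _ _ (_) _ _ _ _ r _ _
        (hpos n (Finset.mem_Icc.2 ⟨hn, le_rfl⟩)) (hpos k hk))
    have hf0 : ∀ ω, 0 ≤ 1 - near r (V n ω) (V k ω) := fun ω => sub_nonneg.2 (near_le_one _ _ _)
    have hf1 : ∀ ω, |1 - near r (V n ω) (V k ω)| ≤ 1 := fun ω => by
      rw [abs_of_nonneg (hf0 ω)]; linarith [near_nonneg r (V n ω) (V k ω)]
    have h1 := h.integral_edge hi hk hfm hf1
    have h2 : ∀ ω, (1 - near r (V n ω) (V k ω)) * edgeProb m δ r (V · ω) (v · · ω) n i k = 0 := by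
      intro ω
      rcases near_eq_zero_or_one r (V n ω) (V k ω) with h0 | h0
      · have h3 := edgeProb_mul (m := m) (δ := δ) (x := (V · ω)) (v := (v · · ω)) (i := i) hr hk
          (fun _ => 1)
        have hkn : n ≠ k := by
          rintro rfl; rw [near_self hr] at h0; exact one_ne_zero h0
        rw [h0, if_neg hkn] at h3
        simp only [one_mul, zero_mul, add_zero, zero_div] at h3
        rw [h3, mul_zero]
      · rw [h0, sub_self, zero_mul]
    simp only [h2, integral_zero] at h1
    have hite : ∀ ω, (0 : ℝ) ≤ (1 - near r (V n ω) (V k ω))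
        * (if v n (i + 1) ω = k then 1 else 0) := fun ω =>
      mul_nonneg (hf0 ω) (by split_ifs <;> simp)
    rw [integral_eq_zero_iff_of_nonneg hite] at h1
    · filter_upwards [h1] with ω hω heq
      by_contra hcon
      simp [heq, near, hcon] at hω
    · refine integrable_of_abs_le ((hfm.mono (h.history_le hi.le) le_rfl).mul (Measurable.ite
        (h.measurable_target n (i + 1) hn (by omega) hi (measurableSet_singleton k))
        measurable_const measurable_const)) 1 fun ω => ?_
      rw [abs_of_nonneg (hite ω)]
      have := hf1 ω
      rw [abs_of_nonneg (hf0 ω)] at this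
      split_ifs <;> linarith
  have hmem' : ∀ᵐ ω ∂P, ∀ i < m, v n (i + 1) ω ∈ Finset.Icc 1 n :=
    ae_all_iff.2 fun i => Filter.eventually_imp_distrib_left.2 fun hi => hmem i hi
  have hfar' : ∀ᵐ ω ∂P, ∀ i < m, ∀ k ∈ Finset.Icc 1 n,
      v n (i + 1) ω = k → dist (V n ω) (V k ω) ≤ r :=
    ae_all_iff.2 fun i => Filter.eventually_imp_distrib_left.2 fun hi =>
      ae_all_iff.2 fun k => Filter.eventually_imp_distrib_left.2 fun hk => hfar i hi k hk
  filter_upwards [hmem', hfar'] with ω h1 h2 _ l hl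
  rw [Finset.mem_Icc] at hl
  obtain ⟨i, rfl⟩ : ∃ i, l = i + 1 := ⟨l - 1, by omega⟩
  have h3 := h1 i (by omega)
  exact ⟨(Finset.mem_Icc.1 h3).1, (Finset.mem_Icc.1 h3).2, h2 i (by omega) _ h3 rfl⟩

end IsGPM

/-! ### One step of the process -/

/-- The weight in the ball around `z.2` in `GPM_s`, increased by the share `m (1 + δ)` of a new
vertex at `z.2`. -/
noncomputable def regionWeight {Ω X : Type*} [Dist X] (m : ℕ) (δ r : ℝ) (V : ℕ → Ω → X)
    (v : ℕ → ℕ → Ω → ℕ) (s : ℕ) (z : Ω × X) : ℝ :=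
  load m δ r (V · z.1) (v · · z.1) s z.2 (fun _ => 1)

/-- The number of the vertices `V_1, …, V_s` in the ball around `z.2`. -/
noncomputable def regionCount {Ω X : Type*} [Dist X] (r : ℝ) (V : ℕ → Ω → X) (s : ℕ)
    (z : Ω × X) : ℝ :=
  ∑ k ∈ Finset.Icc 1 s, near r z.2 (V k z.1)

theorem load_le {X : Type*} [Dist X] {m : ℕ} {δ r : ℝ} {x : ℕ → X} {v : ℕ → ℕ → ℕ} (hδ : 0 < δ)
    {φ : X → ℝ} (hφ0 : ∀ z, 0 ≤ φ z) (hφ : ∀ z, φ z ≤ 1) (s : ℕ) (y : X) :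
    load m δ r x v s y φ ≤ s * (2 * m * s + m * δ) + m * (1 + δ) := by
  refine add_le_add (mass_le hδ (fun z => ?_) le_rfl) ?_
  · exact mul_le_one₀ (near_le_one _ _ _) (hφ0 z) (hφ z)
  · exact mul_le_of_le_one_right (by positivity) (hφ y)

section

variable {Ω : Type*} {d m : ℕ} {δ r p : ℝ} {V : ℕ → Ω → Sphere d} {v : ℕ → ℕ → Ω → ℕ}

theorem regionWeight_nonneg (hδ : 0 < δ) (s : ℕ) (z : Ω × Sphere d) :
    0 ≤ regionWeight m δ r V v s z := load_nonneg hδ (fun _ => zero_le_one) _ _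

theorem regionWeight_le (hδ : 0 < δ) (s : ℕ) (z : Ω × Sphere d) :
    regionWeight m δ r V v s z ≤ s * (2 * m * s + m * δ) + m * (1 + δ) :=
  load_le hδ (fun _ => zero_le_one) (fun _ => le_rfl) _ _

theorem load_div_le_one (hm : 1 ≤ m) (hδ : 0 < δ) (s : ℕ) (z : Ω × Sphere d)
    {φ : Sphere d → ℝ} (hφ : ∀ y, φ y ≤ 1) :
    load m δ r (V · z.1) (v · · z.1) s z.2 φ / regionWeight m δ r V v s z ≤ 1 :=
  (div_le_one (load_one_pos hm hδ _ _)).2 (load_mono hδ hφ _ _)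

theorem load_div_nonneg (hδ : 0 < δ) (s : ℕ) (z : Ω × Sphere d) {φ : Sphere d → ℝ}
    (hφ : ∀ y, 0 ≤ φ y) :
    0 ≤ load m δ r (V · z.1) (v · · z.1) s z.2 φ / regionWeight m δ r V v s z :=
  div_nonneg (load_nonneg hδ hφ _ _) (regionWeight_nonneg hδ _ _)

theorem TrajectoryMeasurable.fst {Z : Type*} [MeasurableSpace Z] {V : ℕ → Z → Sphere d}
    {v : ℕ → ℕ → Z → ℕ} {n i : ℕ} (h : TrajectoryMeasurable m V v n i) :
    TrajectoryMeasurable m (fun a (z : Z × Sphere d) => V a z.1) (fun a l z => v a l z.1) n i :=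
  h.comp measurable_fst

theorem TrajectoryMeasurable.regionWeight {Z : Type*} [MeasurableSpace Z] {V : ℕ → Z → Sphere d}
    {v : ℕ → ℕ → Z → ℕ} {s : ℕ} (h : TrajectoryMeasurable m V v s m) :
    Measurable (regionWeight m δ r V v s) :=
  h.fst.load measurable_snd fun _ _ => measurable_const

theorem TrajectoryMeasurable.load_near {Z : Type*} [MeasurableSpace Z] {V : ℕ → Z → Sphere d}
    {v : ℕ → ℕ → Z → ℕ} {s : ℕ} (h : TrajectoryMeasurable m V v s m) (x : Sphere d) :
    Measurable fun z : Z × Sphere d =>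
      GPM.load m δ r (V · z.1) (v · · z.1) s z.2 (near r x) :=
  h.fst.load measurable_snd fun _ hf => measurable_near measurable_const hf

namespace IsGPM

variable [MeasurableSpace Ω] {P : Measure Ω} [IsProbabilityMeasure P]

/-- In the urn that governs the `m` edges of a new vertex, the proportion of any part of the weight
is a martingale: each edge adds its target once more, and increases the total by `1`. -/
theorem integral_urn (h : IsGPM P d m δ r V v) (hδ : 0 < δ) (hr : 0 ≤ r) (s : ℕ)
    {φ : Sphere d → ℝ} (hφ : Measurable φ) (hφ0 : ∀ z, 0 ≤ φ z) (hφ1 : ∀ z, φ z ≤ 1) {i : ℕ}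
    (hi : i < m) {f : Ω → ℝ} (hf : Measurable[history m V v (s + 1) 0] f) {B : ℝ}
    (hB : ∀ ω, |f ω| ≤ B) :
    ∫ ω, f ω * (urn m δ r (V · ω) (v · · ω) (s + 1) i φ
          / urn m δ r (V · ω) (v · · ω) (s + 1) i (fun _ => 1)) ∂P
      = ∫ ω, f ω * (urn m δ r (V · ω) (v · · ω) (s + 1) 0 φ
          / urn m δ r (V · ω) (v · · ω) (s + 1) 0 (fun _ => 1)) ∂P := by
  induction i generalizing f B with
  | zero => rfl
  | succ i ih =>
    have hi' : i < m := by omega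
    have hm : 0 < m := by omega
    set Z₀ : Ω → ℝ := fun ω => urn m δ r (V · ω) (v · · ω) (s + 1) 0 (fun _ => 1) with hZ₀
    have hZpos : ∀ ω, 0 < Z₀ ω := fun ω => urn_one_pos hδ hm
    -- the total weight before the edge `e_{s+1,i+1}` is `Z₀ + i`
    set f' : Ω → ℝ := fun ω => f ω / (Z₀ ω + i + 1) with hf'
    have hZm : Measurable[history m V v (s + 1) 0] Z₀ :=
      @TrajectoryMeasurable.urn Ω (Sphere d) (_) m δ r (s + 1) 0 _ _ _ _ V v (by omega)
        (trajectoryMeasurable_history m V v (s + 1) 0) (fun _ _ => 1) (fun _ _ => measurable_const)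
    have hf'm : Measurable[history m V v (s + 1) 0] f' :=
      hf.div ((hZm.add_const _).add_const _)
    have hf'B : ∀ ω, |f' ω| ≤ B := fun ω => by
      have h1 : (1 : ℝ) ≤ Z₀ ω + i + 1 := by
        have := hZpos ω
        have : (0 : ℝ) ≤ i := Nat.cast_nonneg i
        linarith
      rw [hf', abs_div, abs_of_pos (by linarith : 0 < Z₀ ω + i + 1)]
      exact (div_le_self (abs_nonneg _) h1).trans (hB ω)
    have hurnm : Measurable fun ω => urn m δ r (V · ω) (v · · ω) (s + 1) i φ :=
      (h.trajectoryMeasurable hi'.le).urn (by omega) fun _ hf => hφ.comp hf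
    have hadm := h.ae_admissible hδ hr
    have hle := h.history_le (n := s + 1) (Nat.zero_le m)
    have hhit : Measurable fun ω => hit (V · ω) (v · · ω) (s + 1) (i + 1) φ :=
      (h.trajectoryMeasurable hi.le).hit (by omega) (Finset.mem_Icc.2 ⟨by omega, le_rfl⟩)
        fun _ hf => hφ.comp hf
    have hint1 : Integrable (fun ω => f' ω * urn m δ r (V · ω) (v · · ω) (s + 1) i φ) P := by
      refine integrable_of_abs_le ((hf'm.mono hle le_rfl).mul hurnm)
        (B * (((s + 1 : ℕ) : ℝ) * (2 * m * (s + 1 : ℕ) + m * δ) + m)) fun ω => ?_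
      rw [abs_mul, abs_of_nonneg (urn_nonneg hδ hφ0 hi')]
      refine mul_le_mul (hf'B ω) ?_ (urn_nonneg hδ hφ0 hi') ((abs_nonneg _).trans (hf'B ω))
      refine add_le_add (mass_le hδ (fun z => mul_le_one₀ (near_le_one _ _ _) (hφ0 z) (hφ1 z))
        hi'.le) ?_
      have : (i : ℝ) ≤ m := by exact_mod_cast hi'.le
      nlinarith [hφ0 (V (s + 1) ω), hφ1 (V (s + 1) ω), (Nat.cast_nonneg i : (0 : ℝ) ≤ i)]
    have hint2 : Integrable (fun ω => f' ω * hit (V · ω) (v · · ω) (s + 1) (i + 1) φ) P := by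
      refine integrable_of_abs_le ((hf'm.mono hle le_rfl).mul hhit) B fun ω => ?_
      rw [abs_mul, abs_of_nonneg (hit_nonneg hφ0 _ _)]
      calc _ ≤ |f' ω| * 1 := mul_le_mul_of_nonneg_left (hit_le_one hφ1 _ _) (abs_nonneg _)
        _ ≤ B := by rw [mul_one]; exact hf'B ω
    have hint3 : Integrable (fun ω => f' ω * (urn m δ r (V · ω) (v · · ω) (s + 1) i φ
        / urn m δ r (V · ω) (v · · ω) (s + 1) i (fun _ => 1))) P := by
      refine integrable_of_abs_le ((hf'm.mono hle le_rfl).mul (hurnm.div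
        ((h.trajectoryMeasurable hi'.le).urn (by omega) fun _ _ => measurable_const))) B fun ω => ?_
      rw [abs_mul, abs_of_nonneg (div_nonneg (urn_nonneg hδ hφ0 hi') (urn_one_pos hδ hi').le)]
      calc _ ≤ |f' ω| * 1 := mul_le_mul_of_nonneg_left (urn_div_le_one hδ hφ1 hi') (abs_nonneg _)
        _ ≤ B := by rw [mul_one]; exact hf'B ω
    rw [← ih hi' hf hB]
    calc _ = ∫ ω, (f' ω * urn m δ r (V · ω) (v · · ω) (s + 1) i φ
            + f' ω * hit (V · ω) (v · · ω) (s + 1) (i + 1) φ) ∂P := by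
          refine integral_congr_ae ?_
          filter_upwards [hadm] with ω hω
          have h1 := urn_one_eq (δ := δ) hr hω s hi.le
          have h0 := urn_zero (δ := δ) hr hω s (fun _ => 1)
          rw [← h0] at h1
          rw [h1, urn_succ_edge hr hω (by omega) hi']
          simp only [hf', hZ₀]
          push_cast
          ring
      _ = ∫ ω, f' ω * urn m δ r (V · ω) (v · · ω) (s + 1) i φ ∂P
            + ∫ ω, f' ω * (urn m δ r (V · ω) (v · · ω) (s + 1) i φ
              / urn m δ r (V · ω) (v · · ω) (s + 1) i (fun _ => 1)) ∂P := by
          rw [integral_add hint1 hint2, h.integral_hit hδ hr (by omega) hi' hφ hφ0 hφ1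
            (hf'm.mono (history_mono_edge m V v (s + 1) (Nat.zero_le i)) le_rfl) hf'B]
      _ = _ := by
          rw [← integral_add hint1 hint3]
          refine integral_congr_ae ?_
          filter_upwards [hadm] with ω hω
          have h1 := urn_one_eq (δ := δ) hr hω s hi'.le
          have h0 := urn_zero (δ := δ) hr hω s (fun _ => 1)
          rw [← h0] at h1
          have h2 := hZpos ω
          simp only [hf', h1]
          change f ω / (Z₀ ω + i + 1) * _ + f ω / (Z₀ ω + i + 1) * (_ / (Z₀ ω + i))
            = f ω * (_ / (Z₀ ω + i))
          have h3 : Z₀ ω + i ≠ 0 := by positivity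
          have h4 : Z₀ ω + i + 1 ≠ 0 := by positivity
          field_simp

/-- The expected increment of the weight in the ball around `x`, jointly with a bounded function
`f` of the past. -/
theorem integral_increment (h : IsGPM P d m δ r V v) (hm : 1 ≤ m) (hδ : 0 < δ) (hr : 0 ≤ r)
    {x : Sphere d} (hp : ∫ y, near r x y ∂(area d) = p) (s : ℕ) {f : Ω → ℝ}
    (hf : Measurable[history m V v s m] f) {B : ℝ} (hB : ∀ ω, |f ω| ≤ B) :
    ∫ ω, f ω * (m * (1 + δ) * near r x (V (s + 1) ω)
        + ∑ l ∈ Finset.range m, hit (V · ω) (v · · ω) (s + 1) (l + 1) (near r x)) ∂P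
      = m * (1 + δ) * p * ∫ ω, f ω ∂P
        + m * ∫ z, f z.1 * (load m δ r (V · z.1) (v · · z.1) s z.2 (near r x)
            / regionWeight m δ r V v s z) ∂(P.prod (area d)) := by
  have hV := h.measurable_position (s + 1) (by omega)
  have hprob : IsProbabilityMeasure (area d) := by
    rw [← h.uniform (s + 1) (by omega)]; exact Measure.isProbabilityMeasure_map hV.aemeasurable
  have hle := h.history_le (n := s) le_rfl
  have hfm := hf.mono hle le_rfl
  have hφ : Measurable (near r x) := measurable_near measurable_const measurable_id
  have hindep := h.indep (s + 1) (by omega)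
  rw [Nat.add_sub_cancel] at hindep
  have hf0 : Measurable[history m V v (s + 1) 0] f := hf.mono (history_le_succ m V v s) le_rfl
  have hint1 : Integrable (fun ω => f ω * (m * (1 + δ) * near r x (V (s + 1) ω))) P := by
    refine integrable_of_abs_le (hfm.mul ((hφ.comp hV).const_mul _)) (B * (m * (1 + δ)))
      fun ω => ?_
    rw [abs_mul, abs_of_nonneg (mul_nonneg (by positivity) (near_nonneg _ _ _))]
    exact mul_le_mul (hB ω) (mul_le_of_le_one_right (by positivity) (near_le_one _ _ _))
      (mul_nonneg (by positivity) (near_nonneg _ _ _)) ((abs_nonneg _).trans (hB ω))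
  have hint2 : ∀ l ∈ Finset.range m,
      Integrable (fun ω => f ω * hit (V · ω) (v · · ω) (s + 1) (l + 1) (near r x)) P :=
    fun l hl => by
    refine integrable_of_abs_le (hfm.mul ((h.trajectoryMeasurable
      (Nat.succ_le_of_lt (Finset.mem_range.1 hl))).hit (by omega)
      (Finset.mem_Icc.2 ⟨by omega, le_rfl⟩) fun _ hg => hφ.comp hg)) B fun ω => ?_
    rw [abs_mul, abs_of_nonneg (hit_nonneg (near_nonneg r x) _ _)]
    calc _ ≤ |f ω| * 1 :=
          mul_le_mul_of_nonneg_left (hit_le_one (near_le_one r x) _ _) (abs_nonneg _)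
      _ ≤ B := by rw [mul_one]; exact hB ω
  have hpos : ∫ ω, f ω * (m * (1 + δ) * near r x (V (s + 1) ω)) ∂P
      = m * (1 + δ) * p * ∫ ω, f ω ∂P := by
    have hg : Measurable[(history m V v s m).prod inferInstance]
        fun z : Ω × Sphere d => f z.1 * (m * (1 + δ) * near r x z.2) :=
      (hf.comp measurable_fst).mul ((hφ.comp measurable_snd).const_mul _)
    rw [integral_indep hV hle hindep hg, h.uniform (s + 1) (by omega),
      integral_prod_mul (f := f) (g := fun y => m * (1 + δ) * near r x y), integral_const_mul, hp]
    ring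
  have hedge : ∀ l ∈ Finset.range m,
      ∫ ω, f ω * hit (V · ω) (v · · ω) (s + 1) (l + 1) (near r x) ∂P
        = ∫ z, f z.1 * (load m δ r (V · z.1) (v · · z.1) s z.2 (near r x)
            / regionWeight m δ r V v s z) ∂(P.prod (area d)) := fun l hl => by
    have hl' := Finset.mem_range.1 hl
    rw [h.integral_hit hδ hr (by omega) hl' hφ (near_nonneg r x) (near_le_one r x)
      (hf0.mono (history_mono_edge m V v (s + 1) (Nat.zero_le l)) le_rfl) hB,
      h.integral_urn hδ hr s hφ (near_nonneg r x) (near_le_one r x) hl' hf0 hB]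
    have hT := trajectoryMeasurable_history m V v s m
    have hg : Measurable[(history m V v s m).prod inferInstance]
        fun z : Ω × Sphere d => f z.1 * (load m δ r (V · z.1) (v · · z.1) s z.2 (near r x)
          / regionWeight m δ r V v s z) :=
      (hf.comp measurable_fst).mul
        ((@TrajectoryMeasurable.load_near d m δ r Ω (_) V v s hT x).div
          (@TrajectoryMeasurable.regionWeight d m δ r Ω (_) V v s hT))
    rw [← h.uniform (s + 1) (by omega), ← integral_indep hV hle hindep hg]
    refine integral_congr_ae ?_
    filter_upwards [h.ae_admissible hδ hr] with ω hω
    rw [urn_zero hr hω, urn_zero hr hω]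
    rfl
  calc _ = ∫ ω, (f ω * (m * (1 + δ) * near r x (V (s + 1) ω))
        + ∑ l ∈ Finset.range m,
          f ω * hit (V · ω) (v · · ω) (s + 1) (l + 1) (near r x)) ∂P := by
        refine integral_congr_ae (ae_of_all _ fun ω => ?_)
        simp only [mul_add, Finset.mul_sum]
    _ = _ := by
        rw [integral_add hint1 (integrable_finsetSum _ hint2), integral_finsetSum _ hint2, hpos,
          Finset.sum_congr rfl hedge, Finset.sum_const, Finset.card_range, nsmul_eq_mul]

end IsGPM

end

section

variable {Ω : Type*} {d m : ℕ} {δ r p : ℝ} {V : ℕ → Ω → Sphere d} {v : ℕ → ℕ → Ω → ℕ}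

theorem integrable_near {μ : Measure (Sphere d)} [IsFiniteMeasure μ] (r : ℝ) (x : Sphere d) :
    Integrable (near r x) μ :=
  integrable_of_abs_le (measurable_near measurable_const measurable_id) 1 fun y => by
    rw [abs_of_nonneg (near_nonneg _ _ _)]; exact near_le_one _ _ _

theorem regionWeight_succ {ω : Ω} (h : Admissible m r (V · ω) (v · · ω)) (s : ℕ) (x : Sphere d) :
    regionWeight m δ r V v (s + 1) (ω, x) = regionWeight m δ r V v s (ω, x)
      + (m * (1 + δ) * near r x (V (s + 1) ω)
        + ∑ l ∈ Finset.range m, hit (V · ω) (v · · ω) (s + 1) (l + 1) (near r x)) := by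
  rw [regionWeight, regionWeight, load_one, load_one, mass_succ h]
  ring

theorem increment_nonneg (hδ : 0 < δ) (s : ℕ) (ω : Ω) (x : Sphere d) :
    0 ≤ m * (1 + δ) * near r x (V (s + 1) ω)
        + ∑ l ∈ Finset.range m, hit (V · ω) (v · · ω) (s + 1) (l + 1) (near r x) :=
  add_nonneg (mul_nonneg (by positivity) (near_nonneg _ _ _))
    (Finset.sum_nonneg fun _ _ => hit_nonneg (near_nonneg r x) _ _)

theorem increment_le (hδ : 0 < δ) (s : ℕ) (ω : Ω) (x : Sphere d) :
    m * (1 + δ) * near r x (V (s + 1) ω)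
        + ∑ l ∈ Finset.range m, hit (V · ω) (v · · ω) (s + 1) (l + 1) (near r x)
      ≤ m * (2 + δ) := by
  have h1 : (m : ℝ) * (1 + δ) * near r x (V (s + 1) ω) ≤ m * (1 + δ) :=
    mul_le_of_le_one_right (by positivity) (near_le_one _ _ _)
  have h2 : ∑ l ∈ Finset.range m, hit (V · ω) (v · · ω) (s + 1) (l + 1) (near r x) ≤ m := by
    calc _ ≤ ∑ l ∈ Finset.range m, (1 : ℝ) :=
          Finset.sum_le_sum fun l _ => hit_le_one (near_le_one r x) _ _
      _ = m := by simp
  linarith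

theorem TrajectoryMeasurable.load_near_prod {Z : Type*} [MeasurableSpace Z]
    {V : ℕ → Z → Sphere d} {v : ℕ → ℕ → Z → ℕ} {s : ℕ} (h : TrajectoryMeasurable m V v s m) :
    Measurable fun q : (Z × Sphere d) × Sphere d =>
      GPM.load m δ r (V · q.1.1) (v · · q.1.1) s q.1.2 (near r q.2) :=
  (h.comp (g := fun q : (Z × Sphere d) × Sphere d => q.1.1)
    (measurable_fst.comp measurable_fst)).load (measurable_snd.comp measurable_fst)
      fun _ hf => measurable_near measurable_snd hf

theorem TrajectoryMeasurable.regionWeight_left {Z : Type*} [MeasurableSpace Z]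
    {V : ℕ → Z → Sphere d} {v : ℕ → ℕ → Z → ℕ} {s : ℕ} (h : TrajectoryMeasurable m V v s m)
    (x : Sphere d) : Measurable fun ω => GPM.regionWeight m δ r V v s (ω, x) :=
  h.regionWeight.comp (measurable_id.prodMk measurable_const)

theorem regionWeight_pos (hm : 1 ≤ m) (hδ : 0 < δ) (s : ℕ) (z : Ω × Sphere d) :
    0 < regionWeight m δ r V v s z := load_one_pos hm hδ _ _

theorem TrajectoryMeasurable.regionCount {Z : Type*} [MeasurableSpace Z] {V : ℕ → Z → Sphere d}
    {v : ℕ → ℕ → Z → ℕ} {s i : ℕ} (h : TrajectoryMeasurable m V v s i) :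
    Measurable (regionCount r V s) :=
  Finset.measurable_fun_sum _ fun k hk =>
    measurable_near measurable_snd ((h.position k hk).comp measurable_fst)

theorem regionCount_nonneg (s : ℕ) (z : Ω × Sphere d) : 0 ≤ regionCount r V s z :=
  Finset.sum_nonneg fun _ _ => near_nonneg _ _ _

theorem regionCount_le (s : ℕ) (z : Ω × Sphere d) : regionCount r V s z ≤ s := by
  calc regionCount r V s z ≤ ∑ k ∈ Finset.Icc 1 s, (1 : ℝ) :=
        Finset.sum_le_sum fun _ _ => near_le_one _ _ _
    _ = s := by simp

/-- Integrating the weight common to two balls over the centre of one of them. -/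
theorem integral_load_left {μ : Measure (Sphere d)} [IsFiniteMeasure μ]
    (hp : ∀ x, ∫ y, near r x y ∂μ = p) (s : ℕ) (ω : Ω) (x : Sphere d) :
    ∫ y, load m δ r (V · ω) (v · · ω) s y (near r x) ∂μ
      = p * regionWeight m δ r V v s (ω, x) := by
  have hint : ∀ k ∈ Finset.Icc 1 s, Integrable (fun y => near r y (V k ω) * near r x (V k ω)
      * weight m δ (v · · ω) s m k) μ := fun k _ => by
    simp only [near_comm r _ (V k ω)]
    exact ((integrable_near r _).mul_const _).mul_const _
  unfold load mass
  rw [integral_add (integrable_finsetSum _ hint) ((integrable_near r x).const_mul _),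
    integral_finsetSum _ hint, integral_const_mul, hp, regionWeight, load_one, mass,
    mul_add p, Finset.mul_sum, mul_comm p (m * (1 + δ) : ℝ)]
  congr 1
  refine Finset.sum_congr rfl fun k _ => ?_
  rw [integral_mul_const, integral_mul_const]
  simp only [near_comm r _ (V k ω)]
  rw [hp]; ring

theorem integral_load_right {μ : Measure (Sphere d)} [IsFiniteMeasure μ]
    (hp : ∀ x, ∫ y, near r x y ∂μ = p) (s : ℕ) (z : Ω × Sphere d) :
    ∫ x, load m δ r (V · z.1) (v · · z.1) s z.2 (near r x) ∂μ
      = p * regionWeight m δ r V v s z := by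
  rw [← integral_load_left hp s z.1 z.2]
  refine integral_congr_ae (ae_of_all _ fun x => ?_)
  simp only [load, mass, near_comm r x z.2]
  congr 1
  refine Finset.sum_congr rfl fun k _ => ?_
  rw [mul_comm (near r z.2 _) (near r x _)]

end

/-- Inequalities that hold for every position `x` of the centre are integrated over `x`. -/
theorem integral_le_of_forall {Ω Z S : Type*} [MeasurableSpace Ω] [MeasurableSpace Z]
    [MeasurableSpace S] {P : Measure Ω} [IsFiniteMeasure P] {Q : Measure Z} [IsFiniteMeasure Q]
    {μ : Measure S} [IsFiniteMeasure μ] {f g : Ω × S → ℝ} {k : Z × S → ℝ}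
    (hf : Integrable f (P.prod μ)) (hg : Integrable g (P.prod μ)) (hk : Integrable k (Q.prod μ))
    (h : ∀ x, ∫ ω, f (ω, x) ∂P ≤ ∫ ω, g (ω, x) ∂P + ∫ z, k (z, x) ∂Q) :
    ∫ z, f z ∂(P.prod μ) ≤ ∫ z, g z ∂(P.prod μ) + ∫ z, ∫ x, k (z, x) ∂μ ∂Q := by
  rw [integral_prod_symm f hf, integral_prod_symm g hg, ← integral_prod k hk,
    integral_prod_symm k hk, ← integral_add hg.integral_prod_right hk.integral_prod_right]
  exact integral_mono hf.integral_prod_right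
    (hg.integral_prod_right.add hk.integral_prod_right) h

namespace IsGPM

variable {Ω : Type*} [MeasurableSpace Ω] {P : Measure Ω} [IsProbabilityMeasure P] {d m : ℕ}
  {δ r p : ℝ} {V : ℕ → Ω → Sphere d} {v : ℕ → ℕ → Ω → ℕ}

theorem isProbabilityMeasure_area (h : IsGPM P d m δ r V v) : IsProbabilityMeasure (area d) := by
  rw [← h.uniform 1 le_rfl]
  exact Measure.isProbabilityMeasure_map (h.measurable_position 1 le_rfl).aemeasurable

/-- An exponential moment of the weight in a region, truncated at `1`. New vertices `y` whose
detection region has a weight of at least `m p (s + 1) / w` send edges at the rate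
`w / (s + 1)` times the present weight; the truncation allows the other ones to be counted
separately, each with the probability that it falls near the region. -/
theorem upper_step (h : IsGPM P d m δ r V v) (hm : 1 ≤ m) (hδ : 0 < δ) (hr : 0 ≤ r) (hp0 : 0 < p)
    (hp : ∀ x, ∫ y, near r x y ∂(area d) = p) {w κ lam : ℝ} (hw : 0 ≤ w) (hκ0 : 0 ≤ κ)
    (hκ1 : κ ≤ 1) (hlam0 : 0 ≤ lam) (hlam : lam * (m * (2 + δ)) ≤ κ) (c : ℝ) (s : ℕ) :
    ∫ z, min 1 (Real.exp (lam * regionWeight m δ r V v (s + 1) z + c)) ∂(P.prod (area d))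
      ≤ ∫ z, min 1 (Real.exp (lam * (1 + (1 + κ) * w / ((s : ℝ) + 1)) * regionWeight m δ r V v s z
            + (c + (1 + κ) * lam * (m * (1 + δ) * p)))) ∂(P.prod (area d))
        + m * p * (P.prod (area d)).real
            {z | w * regionWeight m δ r V v s z < m * p * ((s : ℝ) + 1)} := by
  have hprob := h.isProbabilityMeasure_area
  have hT := h.trajectoryMeasurable (n := s) le_rfl
  have hT1 := h.trajectoryMeasurable (n := s + 1) le_rfl
  have hW := hT.regionWeight (δ := δ) (r := r)
  have hm0 : (0 : ℝ) < m := by exact_mod_cast hm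
  set bad : Set (Ω × Sphere d) := {z | w * regionWeight m δ r V v s z < m * p * ((s : ℝ) + 1)}
    with hbad
  have hbadm : MeasurableSet bad := measurableSet_lt (hW.const_mul _) measurable_const
  have hmin0 : ∀ t : ℝ, 0 ≤ min 1 (Real.exp t) := fun t => le_min zero_le_one (Real.exp_pos _).le
  set k : (Ω × Sphere d) × Sphere d → ℝ := fun q => m * (bad.indicator (fun _ => (1 : ℝ)) q.1
    * (load m δ r (V · q.1.1) (v · · q.1.1) s q.1.2 (near r q.2)
      / regionWeight m δ r V v s q.1)) with hk
  have hind0 : ∀ z, 0 ≤ bad.indicator (fun _ => (1 : ℝ)) z := fun z =>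
    Set.indicator_nonneg (fun _ _ => zero_le_one) z
  have hind1 : ∀ z, bad.indicator (fun _ => (1 : ℝ)) z ≤ 1 := fun z =>
    Set.indicator_le_self' (fun _ _ => zero_le_one) z
  have hk0 : ∀ q, 0 ≤ k q := fun q => mul_nonneg hm0.le (mul_nonneg (hind0 _)
    (load_div_nonneg hδ s q.1 (near_nonneg r q.2)))
  have hk1 : ∀ q, k q ≤ m := fun q => mul_le_of_le_one_right hm0.le (mul_le_one₀ (hind1 _)
    (load_div_nonneg hδ s q.1 (near_nonneg r q.2))
    (load_div_le_one hm hδ s q.1 (near_le_one r q.2)))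
  have hkm : Measurable k := (((measurable_const.indicator hbadm).comp measurable_fst).mul
    (hT.load_near_prod.div (hW.comp measurable_fst))).const_mul _
  have hkint : ∀ z, ∫ x, k (z, x) ∂(area d) = m * p * bad.indicator (fun _ => (1 : ℝ)) z := by
    intro z
    simp only [hk, div_eq_mul_inv]
    rw [integral_const_mul, integral_const_mul, integral_mul_const, integral_load_right hp,
      mul_assoc p, mul_inv_cancel₀ (regionWeight_pos hm hδ _ _).ne']
    ring
  have key := integral_le_of_forall (P := P) (Q := P.prod (area d)) (μ := area d)
    (f := fun z => min 1 (Real.exp (lam * regionWeight m δ r V v (s + 1) z + c)))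
    (g := fun z => min 1 (Real.exp (lam * (1 + (1 + κ) * w / ((s : ℝ) + 1))
      * regionWeight m δ r V v s z + (c + (1 + κ) * lam * (m * (1 + δ) * p))))) (k := k)
    (integrable_of_abs_le (measurable_const.min
      ((hT1.regionWeight.const_mul _).add_const _).exp) 1 fun z => by
        rw [abs_of_nonneg (hmin0 _)]; exact min_le_left _ _)
    (integrable_of_abs_le (measurable_const.min ((hW.const_mul _).add_const _).exp) 1 fun z => by
        rw [abs_of_nonneg (hmin0 _)]; exact min_le_left _ _)
    (integrable_of_abs_le hkm m fun q => by rw [abs_of_nonneg (hk0 q)]; exact hk1 q) ?_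
  · refine key.trans (le_of_eq ?_)
    simp only [hkint]
    rw [integral_const_mul, integral_indicator_const _ hbadm, smul_eq_mul, mul_one]
  intro x
  set W : Ω → ℝ := fun ω => regionWeight m δ r V v s (ω, x) with hWdef
  set lam' := lam * (1 + (1 + κ) * w / ((s : ℝ) + 1)) with hlam'
  set c' := c + (1 + κ) * lam * (m * (1 + δ) * p) with hc'
  have hll : lam ≤ lam' := le_mul_of_one_le_right hlam0 (by
    have : 0 ≤ (1 + κ) * w / ((s : ℝ) + 1) := by positivity
    linarith)
  have hcc : c ≤ c' := by
    have : 0 ≤ (1 + κ) * lam * (m * (1 + δ) * p) := by positivity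
    linarith
  have hW0 : ∀ ω, 0 ≤ W ω := fun ω => regionWeight_nonneg hδ s _
  -- `e` is the current exponential, cut off where it is not small; there `b` takes over.
  set e : Ω → ℝ := fun ω => if lam' * W ω + c' ≤ 0 then Real.exp (lam * W ω + c) else 0 with he
  set b : Ω → ℝ := fun ω => if lam' * W ω + c' ≤ 0 then 0 else 1 with hb
  have he0 : ∀ ω, 0 ≤ e ω := fun ω => by
    simp only [he]; split_ifs
    · exact (Real.exp_pos _).le
    · exact le_rfl
  have he1 : ∀ ω, e ω ≤ 1 := fun ω => by
    simp only [he]; split_ifs with hcase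
    · refine Real.exp_le_one_iff.2 (le_trans ?_ hcase)
      nlinarith [hW0 ω]
    · exact zero_le_one
  have hb0 : ∀ ω, 0 ≤ b ω := fun ω => by simp only [hb]; split_ifs <;> norm_num
  have hb1 : ∀ ω, b ω ≤ 1 := fun ω => by simp only [hb]; split_ifs <;> norm_num
  have hThist := trajectoryMeasurable_history m V v s m
  have hWhist : Measurable[history m V v s m] W :=
    @TrajectoryMeasurable.regionWeight_left d m δ r Ω (_) V v s hThist x
  have hF : Measurable fun t : ℝ => if lam' * t + c' ≤ 0 then Real.exp (lam * t + c) else 0 :=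
    Measurable.ite (measurableSet_le ((measurable_id.const_mul _).add_const _) measurable_const)
      ((measurable_id.const_mul _).add_const _).exp measurable_const
  have hehist : Measurable[history m V v s m] e := hF.comp hWhist
  have hle := h.history_le (n := s) le_rfl
  have hem : Measurable e := hehist.mono hle le_rfl
  have hWm : Measurable W := hWhist.mono hle le_rfl
  have hbm : Measurable b := Measurable.ite (measurableSet_le ((hWm.const_mul _).add_const _)
    measurable_const) measurable_const measurable_const
  set a := (1 + κ) * lam with ha
  have ha0 : 0 ≤ a := by positivity
  have ha1 : a ≤ 1 := by
    have : (1 : ℝ) ≤ m := by exact_mod_cast hm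
    have h2 : (2 : ℝ) ≤ m * (2 + δ) := by nlinarith
    have h3 : lam * 2 ≤ lam * (m * (2 + δ)) := mul_le_mul_of_nonneg_left h2 hlam0
    nlinarith
  set f : Ω → ℝ := fun ω => a * e ω with hf
  have hf0 : ∀ ω, 0 ≤ f ω := fun ω => mul_nonneg ha0 (he0 ω)
  have hf1 : ∀ ω, f ω ≤ 1 := fun ω => mul_le_one₀ ha1 (he0 ω) (he1 ω)
  have hfhist : Measurable[history m V v s m] f := hehist.const_mul _
  have hfm : Measurable f := hem.const_mul _
  set D : Ω → ℝ := fun ω => m * (1 + δ) * near r x (V (s + 1) ω)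
        + ∑ l ∈ Finset.range m, hit (V · ω) (v · · ω) (s + 1) (l + 1) (near r x) with hD
  have hD0 : ∀ ω, 0 ≤ D ω := fun ω => increment_nonneg hδ s ω x
  have hD1 : ∀ ω, D ω ≤ m * (2 + δ) := fun ω => increment_le hδ s ω x
  have hDm : Measurable D := by
    refine ((measurable_near measurable_const (h.measurable_position (s + 1) (by omega))).const_mul
      _).add (Finset.measurable_fun_sum _ fun l hl => ?_)
    exact (h.trajectoryMeasurable (Nat.succ_le_of_lt (Finset.mem_range.1 hl))).hit (by omega)
      (Finset.mem_Icc.2 ⟨by omega, le_rfl⟩) fun _ hg => measurable_near measurable_const hg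
  have hbe : Integrable (fun ω => b ω + e ω) P :=
    integrable_of_abs_le (hbm.add hem) 2 fun ω => by
      rw [abs_of_nonneg (add_nonneg (hb0 ω) (he0 ω))]; linarith [hb1 ω, he1 ω]
  have hfint : Integrable f P := integrable_of_abs_le hfm 1 fun ω => by
    rw [abs_of_nonneg (hf0 ω)]; exact hf1 ω
  have hfD : Integrable (fun ω => f ω * D ω) P :=
    integrable_of_abs_le (hfm.mul hDm) (1 * (m * (2 + δ))) fun ω => by
      rw [abs_of_nonneg (mul_nonneg (hf0 ω) (hD0 ω))]
      exact mul_le_mul (hf1 ω) (hD1 ω) (hD0 ω) zero_le_one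
  set K : ℝ := s * (2 * m * s + m * δ) + m * (1 + δ) with hK
  have hfW : Integrable (fun ω => f ω * W ω) P :=
    integrable_of_abs_le (hfm.mul hWm) (1 * K) fun ω => by
      rw [abs_of_nonneg (mul_nonneg (hf0 ω) (hW0 ω))]
      exact mul_le_mul (hf1 ω) (regionWeight_le hδ s _) (hW0 ω) zero_le_one
  set Lx : Ω × Sphere d → ℝ := fun z => load m δ r (V · z.1) (v · · z.1) s z.2 (near r x) with hLx
  have hL0 : ∀ z, 0 ≤ Lx z := fun z => load_nonneg hδ (near_nonneg r x) _ _
  have hLm : Measurable Lx := hT.load_near x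
  have hfL : Integrable (fun z => f z.1 * Lx z) (P.prod (area d)) :=
    integrable_of_abs_le ((hfm.comp measurable_fst).mul hLm) (1 * K) fun z => by
      rw [abs_of_nonneg (mul_nonneg (hf0 _) (hL0 z))]
      exact mul_le_mul (hf1 _) (load_le hδ (near_nonneg r x) (near_le_one r x) s _) (hL0 z)
        zero_le_one
  have hkx : Integrable (fun z => k (z, x)) (P.prod (area d)) :=
    integrable_of_abs_le (hkm.comp (measurable_id.prodMk measurable_const)) m fun z => by
      rw [abs_of_nonneg (hk0 _)]; exact hk1 _
  have hs0 : (0 : ℝ) < (s : ℝ) + 1 := by positivity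
  have hinc := h.integral_increment hm hδ hr (hp x) s hfhist (B := 1) fun ω => by
    rw [abs_of_nonneg (hf0 ω)]; exact hf1 ω
  have hstep1 : ∫ ω, min 1 (Real.exp (lam * regionWeight m δ r V v (s + 1) (ω, x) + c)) ∂P
      ≤ ∫ ω, (b ω + e ω + f ω * D ω) ∂P := by
    refine integral_mono_ae (integrable_of_abs_le (measurable_const.min
      (((hT1.regionWeight.comp (measurable_id.prodMk measurable_const)).const_mul _).add_const
        _).exp) 1 fun z => by rw [abs_of_nonneg (hmin0 _)]; exact min_le_left _ _)
      (hbe.add hfD) ?_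
    filter_upwards [h.ae_admissible hδ hr] with ω hω
    rw [regionWeight_succ hω]
    by_cases hcase : lam' * W ω + c' ≤ 0
    · refine (min_le_right _ _).trans ?_
      have hbω : b ω = 0 := if_pos hcase
      have heω : e ω = Real.exp (lam * W ω + c) := if_pos hcase
      have ht : lam * D ω ≤ κ := (mul_le_mul_of_nonneg_left (hD1 ω) hlam0).trans hlam
      have h2 := exp_le_one_add_mul hκ1 (mul_nonneg hlam0 (hD0 ω)) ht
      have h3 : lam * (W ω + D ω) + c = lam * W ω + c + lam * D ω := by ring
      change Real.exp (lam * (W ω + D ω) + c) ≤ _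
      rw [h3, Real.exp_add, ← heω, hbω]
      have := mul_le_mul_of_nonneg_left h2 (he0 ω)
      simp only [hf, ha]
      linarith
    · refine (min_le_left _ _).trans ?_
      have hbω : b ω = 1 := if_neg hcase
      have := mul_nonneg (hf0 ω) (hD0 ω)
      linarith [he0 ω]
  have hstep2 : m * ∫ z, f z.1 * (Lx z / regionWeight m δ r V v s z) ∂(P.prod (area d))
      ≤ ∫ ω, w / ((s : ℝ) + 1) * (f ω * W ω) ∂P + ∫ z, k (z, x) ∂(P.prod (area d)) := by
    have h1 : ∫ ω, w / ((s : ℝ) + 1) * (f ω * W ω) ∂P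
        = ∫ z, w / (p * ((s : ℝ) + 1)) * (f z.1 * Lx z) ∂(P.prod (area d)) := by
      rw [integral_const_mul, integral_const_mul, integral_prod _ hfL]
      simp only [integral_const_mul, hLx, integral_load_left hp]
      rw [← integral_const_mul, ← integral_const_mul]
      refine integral_congr_ae (ae_of_all _ fun ω => ?_)
      simp only [hWdef]
      field_simp
    rw [h1, ← integral_add (hfL.const_mul _) hkx, ← integral_const_mul]
    have hfR : Integrable (fun z => f z.1 * (Lx z / regionWeight m δ r V v s z))
        (P.prod (area d)) := by
      refine integrable_of_abs_le (f := fun z => f z.1 * (Lx z / regionWeight m δ r V v s z))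
        ((hfm.comp measurable_fst).mul (hLm.div hW)) 1 fun z => ?_
      rw [abs_of_nonneg (mul_nonneg (hf0 _) (load_div_nonneg hδ s z (near_nonneg r x)))]
      exact mul_le_one₀ (hf1 _) (load_div_nonneg hδ s z (near_nonneg r x))
        (load_div_le_one hm hδ s z (near_le_one r x))
    refine integral_mono (hfR.const_mul _) ((hfL.const_mul _).add hkx) fun z => ?_
    · have hZ : 0 < regionWeight m δ r V v s z := regionWeight_pos hm hδ _ _
      have hf0' := hf0 z.1
      have hL0' := hL0 z
      by_cases hz : z ∈ bad
      · simp only [hk, Set.indicator_of_mem hz]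
        have h3 : 0 ≤ w / (p * ((s : ℝ) + 1)) * (f z.1 * Lx z) := by positivity
        have h4 : f z.1 * (Lx z / regionWeight m δ r V v s z)
            ≤ 1 * (Lx z / regionWeight m δ r V v s z) :=
          mul_le_mul_of_nonneg_right (hf1 _) (by positivity)
        have h5 := mul_le_mul_of_nonneg_left h4 hm0.le
        linarith
      · simp only [hk, Set.indicator_of_notMem hz]
        have h3 : m * p * ((s : ℝ) + 1) ≤ w * regionWeight m δ r V v s z := not_lt.1 hz
        have h4 : (m : ℝ) / regionWeight m δ r V v s z ≤ w / (p * ((s : ℝ) + 1)) := by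
          rw [div_le_div_iff₀ hZ (by positivity)]; linarith
        have h5 := mul_le_mul_of_nonneg_right h4 (mul_nonneg hf0' hL0')
        calc _ = (m : ℝ) / regionWeight m δ r V v s z * (f z.1 * Lx z) := by ring
          _ ≤ _ := h5
          _ = _ := by ring
  have hstep3 : ∫ ω, (b ω + e ω) ∂P + m * (1 + δ) * p * ∫ ω, f ω ∂P
      + ∫ ω, w / ((s : ℝ) + 1) * (f ω * W ω) ∂P
      ≤ ∫ ω, min 1 (Real.exp (lam' * W ω + c')) ∂P := by
    have hbef : Integrable (fun ω => b ω + e ω + m * (1 + δ) * p * f ω) P :=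
      hbe.add (hfint.const_mul _)
    rw [← integral_const_mul, ← integral_add hbe (hfint.const_mul _),
      ← integral_add hbef (hfW.const_mul _)]
    refine integral_mono (hbef.add (hfW.const_mul _))
      (integrable_of_abs_le (measurable_const.min ((hWm.const_mul _).add_const _).exp) 1
        fun z => by rw [abs_of_nonneg (hmin0 _)]; exact min_le_left _ _) fun ω => ?_
    simp only []
    by_cases hcase : lam' * W ω + c' ≤ 0
    · have hbω : b ω = 0 := if_pos hcase
      have heω : e ω = Real.exp (lam * W ω + c) := if_pos hcase
      rw [min_eq_right (Real.exp_le_one_iff.2 hcase)]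
      have h1 : lam' * W ω + c' = (lam * W ω + c)
          + a * (m * (1 + δ) * p + w / ((s : ℝ) + 1) * W ω) := by
        simp only [hlam', hc', ha]; ring
      rw [h1, Real.exp_add, ← heω, hbω]
      have h2 := mul_le_mul_of_nonneg_left
        (Real.add_one_le_exp (a * (m * (1 + δ) * p + w / ((s : ℝ) + 1) * W ω))) (he0 ω)
      simp only [hf]
      linarith
    · have hbω : b ω = 1 := if_neg hcase
      have heω : e ω = 0 := if_neg hcase
      rw [min_eq_left (Real.one_le_exp (not_le.1 hcase).le)]
      simp [hf, heω, hbω]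
  calc _ ≤ ∫ ω, (b ω + e ω + f ω * D ω) ∂P := hstep1
    _ = ∫ ω, (b ω + e ω) ∂P + (m * (1 + δ) * p * ∫ ω, f ω ∂P
          + m * ∫ z, f z.1 * (Lx z / regionWeight m δ r V v s z) ∂(P.prod (area d))) := by
        rw [integral_add hbe hfD, hinc]
    _ ≤ _ := by linarith

/-- A negative exponential moment of the weight in a region. New vertices `y` whose detection
region has a weight of at most `m p (s + 1) / u` send edges at the rate `u / (s + 1)` times the
present weight; the other ones are accounted for by the number of vertices they see. -/
theorem lower_step (h : IsGPM P d m δ r V v) (hm : 1 ≤ m) (hδ : 0 < δ) (hr : 0 ≤ r) (hp0 : 0 < p)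
    (hp : ∀ x, ∫ y, near r x y ∂(area d) = p) {u κ lam : ℝ} (hu : 0 ≤ u) (hκ0 : 0 ≤ κ)
    (hκ1 : κ ≤ 1) (hlam0 : 0 ≤ lam) (hlam : lam * (m * (2 + δ)) ≤ κ) (s : ℕ) :
    ∫ z, Real.exp (-(lam * regionWeight m δ r V v (s + 1) z)) ∂(P.prod (area d))
      ≤ Real.exp (-((1 - κ) * lam * (m * (1 + δ) * p)))
          * ∫ z, Real.exp (-(lam * (1 + (1 - κ) * u / ((s : ℝ) + 1))
              * regionWeight m δ r V v s z)) ∂(P.prod (area d))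
        + u / ((s : ℝ) + 1) * ∫ z, Set.indicator
            {z | m * p * ((s : ℝ) + 1) < u * regionWeight m δ r V v s z}
            (fun z => regionCount r V s z + 1) z ∂(P.prod (area d)) := by
  have hprob := h.isProbabilityMeasure_area
  have hT := h.trajectoryMeasurable (n := s) le_rfl
  have hT1 := h.trajectoryMeasurable (n := s + 1) le_rfl
  have hW := hT.regionWeight (δ := δ) (r := r)
  have hm0 : (0 : ℝ) < m := by exact_mod_cast hm
  have hs0 : (0 : ℝ) < (s : ℝ) + 1 := by positivity
  set bad : Set (Ω × Sphere d) := {z | m * p * ((s : ℝ) + 1) < u * regionWeight m δ r V v s z}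
    with hbad
  have hbadm : MeasurableSet bad := measurableSet_lt measurable_const (hW.const_mul _)
  have hind0 : ∀ z, 0 ≤ bad.indicator (fun _ => (1 : ℝ)) z := fun z =>
    Set.indicator_nonneg (fun _ _ => zero_le_one) z
  have hind1 : ∀ z, bad.indicator (fun _ => (1 : ℝ)) z ≤ 1 := fun z =>
    Set.indicator_le_self' (fun _ _ => zero_le_one) z
  -- the number of vertices, including the new one, in both balls
  set N : (Ω × Sphere d) × Sphere d → ℝ := fun q =>
    ∑ k ∈ Finset.Icc 1 s, near r q.1.2 (V k q.1.1) * near r q.2 (V k q.1.1) + near r q.2 q.1.2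
    with hN
  have hN0 : ∀ q, 0 ≤ N q := fun q => add_nonneg (Finset.sum_nonneg fun _ _ =>
    mul_nonneg (near_nonneg _ _ _) (near_nonneg _ _ _)) (near_nonneg _ _ _)
  have hN1 : ∀ q, N q ≤ s + 1 := fun q => by
    refine add_le_add ?_ (near_le_one _ _ _)
    calc _ ≤ ∑ k ∈ Finset.Icc 1 s, (1 : ℝ) := Finset.sum_le_sum fun k _ =>
          mul_le_one₀ (near_le_one _ _ _) (near_nonneg _ _ _) (near_le_one _ _ _)
      _ = s := by simp
  have hNm : Measurable N := by
    refine (Finset.measurable_fun_sum _ fun k hk => ?_).add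
      (measurable_near measurable_snd (measurable_snd.comp measurable_fst))
    have hVk : Measurable fun q : (Ω × Sphere d) × Sphere d => V k q.1.1 :=
      (hT.position k hk).comp (measurable_fst.comp measurable_fst)
    exact (measurable_near (measurable_snd.comp measurable_fst) hVk).mul
      (measurable_near measurable_snd hVk)
  have hNint : ∀ z, ∫ x, N (z, x) ∂(area d) = p * (regionCount r V s z + 1) := fun z => by
    have hint : ∀ k ∈ Finset.Icc 1 s,
        Integrable (fun x => near r z.2 (V k z.1) * near r x (V k z.1)) (area d) := fun k _ => by
      simp only [near_comm r _ (V k z.1)]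
      exact (integrable_near r _).const_mul _
    have hint' : Integrable (fun x => near r x z.2) (area d) := by
      simp only [near_comm r _ z.2]
      exact integrable_near r _
    simp only [hN]
    rw [integral_add (integrable_finsetSum _ hint) hint', integral_finsetSum _ hint]
    simp only [integral_const_mul, near_comm r _ z.2]
    simp only [near_comm r _ (V _ z.1), hp]
    rw [regionCount, ← Finset.sum_mul]
    simp only [near_comm r z.2]
    ring
  set k : (Ω × Sphere d) × Sphere d → ℝ := fun q =>
    u / (p * ((s : ℝ) + 1)) * (bad.indicator (fun _ => (1 : ℝ)) q.1 * N q) with hk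
  have hk0 : ∀ q, 0 ≤ k q := fun q => mul_nonneg (by positivity) (mul_nonneg (hind0 _) (hN0 _))
  have hk1 : ∀ q, k q ≤ u / (p * ((s : ℝ) + 1)) * (1 * (s + 1)) := fun q =>
    mul_le_mul_of_nonneg_left (mul_le_mul (hind1 _) (hN1 q) (hN0 q) zero_le_one) (by positivity)
  have hkm : Measurable k :=
    (((measurable_const.indicator hbadm).comp measurable_fst).mul hNm).const_mul _
  have hkint : ∀ z, ∫ x, k (z, x) ∂(area d)
      = u / ((s : ℝ) + 1) * bad.indicator (fun z => regionCount r V s z + 1) z := fun z => by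
    simp only [hk]
    rw [integral_const_mul, integral_const_mul, hNint]
    by_cases hz : z ∈ bad
    · rw [Set.indicator_of_mem hz, Set.indicator_of_mem hz]; field_simp
    · rw [Set.indicator_of_notMem hz, Set.indicator_of_notMem hz]; ring
  have hexp : ∀ {t : ℝ}, 0 ≤ t → |Real.exp (-t)| ≤ 1 := fun {t} ht => by
    rw [abs_of_pos (Real.exp_pos _)]; exact Real.exp_le_one_iff.2 (by linarith)
  have hWp : ∀ t : ℕ, ∀ z, 0 ≤ regionWeight m δ r V v t z := fun t z => regionWeight_nonneg hδ t z
  set lam' := lam * (1 + (1 - κ) * u / ((s : ℝ) + 1)) with hlam'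
  have hκ1' : 0 ≤ 1 - κ := by linarith
  have hlam'0 : 0 ≤ lam' := by positivity
  set c := (1 - κ) * lam * (m * (1 + δ) * p) with hc
  have key := integral_le_of_forall (P := P) (Q := P.prod (area d)) (μ := area d)
    (f := fun z => Real.exp (-(lam * regionWeight m δ r V v (s + 1) z)))
    (g := fun z => Real.exp (-c) * Real.exp (-(lam' * regionWeight m δ r V v s z))) (k := k)
    (integrable_of_abs_le (hT1.regionWeight.const_mul _).neg.exp 1 fun z =>
      hexp (mul_nonneg hlam0 (hWp _ z)))
    ((integrable_of_abs_le (hW.const_mul _).neg.exp 1 fun z =>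
      hexp (mul_nonneg hlam'0 (hWp _ z))).const_mul _)
    (integrable_of_abs_le hkm _ fun q => by rw [abs_of_nonneg (hk0 q)]; exact hk1 q) ?_
  · refine key.trans (le_of_eq ?_)
    simp only [hkint]
    rw [integral_const_mul, integral_const_mul]
  intro x
  set W : Ω → ℝ := fun ω => regionWeight m δ r V v s (ω, x) with hWdef
  have hW0 : ∀ ω, 0 ≤ W ω := fun ω => regionWeight_nonneg hδ s _
  set e : Ω → ℝ := fun ω => Real.exp (-(lam * W ω)) with he
  have he0 : ∀ ω, 0 ≤ e ω := fun ω => (Real.exp_pos _).le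
  have he1 : ∀ ω, e ω ≤ 1 := fun ω => by
    refine Real.exp_le_one_iff.2 ?_
    have := mul_nonneg hlam0 (hW0 ω)
    linarith
  have heabs : ∀ ω, |e ω| ≤ 1 := fun ω => by rw [abs_of_nonneg (he0 ω)]; exact he1 ω
  have hThist := trajectoryMeasurable_history m V v s m
  have hWhist : Measurable[history m V v s m] W :=
    @TrajectoryMeasurable.regionWeight_left d m δ r Ω (_) V v s hThist x
  have hehist : Measurable[history m V v s m] e :=
    Real.measurable_exp.comp ((hWhist.const_mul _).neg)
  have hle := h.history_le (n := s) le_rfl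
  have hem : Measurable e := hehist.mono hle le_rfl
  have hWm : Measurable W := hWhist.mono hle le_rfl
  set D : Ω → ℝ := fun ω => m * (1 + δ) * near r x (V (s + 1) ω)
        + ∑ l ∈ Finset.range m, hit (V · ω) (v · · ω) (s + 1) (l + 1) (near r x) with hD
  have hD0 : ∀ ω, 0 ≤ D ω := fun ω => increment_nonneg hδ s ω x
  have hD1 : ∀ ω, D ω ≤ m * (2 + δ) := fun ω => increment_le hδ s ω x
  have hDm : Measurable D := by
    refine ((measurable_near measurable_const (h.measurable_position (s + 1) (by omega))).const_mul
      _).add (Finset.measurable_fun_sum _ fun l hl => ?_)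
    exact (h.trajectoryMeasurable (Nat.succ_le_of_lt (Finset.mem_range.1 hl))).hit (by omega)
      (Finset.mem_Icc.2 ⟨by omega, le_rfl⟩) fun _ hg => measurable_near measurable_const hg
  have heint : Integrable e P := integrable_of_abs_le hem 1 heabs
  have heD : Integrable (fun ω => e ω * D ω) P :=
    integrable_of_abs_le (hem.mul hDm) (1 * (m * (2 + δ))) fun ω => by
      rw [abs_of_nonneg (mul_nonneg (he0 ω) (hD0 ω))]
      exact mul_le_mul (he1 ω) (hD1 ω) (hD0 ω) zero_le_one
  set K : ℝ := s * (2 * m * s + m * δ) + m * (1 + δ) with hK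
  have heW : Integrable (fun ω => e ω * W ω) P :=
    integrable_of_abs_le (hem.mul hWm) (1 * K) fun ω => by
      rw [abs_of_nonneg (mul_nonneg (he0 ω) (hW0 ω))]
      exact mul_le_mul (he1 ω) (regionWeight_le hδ s _) (hW0 ω) zero_le_one
  set Lx : Ω × Sphere d → ℝ := fun z => load m δ r (V · z.1) (v · · z.1) s z.2 (near r x) with hLx
  have hL0 : ∀ z, 0 ≤ Lx z := fun z => load_nonneg hδ (near_nonneg r x) _ _
  have hLm : Measurable Lx := hT.load_near x
  have heL : Integrable (fun z => e z.1 * Lx z) (P.prod (area d)) :=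
    integrable_of_abs_le ((hem.comp measurable_fst).mul hLm) (1 * K) fun z => by
      rw [abs_of_nonneg (mul_nonneg (he0 _) (hL0 z))]
      exact mul_le_mul (he1 _) (load_le hδ (near_nonneg r x) (near_le_one r x) s _) (hL0 z)
        zero_le_one
  have heR : Integrable (fun z => e z.1 * (Lx z / regionWeight m δ r V v s z))
      (P.prod (area d)) := by
    refine integrable_of_abs_le ((hem.comp measurable_fst).mul (hLm.div hW)) 1 fun z => ?_
    rw [abs_of_nonneg (mul_nonneg (he0 _) (load_div_nonneg hδ s z (near_nonneg r x)))]
    exact mul_le_one₀ (he1 _) (load_div_nonneg hδ s z (near_nonneg r x))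
      (load_div_le_one hm hδ s z (near_le_one r x))
  have hkx : Integrable (fun z => k (z, x)) (P.prod (area d)) :=
    integrable_of_abs_le (hkm.comp (measurable_id.prodMk measurable_const)) _ fun z => by
      rw [abs_of_nonneg (hk0 _)]; exact hk1 _
  have hinc := h.integral_increment hm hδ hr (hp x) s hehist heabs
  set a := (1 - κ) * lam with ha
  have ha0 : 0 ≤ a := by positivity
  have hstep1 : ∫ ω, Real.exp (-(lam * regionWeight m δ r V v (s + 1) (ω, x))) ∂P
      ≤ ∫ ω, (e ω - a * (e ω * D ω)) ∂P := by
    refine integral_mono_ae (integrable_of_abs_le ((hT1.regionWeight.comp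
      (measurable_id.prodMk measurable_const)).const_mul _).neg.exp 1
        fun z => hexp (mul_nonneg hlam0 (hWp _ _))) (heint.sub (heD.const_mul _)) ?_
    filter_upwards [h.ae_admissible hδ hr] with ω hω
    rw [regionWeight_succ hω]
    have ht : lam * D ω ≤ κ := (mul_le_mul_of_nonneg_left (hD1 ω) hlam0).trans hlam
    have h2 := exp_neg_le_one_sub_mul hκ1 (mul_nonneg hlam0 (hD0 ω)) ht
    have h3 : -(lam * (W ω + D ω)) = -(lam * W ω) + -(lam * D ω) := by ring
    change Real.exp (-(lam * (W ω + D ω))) ≤ _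
    rw [h3, Real.exp_add]
    have := mul_le_mul_of_nonneg_left h2 (he0 ω)
    simp only [ha]
    calc _ ≤ e ω * (1 - (1 - κ) * (lam * D ω)) := this
      _ = _ := by ring
  have hstep2 : ∫ ω, a * (u / ((s : ℝ) + 1)) * (e ω * W ω) ∂P
      ≤ a * (m * ∫ z, e z.1 * (Lx z / regionWeight m δ r V v s z) ∂(P.prod (area d)))
        + ∫ z, k (z, x) ∂(P.prod (area d)) := by
    have h1 : ∫ ω, a * (u / ((s : ℝ) + 1)) * (e ω * W ω) ∂P
        = ∫ z, a * (u / (p * ((s : ℝ) + 1))) * (e z.1 * Lx z) ∂(P.prod (area d)) := by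
      rw [integral_const_mul, integral_const_mul, integral_prod _ heL]
      simp only [integral_const_mul, hLx, integral_load_left hp]
      rw [← integral_const_mul, ← integral_const_mul]
      refine integral_congr_ae (ae_of_all _ fun ω => ?_)
      simp only [hWdef]
      field_simp
    rw [h1, ← integral_const_mul, ← integral_const_mul, ← integral_add
      ((heR.const_mul _).const_mul _) hkx]
    refine integral_mono (heL.const_mul _) (((heR.const_mul _).const_mul _).add hkx) fun z => ?_
    have hZ : 0 < regionWeight m δ r V v s z := regionWeight_pos hm hδ _ _
    have he0' := he0 z.1
    have hL0' := hL0 z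
    by_cases hz : z ∈ bad
    · simp only [hk, Set.indicator_of_mem hz]
      have h3 : 0 ≤ a * (m * (e z.1 * (Lx z / regionWeight m δ r V v s z))) := by positivity
      have hcount : Lx z ≤ W z.1 * N (z, x) := by
        have := load_le_mul_count (m := m) (r := r) (x := (V · z.1)) (v := (v · · z.1)) hδ s x z.2
        rwa [← load_one] at this
      have hsmall : a * (e z.1 * W z.1) ≤ 1 := by
        -- `t * exp (-t) ≤ 1`
        have h4 : lam * W z.1 * e z.1 ≤ 1 := by
          have h5 := Real.add_one_le_exp (lam * W z.1)
          have h6 : Real.exp (lam * W z.1) * e z.1 = 1 := by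
            rw [he, ← Real.exp_add, add_neg_cancel, Real.exp_zero]
          nlinarith [he0 z.1]
        have h7 : 0 ≤ lam * W z.1 * e z.1 := by have := hW0 z.1; positivity
        calc a * (e z.1 * W z.1) = (1 - κ) * (lam * W z.1 * e z.1) := by simp only [ha]; ring
          _ ≤ 1 := by nlinarith
      have h8 : a * (e z.1 * Lx z) ≤ N (z, x) := by
        calc a * (e z.1 * Lx z) ≤ a * (e z.1 * (W z.1 * N (z, x))) := by gcongr
          _ = a * (e z.1 * W z.1) * N (z, x) := by ring
          _ ≤ 1 * N (z, x) := mul_le_mul_of_nonneg_right hsmall (hN0 _)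
          _ = _ := one_mul _
      have h9 := mul_le_mul_of_nonneg_left h8
        (by positivity : 0 ≤ u / (p * ((s : ℝ) + 1)))
      calc _ = u / (p * ((s : ℝ) + 1)) * (a * (e z.1 * Lx z)) := by ring
        _ ≤ _ := by linarith
    · simp only [hk, Set.indicator_of_notMem hz]
      have h3 : u * regionWeight m δ r V v s z ≤ m * p * ((s : ℝ) + 1) := not_lt.1 hz
      have h4 : u / (p * ((s : ℝ) + 1)) ≤ (m : ℝ) / regionWeight m δ r V v s z := by
        rw [div_le_div_iff₀ (by positivity) hZ]; linarith
      have h5 := mul_le_mul_of_nonneg_right h4 (mul_nonneg ha0 (mul_nonneg he0' hL0'))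
      calc _ = u / (p * ((s : ℝ) + 1)) * (a * (e z.1 * Lx z)) := by ring
        _ ≤ _ := h5
        _ = _ := by ring
  have hstep3 : ∫ ω, (e ω - a * (m * (1 + δ) * p) * e ω
      - a * (u / ((s : ℝ) + 1)) * (e ω * W ω)) ∂P
      ≤ ∫ ω, Real.exp (-c) * Real.exp (-(lam' * W ω)) ∂P := by
    refine integral_mono ((heint.sub (heint.const_mul _)).sub (heW.const_mul _))
      ((integrable_of_abs_le (hWm.const_mul _).neg.exp 1 fun z =>
        hexp (mul_nonneg hlam'0 (hW0 z))).const_mul _) fun ω => ?_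
    simp only []
    rw [← Real.exp_add]
    have h1 : -c + -(lam' * W ω) = -(lam * W ω)
        + -(a * (m * (1 + δ) * p + u / ((s : ℝ) + 1) * W ω)) := by
      simp only [hlam', hc, ha]; ring
    rw [h1, Real.exp_add]
    have h2 := mul_le_mul_of_nonneg_left
      (Real.add_one_le_exp (-(a * (m * (1 + δ) * p + u / ((s : ℝ) + 1) * W ω)))) (he0 ω)
    calc _ = e ω * (-(a * (m * (1 + δ) * p + u / ((s : ℝ) + 1) * W ω)) + 1) := by ring
      _ ≤ _ := h2
  have hee : Integrable (fun ω => e ω - a * (m * (1 + δ) * p) * e ω) P :=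
    heint.sub (heint.const_mul _)
  rw [integral_sub hee (heW.const_mul _), integral_sub heint (heint.const_mul _),
    integral_const_mul] at hstep3
  rw [integral_sub heint (heD.const_mul _), integral_const_mul, hinc] at hstep1
  calc _ ≤ _ := hstep1
    _ ≤ _ := by
      refine le_trans ?_ (add_le_add hstep3 le_rfl)
      linarith

end IsGPM

/-! ### Many steps of the process -/

namespace IsGPM

variable {Ω : Type*} [MeasurableSpace Ω] {P : Measure Ω} [IsProbabilityMeasure P] {d m : ℕ}
  {δ r p : ℝ} {V : ℕ → Ω → Sphere d} {v : ℕ → ℕ → Ω → ℕ}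

/-- Iteration of `upper_step` from time `s` to time `N`. The exponent is `lam` at time `N` and
`lam * growth θ N / growth θ j` at time `j`, with `θ = (1 + κ) w`. A weight of at most `X` at time
`s` grows by the factor `(N / s) ^ θ`, and the new vertices contribute at most
`(1 + κ) m (1 + δ) p (N + 1) / (1 - θ)`, which is `m p (N + 1) (1 + δ) / (1 - w)` for small `κ`. -/
theorem upper_tail_le (h : IsGPM P d m δ r V v) (hm : 1 ≤ m) (hδ : 0 < δ) (hr : 0 ≤ r)
    (hp0 : 0 < p) (hp : ∀ x, ∫ y, near r x y ∂(area d) = p) {w κ lam : ℝ} (hw : 0 ≤ w)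
    (hκ0 : 0 ≤ κ) (hκ1 : κ ≤ 1) (hθ : (1 + κ) * w < 1) {s N : ℕ} (hs : 1 ≤ s) (hsN : s ≤ N)
    (hlam0 : 0 ≤ lam)
    (hlam : lam * (((N : ℝ) / s) ^ ((1 + κ) * w) * (m * (2 + δ))) ≤ κ) {X : ℝ} (hX : 0 ≤ X)
    (b : ℝ) :
    (P.prod (area d)).real {z | b ≤ regionWeight m δ r V v N z}
      ≤ (P.prod (area d)).real {z | X < regionWeight m δ r V v s z}
        + m * p * ∑ j ∈ Finset.Ico s N, (P.prod (area d)).real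
            {z | w * regionWeight m δ r V v j z < m * p * ((j : ℝ) + 1)}
        + Real.exp (-(lam * (b - (1 + κ) * (m * (1 + δ) * p) * ((N : ℝ) + 1) / (1 - (1 + κ) * w)
            - ((N : ℝ) / s) ^ ((1 + κ) * w) * X))) := by
  have hprob := h.isProbabilityMeasure_area
  set θ := (1 + κ) * w with hθdef
  have hθ0 : 0 ≤ θ := by positivity
  have hG := growth_pos hθ0
  have hgr : growth θ N / growth θ s ≤ ((N : ℝ) / s) ^ θ := growth_div_le hθ0 hθ.le hs hsN
  set ℓ : ℕ → ℝ := fun j => lam * (growth θ N / growth θ j) with hℓ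
  have hℓ0 : ∀ j, 0 ≤ ℓ j := fun j => mul_nonneg hlam0 (div_nonneg (hG _).le (hG _).le)
  have hℓs : ∀ j, s ≤ j → ℓ j * (m * (2 + δ)) ≤ κ := fun j hj => by
    refine le_trans ?_ hlam
    rw [mul_assoc]
    refine mul_le_mul_of_nonneg_left (mul_le_mul_of_nonneg_right (le_trans ?_ hgr)
      (by positivity)) hlam0
    exact div_le_div_of_nonneg_left (hG _).le (hG _) (growth_mono hθ0 hj)
  have hℓN : ℓ N = lam := by simp only [hℓ]; rw [div_self (hG _).ne', mul_one]
  set c₀ := (m : ℝ) * (1 + δ) * p with hc₀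
  have hmono : ∀ t : ℕ, s ≤ t → ∀ c : ℝ,
      ∫ z, min 1 (Real.exp (ℓ t * regionWeight m δ r V v t z + c)) ∂(P.prod (area d))
        ≤ ∫ z, min 1 (Real.exp (ℓ s * regionWeight m δ r V v s z
            + (c + (1 + κ) * c₀ * ∑ j ∈ Finset.Ico s t, ℓ (j + 1)))) ∂(P.prod (area d))
          + m * p * ∑ j ∈ Finset.Ico s t, (P.prod (area d)).real
            {z | w * regionWeight m δ r V v j z < m * p * ((j : ℝ) + 1)} := by
    intro t ht
    induction t, ht using Nat.le_induction with
    | base => intro c; simp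
    | succ t ht ih =>
      intro c
      have h1 := h.upper_step hm hδ hr hp0 hp hw hκ0 hκ1 (hℓ0 (t + 1)) (hℓs (t + 1) (by omega)) c t
      have hrec : ℓ (t + 1) * (1 + (1 + κ) * w / ((t : ℝ) + 1)) = ℓ t := by
        simp only [hℓ]
        rw [growth_succ, ← hθdef]
        have := (hG t).ne'
        have h2 : 1 + θ / ((t : ℝ) + 1) ≠ 0 := by positivity
        field_simp
      rw [hrec] at h1
      have h2 := ih (c + (1 + κ) * ℓ (t + 1) * c₀)
      rw [Finset.sum_Ico_succ_top ht, Finset.sum_Ico_succ_top ht]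
      have h3 : c + (1 + κ) * ℓ (t + 1) * c₀ + (1 + κ) * c₀ * ∑ j ∈ Finset.Ico s t, ℓ (j + 1)
          = c + (1 + κ) * c₀ * (∑ j ∈ Finset.Ico s t, ℓ (j + 1) + ℓ (t + 1)) := by ring
      rw [h3] at h2
      linarith
  have hT := fun t => (h.trajectoryMeasurable (n := t) le_rfl).regionWeight (δ := δ) (r := r)
  have hmin0 : ∀ t : ℝ, 0 ≤ min 1 (Real.exp t) := fun t => le_min zero_le_one (Real.exp_pos _).le
  have hint : ∀ t : ℕ, ∀ a c : ℝ, Integrable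
      (fun z => min 1 (Real.exp (a * regionWeight m δ r V v t z + c))) (P.prod (area d)) :=
    fun t a c => integrable_of_abs_le
      (measurable_const.min (((hT t).const_mul _).add_const _).exp) 1 fun z => by
        rw [abs_of_nonneg (hmin0 _)]; exact min_le_left _ _
  have hleft : (P.prod (area d)).real {z | b ≤ regionWeight m δ r V v N z}
      ≤ ∫ z, min 1 (Real.exp (ℓ N * regionWeight m δ r V v N z + -(lam * b)))
          ∂(P.prod (area d)) := by
    have hset : MeasurableSet {z | b ≤ regionWeight m δ r V v N z} :=
      measurableSet_le measurable_const (hT N)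
    rw [← integral_indicator_one hset]
    refine integral_mono ((integrable_const 1).indicator hset) (hint _ _ _) fun z => ?_
    by_cases hz : z ∈ {z | b ≤ regionWeight m δ r V v N z}
    · rw [Set.indicator_of_mem hz, hℓN, min_eq_left (Real.one_le_exp ?_)]
      · rfl
      · have := mul_le_mul_of_nonneg_left hz hlam0
        linarith
    · rw [Set.indicator_of_notMem hz]; exact hmin0 _
  have hright : ∀ C : ℝ, ∫ z, min 1 (Real.exp (ℓ s * regionWeight m δ r V v s z + C))
        ∂(P.prod (area d))
      ≤ (P.prod (area d)).real {z | X < regionWeight m δ r V v s z}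
        + Real.exp (ℓ s * X + C) := fun C => by
    have hset : MeasurableSet {z | X < regionWeight m δ r V v s z} :=
      measurableSet_lt measurable_const (hT s)
    have hint1 : Integrable (Set.indicator {z | X < regionWeight m δ r V v s z}
      (1 : Ω × Sphere d → ℝ)) (P.prod (area d)) := (integrable_const 1).indicator hset
    calc _ ≤ ∫ z, (Set.indicator {z | X < regionWeight m δ r V v s z} 1 z
            + Real.exp (ℓ s * X + C)) ∂(P.prod (area d)) := by
          refine integral_mono (hint _ _ _) (hint1.add (integrable_const _)) fun z => ?_
          by_cases hz : z ∈ {z | X < regionWeight m δ r V v s z}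
          · simp only [Set.indicator_of_mem hz, Pi.one_apply]
            linarith [min_le_left 1 (Real.exp (ℓ s * regionWeight m δ r V v s z + C)),
              Real.exp_pos (ℓ s * X + C)]
          · simp only [Set.indicator_of_notMem hz, zero_add]
            refine (min_le_right _ _).trans (Real.exp_le_exp.2 ?_)
            have := mul_le_mul_of_nonneg_left (not_lt.1 hz) (hℓ0 s)
            linarith
      _ = _ := by
          rw [integral_add hint1 (integrable_const _), integral_indicator_one hset,
            integral_const, probReal_univ, one_smul]
  have hsum : ∑ j ∈ Finset.Ico s N, ℓ (j + 1) ≤ lam * (((N : ℝ) + 1) / (1 - θ)) := by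
    have h1 := sum_inv_growth hθ0 hsN
    have h2 : ∑ j ∈ Finset.Ico s N, ℓ (j + 1)
        = lam * growth θ N * ∑ j ∈ Finset.Ico s N, (growth θ (j + 1))⁻¹ := by
      rw [Finset.mul_sum]
      exact Finset.sum_congr rfl fun j _ => by simp only [hℓ]; ring
    rw [h2, mul_assoc]
    refine mul_le_mul_of_nonneg_left ?_ hlam0
    rw [le_div_iff₀ (by linarith)]
    have h3 : 0 ≤ ((s : ℝ) + 1) * (growth θ s)⁻¹ :=
      mul_nonneg (by positivity) (inv_nonneg.2 (hG s).le)
    calc growth θ N * (∑ j ∈ Finset.Ico s N, (growth θ (j + 1))⁻¹) * (1 - θ)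
        = growth θ N * (((N : ℝ) + 1) * (growth θ N)⁻¹ - ((s : ℝ) + 1) * (growth θ s)⁻¹) := by
          rw [← h1]; ring
      _ ≤ growth θ N * (((N : ℝ) + 1) * (growth θ N)⁻¹) :=
          mul_le_mul_of_nonneg_left (by linarith) (hG N).le
      _ = _ := by
          have := (hG N).ne'
          field_simp
  have hfinal := (hleft.trans (hmono N hsN _)).trans (add_le_add (hright _) le_rfl)
  have hexp : Real.exp (ℓ s * X + (-(lam * b) + (1 + κ) * c₀ * ∑ j ∈ Finset.Ico s N, ℓ (j + 1)))
      ≤ Real.exp (-(lam * (b - (1 + κ) * c₀ * ((N : ℝ) + 1) / (1 - θ)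
          - ((N : ℝ) / s) ^ θ * X))) := by
    refine Real.exp_le_exp.2 ?_
    have h1 : ℓ s * X ≤ lam * (((N : ℝ) / s) ^ θ * X) := by
      simp only [hℓ]
      rw [mul_assoc]
      exact mul_le_mul_of_nonneg_left (mul_le_mul_of_nonneg_right hgr hX) hlam0
    have h2 := mul_le_mul_of_nonneg_left hsum (by positivity : 0 ≤ (1 + κ) * c₀)
    calc _ ≤ lam * (((N : ℝ) / s) ^ θ * X)
          + (-(lam * b) + (1 + κ) * c₀ * (lam * (((N : ℝ) + 1) / (1 - θ)))) := by linarith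
      _ = _ := by ring
  linarith

/-- Iteration of `lower_step` from time `s` to time `N`, in the same way as in `upper_tail_le`, with
`θ = (1 - κ) u`. -/
theorem lower_tail_le (h : IsGPM P d m δ r V v) (hm : 1 ≤ m) (hδ : 0 < δ) (hr : 0 ≤ r)
    (hp0 : 0 < p) (hp : ∀ x, ∫ y, near r x y ∂(area d) = p) {u κ lam : ℝ} (hu : 0 ≤ u)
    (hκ0 : 0 ≤ κ) (hκ1 : κ ≤ 1) (hθ : (1 - κ) * u < 1) {s N : ℕ} (hs : 1 ≤ s) (hsN : s ≤ N)
    (hlam0 : 0 ≤ lam)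
    (hlam : lam * (((N : ℝ) / s) ^ ((1 - κ) * u) * (m * (2 + δ))) ≤ κ) (b : ℝ) :
    (P.prod (area d)).real {z | regionWeight m δ r V v N z ≤ b}
      ≤ Real.exp (-(lam * ((1 - κ) * (m * (1 + δ) * p) * (((N : ℝ) + 1)
            - ((s : ℝ) + 1) * ((N : ℝ) / s) ^ ((1 - κ) * u)) / (1 - (1 - κ) * u) - b)))
        + Real.exp (lam * b) * ∑ j ∈ Finset.Ico s N, u / ((j : ℝ) + 1) * ∫ z, Set.indicator
            {z | m * p * ((j : ℝ) + 1) < u * regionWeight m δ r V v j z}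
            (fun z => regionCount r V j z + 1) z ∂(P.prod (area d)) := by
  have hprob := h.isProbabilityMeasure_area
  set θ := (1 - κ) * u with hθdef
  have hκ1' : 0 ≤ 1 - κ := by linarith
  have hθ0 : 0 ≤ θ := by positivity
  have hG := growth_pos hθ0
  have hgr : growth θ N / growth θ s ≤ ((N : ℝ) / s) ^ θ := growth_div_le hθ0 hθ.le hs hsN
  set ℓ : ℕ → ℝ := fun j => lam * (growth θ N / growth θ j) with hℓ
  have hℓ0 : ∀ j, 0 ≤ ℓ j := fun j => mul_nonneg hlam0 (div_nonneg (hG _).le (hG _).le)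
  have hℓs : ∀ j, s ≤ j → ℓ j * (m * (2 + δ)) ≤ κ := fun j hj => by
    refine le_trans ?_ hlam
    rw [mul_assoc]
    refine mul_le_mul_of_nonneg_left (mul_le_mul_of_nonneg_right (le_trans ?_ hgr)
      (by positivity)) hlam0
    exact div_le_div_of_nonneg_left (hG _).le (hG _) (growth_mono hθ0 hj)
  have hℓN : ℓ N = lam := by simp only [hℓ]; rw [div_self (hG _).ne', mul_one]
  set c₀ := (m : ℝ) * (1 + δ) * p with hc₀
  have hc₀0 : 0 ≤ c₀ := by positivity
  have hT := fun t => (h.trajectoryMeasurable (n := t) le_rfl).regionWeight (δ := δ) (r := r)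
  set err : ℕ → ℝ := fun j => u / ((j : ℝ) + 1) * ∫ z, Set.indicator
            {z | m * p * ((j : ℝ) + 1) < u * regionWeight m δ r V v j z}
            (fun z => regionCount r V j z + 1) z ∂(P.prod (area d)) with herr
  have herr0 : ∀ j, 0 ≤ err j := fun j => mul_nonneg (by positivity)
    (integral_nonneg fun z => Set.indicator_nonneg
      (fun z _ => add_nonneg (regionCount_nonneg _ _) zero_le_one) z)
  have hmono : ∀ t : ℕ, s ≤ t →
      ∫ z, Real.exp (-(ℓ t * regionWeight m δ r V v t z)) ∂(P.prod (area d))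
        ≤ Real.exp (-((1 - κ) * c₀ * ∑ j ∈ Finset.Ico s t, ℓ (j + 1)))
          * ∫ z, Real.exp (-(ℓ s * regionWeight m δ r V v s z)) ∂(P.prod (area d))
          + ∑ j ∈ Finset.Ico s t, err j := by
    intro t ht
    induction t, ht using Nat.le_induction with
    | base => simp
    | succ t ht ih =>
      have h1 := h.lower_step hm hδ hr hp0 hp hu hκ0 hκ1 (hℓ0 (t + 1)) (hℓs (t + 1) (by omega)) t
      have hrec : ℓ (t + 1) * (1 + (1 - κ) * u / ((t : ℝ) + 1)) = ℓ t := by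
        simp only [hℓ]
        rw [growth_succ, ← hθdef]
        have := (hG t).ne'
        have h2 : 1 + θ / ((t : ℝ) + 1) ≠ 0 := by positivity
        field_simp
      rw [hrec] at h1
      rw [Finset.sum_Ico_succ_top ht, Finset.sum_Ico_succ_top ht]
      have hE : Real.exp (-((1 - κ) * ℓ (t + 1) * c₀)) ≤ 1 := Real.exp_le_one_iff.2 (by
        have : 0 ≤ (1 - κ) * ℓ (t + 1) * c₀ := mul_nonneg (mul_nonneg hκ1' (hℓ0 _)) hc₀0
        linarith)
      have h2 := mul_le_mul_of_nonneg_left ih (Real.exp_pos (-((1 - κ) * ℓ (t + 1) * c₀))).le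
      rw [mul_add, ← mul_assoc (Real.exp _) (Real.exp _), ← Real.exp_add] at h2
      have h3 : -((1 - κ) * ℓ (t + 1) * c₀) + -((1 - κ) * c₀ * ∑ j ∈ Finset.Ico s t, ℓ (j + 1))
          = -((1 - κ) * c₀ * (∑ j ∈ Finset.Ico s t, ℓ (j + 1) + ℓ (t + 1))) := by ring
      rw [h3] at h2
      have h4 := mul_le_mul_of_nonneg_right hE
        (Finset.sum_nonneg fun j (_ : j ∈ Finset.Ico s t) => herr0 j)
      have h5 : err t = u / ((t : ℝ) + 1) * ∫ z, Set.indicator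
            {z | m * p * ((t : ℝ) + 1) < u * regionWeight m δ r V v t z}
            (fun z => regionCount r V t z + 1) z ∂(P.prod (area d)) := rfl
      linarith
  have hexp1 : ∀ t z, Real.exp (-(ℓ t * regionWeight m δ r V v t z)) ≤ 1 := fun t z =>
    Real.exp_le_one_iff.2 (by
      have := mul_nonneg (hℓ0 t) (regionWeight_nonneg (m := m) (r := r) (V := V) (v := v) hδ t z)
      linarith)
  have hint : ∀ t : ℕ, Integrable
      (fun z => Real.exp (-(ℓ t * regionWeight m δ r V v t z))) (P.prod (area d)) :=
    fun t => integrable_of_abs_le ((hT t).const_mul _).neg.exp 1 fun z => by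
      rw [abs_of_pos (Real.exp_pos _)]; exact hexp1 t z
  have hleft : (P.prod (area d)).real {z | regionWeight m δ r V v N z ≤ b}
      ≤ Real.exp (lam * b) * ∫ z, Real.exp (-(ℓ N * regionWeight m δ r V v N z))
          ∂(P.prod (area d)) := by
    have hset : MeasurableSet {z | regionWeight m δ r V v N z ≤ b} :=
      measurableSet_le (hT N) measurable_const
    rw [← integral_indicator_one hset, ← integral_const_mul]
    refine integral_mono ((integrable_const 1).indicator hset) ((hint _).const_mul _) fun z => ?_
    by_cases hz : z ∈ {z | regionWeight m δ r V v N z ≤ b}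
    · rw [Set.indicator_of_mem hz, hℓN]
      simp only [Pi.one_apply]
      rw [← Real.exp_add]
      refine Real.one_le_exp ?_
      have := mul_le_mul_of_nonneg_left hz hlam0
      linarith
    · rw [Set.indicator_of_notMem hz]; positivity
  have hright : ∫ z, Real.exp (-(ℓ s * regionWeight m δ r V v s z)) ∂(P.prod (area d)) ≤ 1 := by
    calc _ ≤ ∫ z, (1 : ℝ) ∂(P.prod (area d)) :=
          integral_mono (hint s) (integrable_const _) (hexp1 s)
      _ = 1 := by simp
  have hsum : lam * ((((N : ℝ) + 1) - ((s : ℝ) + 1) * ((N : ℝ) / s) ^ θ) / (1 - θ))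
      ≤ ∑ j ∈ Finset.Ico s N, ℓ (j + 1) := by
    have h1 := sum_inv_growth hθ0 hsN
    have h2 : ∑ j ∈ Finset.Ico s N, ℓ (j + 1)
        = lam * growth θ N * ∑ j ∈ Finset.Ico s N, (growth θ (j + 1))⁻¹ := by
      rw [Finset.mul_sum]
      exact Finset.sum_congr rfl fun j _ => by simp only [hℓ]; ring
    rw [h2, mul_assoc]
    refine mul_le_mul_of_nonneg_left ?_ hlam0
    rw [div_le_iff₀ (by linarith)]
    have h3 := mul_le_mul_of_nonneg_left hgr (by positivity : 0 ≤ (s : ℝ) + 1)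
    have h4 : growth θ N * (∑ j ∈ Finset.Ico s N, (growth θ (j + 1))⁻¹) * (1 - θ)
        = growth θ N * ((1 - θ) * ∑ j ∈ Finset.Ico s N, (growth θ (j + 1))⁻¹) := by ring
    rw [h4, h1, mul_sub]
    have h5 : growth θ N * (((N : ℝ) + 1) * (growth θ N)⁻¹) = (N : ℝ) + 1 := by
      have := (hG N).ne'
      field_simp
    have h6 : growth θ N * (((s : ℝ) + 1) * (growth θ s)⁻¹)
        = ((s : ℝ) + 1) * (growth θ N / growth θ s) := by ring
    rw [h5, h6]
    linarith
  have herrs : 0 ≤ ∑ j ∈ Finset.Ico s N, err j := Finset.sum_nonneg fun j _ => herr0 j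
  have hcomb := hmono N hsN
  have h7 : Real.exp (-((1 - κ) * c₀ * ∑ j ∈ Finset.Ico s N, ℓ (j + 1)))
      ≤ Real.exp (-((1 - κ) * c₀ * (lam * ((((N : ℝ) + 1)
        - ((s : ℝ) + 1) * ((N : ℝ) / s) ^ θ) / (1 - θ))))) := by
    refine Real.exp_le_exp.2 (neg_le_neg ?_)
    exact mul_le_mul_of_nonneg_left hsum (mul_nonneg hκ1' hc₀0)
  have h8 : ∫ z, Real.exp (-(ℓ N * regionWeight m δ r V v N z)) ∂(P.prod (area d))
      ≤ Real.exp (-((1 - κ) * c₀ * (lam * ((((N : ℝ) + 1)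
        - ((s : ℝ) + 1) * ((N : ℝ) / s) ^ θ) / (1 - θ))))) + ∑ j ∈ Finset.Ico s N, err j := by
    have := mul_le_mul h7 hright (integral_nonneg fun z => (Real.exp_pos _).le)
      (Real.exp_pos _).le
    linarith
  calc _ ≤ _ := hleft
    _ ≤ Real.exp (lam * b) * (Real.exp (-((1 - κ) * c₀ * (lam * ((((N : ℝ) + 1)
        - ((s : ℝ) + 1) * ((N : ℝ) / s) ^ θ) / (1 - θ))))) + ∑ j ∈ Finset.Ico s N, err j) :=
        mul_le_mul_of_nonneg_left h8 (Real.exp_pos _).le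
    _ = _ := by
        rw [mul_add, ← Real.exp_add]
        congr 2
        ring

/-! ### Counting vertices -/

/-- The number of vertices in a ball is binomial. -/
theorem integral_exp_count_le (h : IsGPM P d m δ r V v) {ρ q t : ℝ} (ht : 0 ≤ t) {x : Sphere d}
    (hq : ∫ y, near ρ x y ∂(area d) ≤ q) (s : ℕ) :
    ∫ ω, Real.exp (t * regionCount ρ V s (ω, x)) ∂P ≤ Real.exp ((Real.exp t - 1) * q * s) := by
  have hprob := h.isProbabilityMeasure_area
  induction s with
  | zero => simp [regionCount]
  | succ s ih =>
    have hV := h.measurable_position (s + 1) (by omega)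
    have hindep := h.indep (s + 1) (by omega)
    rw [Nat.add_sub_cancel] at hindep
    have hThist := trajectoryMeasurable_history m V v s m
    have hc : Measurable[history m V v s m] fun ω => regionCount ρ V s (ω, x) :=
      Finset.measurable_fun_sum _ fun k hk => @measurable_near _ _ (_) _ _ _ _ ρ _ _
        (@measurable_const _ _ (_) (_) _) (@TrajectoryMeasurable.position _ _ (_) _ _ _ _ _ _
          hThist k hk)
    have hx : Measurable fun y => near ρ x y := measurable_near measurable_const measurable_id
    have hg : Measurable[(history m V v s m).prod inferInstance]
        fun z : Ω × Sphere d => Real.exp (t * regionCount ρ V s (z.1, x))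
          * Real.exp (t * near ρ x z.2) :=
      (Real.measurable_exp.comp ((hc.comp measurable_fst).const_mul _)).mul
        (Real.measurable_exp.comp ((hx.comp measurable_snd).const_mul _))
    have h1 : ∫ ω, Real.exp (t * regionCount ρ V (s + 1) (ω, x)) ∂P
        = ∫ ω, Real.exp (t * regionCount ρ V s (ω, x)) * Real.exp (t * near ρ x (V (s + 1) ω))
            ∂P := by
      refine integral_congr_ae (ae_of_all _ fun ω => ?_)
      simp only [regionCount]
      rw [← Real.exp_add, Finset.sum_Icc_succ_top (by omega), mul_add]
    have hpt : ∀ y, Real.exp (t * near ρ x y) = 1 + (Real.exp t - 1) * near ρ x y := fun y => by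
      rcases near_eq_zero_or_one ρ x y with h0 | h0 <;> simp [h0]
    have h2 : ∫ y, Real.exp (t * near ρ x y) ∂(area d) ≤ Real.exp ((Real.exp t - 1) * q) := by
      simp only [hpt]
      rw [integral_add (integrable_const _) ((integrable_near ρ x).const_mul _),
        integral_const_mul, integral_const, probReal_univ, one_smul]
      have h3 : 0 ≤ Real.exp t - 1 := by linarith [Real.one_le_exp ht]
      have h4 := mul_le_mul_of_nonneg_left hq h3
      linarith [Real.add_one_le_exp ((Real.exp t - 1) * q)]
    rw [h1, integral_indep hV (h.history_le le_rfl) hindep hg, h.uniform (s + 1) (by omega),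
      integral_prod_mul (f := fun ω => Real.exp (t * regionCount ρ V s (ω, x)))
        (g := fun y => Real.exp (t * near ρ x y))]
    calc _ ≤ Real.exp ((Real.exp t - 1) * q * s) * Real.exp ((Real.exp t - 1) * q) :=
          mul_le_mul ih h2 (integral_nonneg fun _ => (Real.exp_pos _).le) (Real.exp_pos _).le
      _ = _ := by rw [← Real.exp_add]; push_cast; ring_nf

theorem integrable_exp_count (h : IsGPM P d m δ r V v) (ρ : ℝ) {t : ℝ} (ht : 0 ≤ t) (s : ℕ) :
    Integrable (fun z => Real.exp (t * regionCount ρ V s z)) (P.prod (area d)) := by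
  have hprob := h.isProbabilityMeasure_area
  refine integrable_of_abs_le ((h.trajectoryMeasurable (n := s) le_rfl).regionCount.const_mul
    _).exp (Real.exp (t * s)) fun z => ?_
  rw [abs_of_pos (Real.exp_pos _)]
  exact Real.exp_le_exp.2 (mul_le_mul_of_nonneg_left (regionCount_le _ _) ht)

theorem integral_exp_count_prod_le (h : IsGPM P d m δ r V v) {ρ q t : ℝ} (ht : 0 ≤ t)
    (hq : ∀ x, ∫ y, near ρ x y ∂(area d) ≤ q) (s : ℕ) :
    ∫ z, Real.exp (t * regionCount ρ V s z) ∂(P.prod (area d))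
      ≤ Real.exp ((Real.exp t - 1) * q * s) := by
  have hprob := h.isProbabilityMeasure_area
  have hint := h.integrable_exp_count ρ ht s
  rw [integral_prod_symm _ hint]
  calc _ ≤ ∫ _, Real.exp ((Real.exp t - 1) * q * s) ∂(area d) :=
        integral_mono hint.integral_prod_right (integrable_const _)
          fun x => h.integral_exp_count_le ht (hq x) s
    _ = _ := by simp

/-- Chernoff bound for the number of vertices in a ball around a random point. -/
theorem count_tail_le (h : IsGPM P d m δ r V v) {ρ q : ℝ}
    (hq : ∀ x, ∫ y, near ρ x y ∂(area d) ≤ q) (s : ℕ) (b : ℝ) :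
    (P.prod (area d)).real {z | b < regionCount ρ V s z}
      ≤ Real.exp ((Real.exp 1 - 1) * q * s - b) := by
  have hprob := h.isProbabilityMeasure_area
  have hset : MeasurableSet {z | b < regionCount ρ V s z} :=
    measurableSet_lt measurable_const (h.trajectoryMeasurable (n := s) le_rfl).regionCount
  have hint := h.integrable_exp_count ρ zero_le_one s
  rw [← integral_indicator_one hset]
  calc _ ≤ ∫ z, Real.exp (-b) * Real.exp (1 * regionCount ρ V s z) ∂(P.prod (area d)) := by
        refine integral_mono ((integrable_const 1).indicator hset) (hint.const_mul _) fun z => ?_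
        by_cases hz : z ∈ {z | b < regionCount ρ V s z}
        · rw [Set.indicator_of_mem hz]
          simp only [Pi.one_apply]
          rw [← Real.exp_add]
          have : b < regionCount ρ V s z := hz
          exact Real.one_le_exp (by linarith)
        · rw [Set.indicator_of_notMem hz]; positivity
    _ ≤ Real.exp (-b) * Real.exp ((Real.exp 1 - 1) * q * s) := by
        rw [integral_const_mul]
        exact mul_le_mul_of_nonneg_left (h.integral_exp_count_prod_le zero_le_one hq s)
          (Real.exp_pos _).le
    _ = _ := by rw [← Real.exp_add]; ring_nf

/-- On an event of small probability, the number of vertices in a detection region has small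
expectation: it rarely exceeds a multiple of its mean. -/
theorem integral_indicator_count_le (h : IsGPM P d m δ r V v) (hp0 : 0 < p)
    (hp : ∀ x, ∫ y, near r x y ∂(area d) = p) (s : ℕ) {A : Set (Ω × Sphere d)}
    (hA : MeasurableSet A) :
    ∫ z, A.indicator (fun z => regionCount r V s z + 1) z ∂(P.prod (area d))
      ≤ 8 * (p * ((s : ℝ) + 1)) * (P.prod (area d)).real A
        + Real.exp 1 * Real.exp (-(p * ((s : ℝ) + 1))) := by
  have hprob := h.isProbabilityMeasure_area
  set b := 8 * (p * ((s : ℝ) + 1)) with hb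
  have hint := h.integrable_exp_count r zero_le_two s
  have hcm := (h.trajectoryMeasurable (n := s) le_rfl).regionCount (r := r)
  have hAint : Integrable (A.indicator (1 : Ω × Sphere d → ℝ)) (P.prod (area d)) :=
    (integrable_const 1).indicator hA
  have hcint : Integrable (A.indicator fun z => regionCount r V s z + 1) (P.prod (area d)) := by
    refine Integrable.indicator (integrable_of_abs_le (hcm.add_const _) (s + 1) fun z => ?_) hA
    rw [abs_of_nonneg (add_nonneg (regionCount_nonneg _ _) zero_le_one)]
    linarith [regionCount_le (r := r) (V := V) s z]
  calc _ ≤ ∫ z, (b * A.indicator 1 z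
        + Real.exp (1 - b) * Real.exp (2 * regionCount r V s z)) ∂(P.prod (area d)) := by
        refine integral_mono hcint ((hAint.const_mul _).add (hint.const_mul _)) fun z => ?_
        have hpos : 0 < Real.exp (1 - b) * Real.exp (2 * regionCount r V s z) := by positivity
        by_cases hz : z ∈ A
        · simp only [Set.indicator_of_mem hz, Pi.one_apply, mul_one]
          by_cases hc : regionCount r V s z + 1 ≤ b
          · linarith
          · -- `n + 1 ≤ exp n` and `1 ≤ exp (n + 1 - b)`
            have h1 := Real.add_one_le_exp (regionCount r V s z)
            have h2 : 1 ≤ Real.exp (regionCount r V s z + 1 - b) :=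
              Real.one_le_exp (by linarith)
            have h3 : Real.exp (1 - b) * Real.exp (2 * regionCount r V s z)
                = Real.exp (regionCount r V s z) * Real.exp (regionCount r V s z + 1 - b) := by
              rw [← Real.exp_add, ← Real.exp_add]; ring_nf
            have hb0 : 0 < b := by positivity
            have h4 := Real.exp_pos (regionCount r V s z)
            rw [h3]
            nlinarith
        · simp only [Set.indicator_of_notMem hz]; linarith
    _ ≤ b * (P.prod (area d)).real A + Real.exp (1 - b) * Real.exp ((Real.exp 2 - 1) * p * s) := by
        rw [integral_add (hAint.const_mul _) (hint.const_mul _), integral_const_mul,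
          integral_const_mul, integral_indicator_one hA]
        gcongr
        exact h.integral_exp_count_prod_le zero_le_two (fun x => (hp x).le) s
    _ ≤ _ := by
        rw [← Real.exp_add, ← Real.exp_add]
        gcongr ?_ + Real.exp ?_
        · exact le_rfl
        -- the constant `8` exceeds `exp 2`, which leaves a factor `exp (-p (s + 1))`
        · have he : Real.exp 2 ≤ 8 := by
            have h1 := Real.exp_one_lt_d9
            have h2 : Real.exp 2 = Real.exp 1 * Real.exp 1 := by rw [← Real.exp_add]; norm_num
            have h3 := Real.exp_pos 1
            nlinarith
          have h4 : 0 ≤ p * s := by positivity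
          have h5 : (Real.exp 2 - 1) * p * s ≤ 7 * (p * s) := by nlinarith
          linarith

/-- Exponential moment of the number of vertices in the detection region of `V_k`. -/
theorem integral_exp_degree_le (h : IsGPM P d m δ r V v) (hr : 0 ≤ r) (hp0 : 0 < p)
    (hp : ∀ x, ∫ y, near r x y ∂(area d) = p) {k s : ℕ} (hk : 1 ≤ k) (hks : k ≤ s) :
    ∫ ω, Real.exp (∑ a ∈ Finset.Icc 1 s, near r (V k ω) (V a ω)) ∂P
      ≤ Real.exp (1 + (Real.exp 1 - 1) * p * s) := by
  have hprob := h.isProbabilityMeasure_area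
  have he1 : 0 ≤ Real.exp 1 - 1 := by linarith [Real.one_le_exp zero_le_one]
  induction s, hks using Nat.le_induction with
  | base =>
    obtain ⟨j, rfl⟩ : ∃ j, k = j + 1 := ⟨k - 1, by omega⟩
    have hindep := h.indep (j + 1) (by omega)
    rw [Nat.add_sub_cancel] at hindep
    have hg : Measurable[(history m V v j m).prod inferInstance]
        fun z : Ω × Sphere d => Real.exp 1 * Real.exp (1 * regionCount r V j z) :=
      (Real.measurable_exp.comp ((@TrajectoryMeasurable.regionCount d m r Ω (_) V v j m
        (trajectoryMeasurable_history m V v j m)).const_mul _)).const_mul _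
    have h1 := integral_indep (h.measurable_position (j + 1) (by omega)) (h.history_le le_rfl)
      hindep hg
    rw [h.uniform (j + 1) (by omega)] at h1
    calc _ = ∫ ω, Real.exp 1 * Real.exp (1 * regionCount r V j (ω, V (j + 1) ω)) ∂P := by
          refine integral_congr_ae (ae_of_all _ fun ω => ?_)
          simp only [regionCount]
          rw [Finset.sum_Icc_succ_top (by omega), near_self hr, ← Real.exp_add]
          ring_nf
      _ ≤ Real.exp 1 * Real.exp ((Real.exp 1 - 1) * p * j) := by
          rw [h1, integral_const_mul]
          exact mul_le_mul_of_nonneg_left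
            (h.integral_exp_count_prod_le zero_le_one (fun x => (hp x).le) j) (Real.exp_pos _).le
      _ ≤ _ := by
          rw [← Real.exp_add]
          refine Real.exp_le_exp.2 ?_
          have : 0 ≤ (Real.exp 1 - 1) * p := by positivity
          push_cast
          linarith
  | succ s hks ih =>
    have hindep := h.indep (s + 1) (by omega)
    rw [Nat.add_sub_cancel] at hindep
    have hThist := trajectoryMeasurable_history m V v s m
    have hpos := @TrajectoryMeasurable.position _ _ (_) _ _ _ _ _ _ hThist
    have hkm := hpos k (Finset.mem_Icc.2 ⟨hk, hks⟩)
    set F : Ω → ℝ := fun ω => Real.exp (∑ a ∈ Finset.Icc 1 s, near r (V k ω) (V a ω)) with hF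
    have hFm : Measurable[history m V v s m] F :=
      Real.measurable_exp.comp (Finset.measurable_fun_sum _ fun a ha =>
        @measurable_near _ _ (_) _ _ _ _ r _ _ hkm (hpos a ha))
    have hF0 : ∀ ω, 0 ≤ F ω := fun ω => (Real.exp_pos _).le
    have hF1 : ∀ ω, F ω ≤ Real.exp s := fun ω => by
      refine Real.exp_le_exp.2 ?_
      calc _ ≤ ∑ a ∈ Finset.Icc 1 s, (1 : ℝ) := Finset.sum_le_sum fun _ _ => near_le_one _ _ _
        _ = s := by simp
    have hle := h.history_le (n := s) le_rfl
    have hFm' : Measurable F := hFm.mono hle le_rfl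
    have hFint : Integrable F P := integrable_of_abs_le hFm' (Real.exp s) fun ω => by
      rw [abs_of_nonneg (hF0 ω)]; exact hF1 ω
    have hg : Measurable[(history m V v s m).prod inferInstance]
        fun z : Ω × Sphere d => F z.1 * (1 + (Real.exp 1 - 1) * near r (V k z.1) z.2) := by
      refine (hFm.comp measurable_fst).mul (Measurable.const_add (Measurable.const_mul ?_ _) _)
      exact @measurable_near _ _ (_) _ _ _ _ r _ _ (hkm.comp measurable_fst) measurable_snd
    have hgint : Integrable
        (fun z : Ω × Sphere d => F z.1 * (1 + (Real.exp 1 - 1) * near r (V k z.1) z.2))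
        (P.prod (area d)) := by
      refine integrable_of_abs_le ((hFm'.comp measurable_fst).mul (Measurable.const_add
        (Measurable.const_mul (measurable_near ((h.measurable_position k hk).comp measurable_fst)
          measurable_snd) _) _)) (Real.exp s * Real.exp 1) fun z => ?_
      have h0 : 0 ≤ 1 + (Real.exp 1 - 1) * near r (V k z.1) z.2 :=
        add_nonneg zero_le_one (mul_nonneg he1 (near_nonneg _ _ _))
      rw [abs_of_nonneg (mul_nonneg (hF0 _) h0)]
      refine mul_le_mul (hF1 _) ?_ h0 (Real.exp_pos _).le
      have := mul_le_mul_of_nonneg_left (near_le_one r (V k z.1) z.2) he1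
      linarith
    calc _ = ∫ ω, F ω * (1 + (Real.exp 1 - 1) * near r (V k ω) (V (s + 1) ω)) ∂P := by
          refine integral_congr_ae (ae_of_all _ fun ω => ?_)
          simp only [hF]
          rw [Finset.sum_Icc_succ_top (by omega), Real.exp_add]
          rcases near_eq_zero_or_one r (V k ω) (V (s + 1) ω) with h0 | h0 <;> simp [h0]
      _ = (1 + (Real.exp 1 - 1) * p) * ∫ ω, F ω ∂P := by
          rw [integral_indep (h.measurable_position (s + 1) (by omega)) hle hindep hg,
            h.uniform (s + 1) (by omega), integral_prod _ hgint, ← integral_const_mul]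
          refine integral_congr_ae (ae_of_all _ fun ω => ?_)
          simp only []
          rw [integral_const_mul, integral_add (integrable_const _)
            ((integrable_near r _).const_mul _), integral_const_mul, hp, integral_const,
            probReal_univ, one_smul]
          ring
      _ ≤ Real.exp ((Real.exp 1 - 1) * p) * Real.exp (1 + (Real.exp 1 - 1) * p * s) :=
          mul_le_mul (by linarith [Real.add_one_le_exp ((Real.exp 1 - 1) * p)]) ih
            (integral_nonneg hF0) (Real.exp_pos _).le
      _ = _ := by rw [← Real.exp_add]; push_cast; ring_nf

end IsGPM

/-! ### Crude upper bounds -/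

theorem exp_one_sub_one_le : Real.exp 1 - 1 ≤ 2 := by linarith [Real.exp_one_lt_d9]

theorem integral_near {d : ℕ} {μ : Measure (Sphere d)} (r : ℝ) (x : Sphere d) :
    ∫ y, near r x y ∂μ = μ.real (Metric.closedBall x r) := by
  rw [← integral_indicator_one Metric.isClosed_closedBall.measurableSet]
  refine integral_congr_ae (ae_of_all _ fun y => ?_)
  by_cases hy : y ∈ Metric.closedBall x r
  · have hy' : dist x y ≤ r := by rwa [dist_comm]
    simp [near, hy, hy']
  · have hy' : ¬ dist x y ≤ r := by rwa [dist_comm]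
    simp [near, hy, hy']

theorem card_le_of_separated_of_dist_le {d : ℕ} {r : ℝ} (hr : 0 < r) (x : Sphere d)
    (T : Finset (Sphere d)) (hT : ∀ y ∈ T, dist y x ≤ 2 * r)
    (hsep : ∀ y ∈ T, ∀ z ∈ T, y ≠ z → r ≤ dist y z) : T.card ≤ 5 ^ (d + 1) := by
  classical
  have hinj : Function.Injective fun y : Sphere d => r⁻¹ • ((y : Ambient d) - x) := by
    intro y z hyz
    have h1 : (y : Ambient d) - x = z - x :=
      smul_right_injective _ (inv_ne_zero hr.ne') hyz
    exact Subtype.ext (sub_left_injective h1)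
  have hnorm : ∀ a : Ambient d, ‖r⁻¹ • a‖ = ‖a‖ / r := fun a => by
    rw [norm_smul, norm_inv, Real.norm_of_nonneg hr.le, inv_mul_eq_div]
  have h := Besicovitch.card_le_of_separated
    (T.image fun y : Sphere d => r⁻¹ • ((y : Ambient d) - x)) ?_ ?_
  · rw [Finset.card_image_of_injective _ hinj] at h
    simpa using h
  · intro c hc
    obtain ⟨y, hy, rfl⟩ := Finset.mem_image.1 hc
    rw [hnorm, div_le_iff₀ hr, ← dist_eq_norm]
    exact hT y hy
  · intro c hc c' hc' hne
    obtain ⟨y, hy, rfl⟩ := Finset.mem_image.1 hc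
    obtain ⟨z, hz, rfl⟩ := Finset.mem_image.1 hc'
    have hyz : y ≠ z := fun h => hne (by rw [h])
    rw [← smul_sub, sub_sub_sub_cancel_right, hnorm, le_div_iff₀ hr, one_mul, ← dist_eq_norm]
    exact hsep y hy z hz hyz

/-- In a fixed dimension, doubling the radius of a ball multiplies its area by a bounded factor:
a maximal `r`-separated subset of the larger ball has a bounded number of points. -/
theorem area_double_le {d : ℕ} {p r : ℝ} (hr : 0 ≤ r) (hp : 0 < p)
    (h : ∀ x : Sphere d, area d (Metric.closedBall x r) = ENNReal.ofReal p) (x : Sphere d) :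
    (area d).real (Metric.closedBall x (2 * r)) ≤ 5 ^ (d + 1) * p := by
  classical
  have key : ∃ T : Finset (Sphere d), T.card ≤ 5 ^ (d + 1) ∧
      Metric.closedBall x (2 * r) ⊆ ⋃ y ∈ T, Metric.closedBall y r := by
    rcases hr.eq_or_lt with rfl | hr
    · exact ⟨{x}, by simpa using Nat.one_le_pow _ _ (by norm_num), by simp⟩
    by_contra hcon
    have hbig : ∀ k : ℕ, ∃ T : Finset (Sphere d), T.card = k ∧ (∀ y ∈ T, dist y x ≤ 2 * r) ∧
        ∀ y ∈ T, ∀ z ∈ T, y ≠ z → r ≤ dist y z := by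
      intro k
      induction k with
      | zero => exact ⟨∅, by simp⟩
      | succ k ih =>
        obtain ⟨T, hTk, hT1, hT2⟩ := ih
        have hnot : ¬ Metric.closedBall x (2 * r) ⊆ ⋃ y ∈ T, Metric.closedBall y r :=
          fun hsub => hcon ⟨T, card_le_of_separated_of_dist_le hr x T hT1 hT2, hsub⟩
        obtain ⟨y, hy, hyT⟩ := Set.not_subset.1 hnot
        have hfar : ∀ z ∈ T, r < dist y z := fun z hz => by
          by_contra hle
          exact hyT (Set.mem_biUnion hz (not_lt.1 hle))
        have hyn : y ∉ T := fun hyT' => by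
          have := hfar y hyT'
          rw [dist_self] at this
          linarith
        refine ⟨insert y T, by rw [Finset.card_insert_of_notMem hyn, hTk], ?_, ?_⟩
        · intro z hz
          rcases Finset.mem_insert.1 hz with rfl | hz
          · exact hy
          · exact hT1 z hz
        · intro z hz z' hz' hne
          rcases Finset.mem_insert.1 hz with hzy | hzT <;>
            rcases Finset.mem_insert.1 hz' with hzy' | hzT'
          · exact absurd (hzy.trans hzy'.symm) hne
          · rw [hzy]; exact (hfar z' hzT').le
          · rw [hzy', dist_comm]; exact (hfar z hzT).le
          · exact hT2 z hzT z' hzT' hne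
    obtain ⟨T, hTk, hT1, hT2⟩ := hbig (5 ^ (d + 1) + 1)
    have := card_le_of_separated_of_dist_le hr x T hT1 hT2
    omega
  obtain ⟨T, hT, hsub⟩ := key
  have h1 : area d (Metric.closedBall x (2 * r)) ≤ ENNReal.ofReal (5 ^ (d + 1) * p) := by
    calc _ ≤ area d (⋃ y ∈ T, Metric.closedBall y r) := measure_mono hsub
      _ ≤ ∑ y ∈ T, area d (Metric.closedBall y r) := measure_biUnion_finset_le _ _
      _ = T.card * ENNReal.ofReal p := by simp [h]
      _ ≤ (5 ^ (d + 1) : ℕ) * ENNReal.ofReal p := by gcongr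
      _ = _ := by
        rw [ENNReal.ofReal_mul (by positivity), ENNReal.ofReal_pow (by norm_num)]
        norm_num
  exact ENNReal.toReal_le_of_le_ofReal (by positivity) h1

namespace IsGPM

variable {Ω : Type*} [MeasurableSpace Ω] {P : Measure Ω} [IsProbabilityMeasure P] {d m : ℕ}
  {δ r p : ℝ} {V : ℕ → Ω → Sphere d} {v : ℕ → ℕ → Ω → ℕ}

theorem ae_prod_admissible (h : IsGPM P d m δ r V v) (hδ : 0 < δ) (hr : 0 ≤ r) :
    ∀ᵐ z ∂(P.prod (area d)), Admissible m r (V · z.1) (v · · z.1) := by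
  have hprob := h.isProbabilityMeasure_area
  exact Measure.quasiMeasurePreserving_fst.ae (h.ae_admissible hδ hr)

/-- A bound that is linear in `p (s + 1)`, when balls of radius `2 r` have area at most `K p`. -/
theorem upper_tail_le_of_double (h : IsGPM P d m δ r V v) (hδ : 0 < δ) (hr : 0 ≤ r)
    (hp0 : 0 < p) {K : ℝ} (hK : 1 ≤ K) (hq : ∀ x, ∫ y, near (2 * r) x y ∂(area d) ≤ K * p) (s : ℕ)
    (hs : 1 ≤ p * ((s : ℝ) + 1)) :
    (P.prod (area d)).real {z | m * (p * ((s : ℝ) + 1)) * (4 * K * (2 + δ) + (1 + δ))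
        < regionWeight m δ r V v s z} ≤ Real.exp (-(p * ((s : ℝ) + 1))) := by
  have hprob := h.isProbabilityMeasure_area
  set q := p * ((s : ℝ) + 1) with hqdef
  have h1 : (P.prod (area d)).real {z | m * q * (4 * K * (2 + δ) + (1 + δ))
        < regionWeight m δ r V v s z}
      ≤ (P.prod (area d)).real {z | 4 * K * q < regionCount (2 * r) V s z} := by
    refine ENNReal.toReal_mono (measure_ne_top _ _) (measure_mono_ae ?_)
    filter_upwards [h.ae_prod_admissible hδ hr] with z hz hlt
    change 4 * K * q < regionCount (2 * r) V s z
    by_contra hcon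
    have h2 := mass_le_of_double (m := m) hδ hr hz s z.2
    have h3 : m * q * (4 * K * (2 + δ) + (1 + δ)) < regionWeight m δ r V v s z := hlt
    rw [regionWeight, load_one] at h3
    have h4 : (m : ℝ) * (2 + δ) * regionCount (2 * r) V s z ≤ m * (2 + δ) * (4 * K * q) :=
      mul_le_mul_of_nonneg_left (not_lt.1 hcon) (by positivity)
    have h5 : (m : ℝ) * (1 + δ) * 1 ≤ m * (1 + δ) * q :=
      mul_le_mul_of_nonneg_left hs (by positivity)
    rw [regionCount] at h4
    nlinarith
  refine h1.trans ((h.count_tail_le hq s _).trans (Real.exp_le_exp.2 ?_))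
  have h2 : (Real.exp 1 - 1) * (K * p) * s ≤ 2 * (K * p) * s := by
    gcongr
    exact exp_one_sub_one_le
  have h3 : 2 * (K * p) * s ≤ 2 * K * q := by
    have : 0 ≤ K * p := by positivity
    rw [hqdef]; linarith
  have h4 : q ≤ K * q := le_mul_of_one_le_left (by positivity) hK
  nlinarith

/-- A bound that is quadratic in `p (s + 1)`, uniformly in the dimension: every vertex of the
region has few vertices in its own detection region. -/
theorem upper_tail_le_sq (h : IsGPM P d m δ r V v) (hδ : 0 < δ) (hr : 0 ≤ r)
    (hp0 : 0 < p) (hp : ∀ x, ∫ y, near r x y ∂(area d) = p) (s : ℕ)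
    (hs : 1 ≤ p * ((s : ℝ) + 1)) :
    (P.prod (area d)).real {z | 17 * (m * (2 + δ)) * (p * ((s : ℝ) + 1)) ^ 2
        < regionWeight m δ r V v s z}
      ≤ Real.exp (-(p * ((s : ℝ) + 1)))
        + p * ((s : ℝ) + 1) * (Real.exp 1 * Real.exp (-(p * ((s : ℝ) + 1)))) := by
  have hprob := h.isProbabilityMeasure_area
  set q := p * ((s : ℝ) + 1) with hqdef
  -- Counts of vertices above `b` are exceptional: their exponential moments are of order
  -- `exp (2 q)`. In units of `m (2 + δ)`, counts below `b` give the weight `b ^ 2 = 16 q ^ 2`, and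
  -- the share of the new vertex is at most `q ^ 2`.
  set b := 4 * q with hb
  have hT := h.trajectoryMeasurable (n := s) le_rfl
  set N : ℕ → Ω → ℝ := fun k ω => ∑ a ∈ Finset.Icc 1 s, near r (V k ω) (V a ω) with hN
  have hNm : ∀ k ∈ Finset.Icc 1 s, Measurable (N k) := fun k hk =>
    Finset.measurable_fun_sum _ fun a ha => measurable_near (hT.position k hk) (hT.position a ha)
  have hN1 : ∀ k ω, N k ω ≤ s := fun k ω => by
    calc _ ≤ ∑ a ∈ Finset.Icc 1 s, (1 : ℝ) := Finset.sum_le_sum fun _ _ => near_le_one _ _ _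
      _ = s := by simp
  set A := {z | 17 * (m * (2 + δ)) * q ^ 2 < regionWeight m δ r V v s z} with hA
  set B := {z | b < regionCount r V s z} with hB
  have hAm : MeasurableSet A := measurableSet_lt measurable_const hT.regionWeight
  have hBm : MeasurableSet B := measurableSet_lt measurable_const hT.regionCount
  have hps : (Real.exp 1 - 1) * p * s ≤ 2 * q := by
    have h1 : (Real.exp 1 - 1) * p * s ≤ 2 * p * s := by
      gcongr
      exact exp_one_sub_one_le
    rw [hqdef]; linarith
  have hint : ∀ k ∈ Finset.Icc 1 s, Integrable
      (fun z : Ω × Sphere d => Real.exp (N k z.1 - b) * near r z.2 (V k z.1))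
      (P.prod (area d)) := fun k hk => by
    refine integrable_of_abs_le ((((hNm k hk).comp measurable_fst).sub_const _).exp.mul
      (measurable_near measurable_snd ((hT.position k hk).comp measurable_fst)))
      (Real.exp (s - b) * 1) fun z => ?_
    rw [abs_of_nonneg (mul_nonneg (Real.exp_pos _).le (near_nonneg _ _ _))]
    exact mul_le_mul (Real.exp_le_exp.2 (by linarith [hN1 k z.1])) (near_le_one _ _ _)
      (near_nonneg _ _ _) (Real.exp_pos _).le
  have hval : ∀ k ∈ Finset.Icc 1 s,
      ∫ z, Real.exp (N k z.1 - b) * near r z.2 (V k z.1) ∂(P.prod (area d))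
        ≤ p * (Real.exp 1 * Real.exp (-q)) := fun k hk => by
    have hk' := Finset.mem_Icc.1 hk
    rw [integral_prod _ (hint k hk)]
    simp only [integral_const_mul, near_comm r _ (V k _), hp]
    rw [integral_mul_const, mul_comm]
    refine mul_le_mul_of_nonneg_left ?_ hp0.le
    simp only [sub_eq_add_neg, Real.exp_add]
    rw [integral_mul_const]
    calc _ ≤ Real.exp (1 + (Real.exp 1 - 1) * p * s) * Real.exp (-b) :=
          mul_le_mul_of_nonneg_right (h.integral_exp_degree_le hr hp0 hp hk'.1 hk'.2)
            (Real.exp_pos _).le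
      _ ≤ _ := by
          rw [← Real.exp_add, ← Real.exp_add]
          refine Real.exp_le_exp.2 ?_
          linarith
  have hA1 : (P.prod (area d)).real A ≤ (P.prod (area d)).real B
      + ∑ k ∈ Finset.Icc 1 s,
        ∫ z, Real.exp (N k z.1 - b) * near r z.2 (V k z.1) ∂(P.prod (area d)) := by
    have hBint : Integrable (B.indicator (1 : Ω × Sphere d → ℝ)) (P.prod (area d)) :=
      (integrable_const 1).indicator hBm
    rw [← integral_indicator_one hAm, ← integral_indicator_one hBm, ← integral_finsetSum _ hint,
      ← integral_add hBint (integrable_finsetSum _ hint)]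
    refine integral_mono_ae ((integrable_const 1).indicator hAm)
      (hBint.add (integrable_finsetSum _ hint)) ?_
    filter_upwards [h.ae_prod_admissible hδ hr] with z hz
    have hnn : ∀ k, 0 ≤ Real.exp (N k z.1 - b) * near r z.2 (V k z.1) := fun k =>
      mul_nonneg (Real.exp_pos _).le (near_nonneg _ _ _)
    have hB0 : 0 ≤ B.indicator (1 : Ω × Sphere d → ℝ) z :=
      Set.indicator_nonneg (fun _ _ => zero_le_one) z
    by_cases hzA : z ∈ A
    swap
    · rw [Set.indicator_of_notMem hzA]
      exact add_nonneg hB0 (Finset.sum_nonneg fun k _ => hnn k)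
    rw [Set.indicator_of_mem hzA, Pi.one_apply]
    by_cases hzB : z ∈ B
    · rw [Set.indicator_of_mem hzB, Pi.one_apply]
      have := Finset.sum_nonneg fun k (_ : k ∈ Finset.Icc 1 s) => hnn k
      linarith
    -- some vertex of the region sees more than `b` vertices, or none does
    by_cases hk : ∃ k ∈ Finset.Icc 1 s, near r z.2 (V k z.1) = 1 ∧ b < N k z.1
    · obtain ⟨k, hk, hk1, hk2⟩ := hk
      have h1 := Finset.single_le_sum
        (f := fun k => Real.exp (N k z.1 - b) * near r z.2 (V k z.1)) (fun k _ => hnn k) hk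
      have h2 : 1 ≤ Real.exp (N k z.1 - b) := Real.one_le_exp (by linarith)
      simp only [hk1, mul_one] at h1
      linarith
    · exfalso
      push Not at hk
      have hcount : regionCount r V s z ≤ b := not_lt.1 hzB
      have h1 := mass_le_sum_pairs (m := m) hδ hr hz s z.2
      have h2 : ∑ a ∈ Finset.Icc 1 s, ∑ k ∈ Finset.Icc 1 s,
          near r z.2 (V k z.1) * near r (V a z.1) (V k z.1) ≤ b * b := by
        rw [Finset.sum_comm]
        calc _ = ∑ k ∈ Finset.Icc 1 s, near r z.2 (V k z.1) * N k z.1 := by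
              refine Finset.sum_congr rfl fun k _ => ?_
              simp only [hN]
              rw [Finset.mul_sum]
              exact Finset.sum_congr rfl fun a _ => by rw [near_comm r (V a z.1)]
          _ ≤ ∑ k ∈ Finset.Icc 1 s, near r z.2 (V k z.1) * b := by
              refine Finset.sum_le_sum fun k hk' => ?_
              rcases near_eq_zero_or_one r z.2 (V k z.1) with h0 | h0
              · simp [h0]
              · rw [h0, one_mul, one_mul]; exact hk k hk' h0
          _ = regionCount r V s z * b := by rw [← Finset.sum_mul]; rfl
          _ ≤ b * b := mul_le_mul_of_nonneg_right hcount (by positivity)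
      have h3 := mul_le_mul_of_nonneg_left h2 (by positivity : 0 ≤ (m : ℝ) * (2 + δ))
      have h4 : 17 * (m * (2 + δ)) * q ^ 2 < regionWeight m δ r V v s z := hzA
      rw [regionWeight, load_one] at h4
      have h5 : (m : ℝ) * (1 + δ) ≤ m * (2 + δ) * q ^ 2 := by
        have h6 : (1 : ℝ) ≤ q ^ 2 := one_le_pow₀ hs
        have h7 : (m : ℝ) * (1 + δ) ≤ m * (2 + δ) := by gcongr; norm_num
        nlinarith [(by positivity : (0 : ℝ) ≤ m * (2 + δ))]
      have h8 : (m : ℝ) * (2 + δ) * (b * b) = 16 * (m * (2 + δ)) * q ^ 2 := by rw [hb]; ring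
      linarith
  have hB1 : (P.prod (area d)).real B ≤ Real.exp (-q) := by
    refine (h.count_tail_le (fun x => (hp x).le) s b).trans (Real.exp_le_exp.2 ?_)
    linarith
  have hsum := Finset.sum_le_sum hval
  rw [Finset.sum_const, Nat.card_Icc, Nat.add_sub_cancel, nsmul_eq_mul] at hsum
  have h9 : (s : ℝ) * (p * (Real.exp 1 * Real.exp (-q))) ≤ q * (Real.exp 1 * Real.exp (-q)) := by
    rw [← mul_assoc]
    refine mul_le_mul_of_nonneg_right ?_ (by positivity)
    rw [hqdef]; linarith
  linarith

end IsGPM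

universe u

/-! ### Families of processes -/

/-- A geometric preferential attachment process, with all its data, for given `m` and `δ`. Bounds
that are uniform in the dimension, the detection radius and the probability space are bounds that
are uniform over a set of such models. -/
structure Model (m : ℕ) (δ : ℝ) : Type (u + 1) where
  /-- the dimension of the sphere -/
  d : ℕ
  /-- the area of the detection region -/
  p : ℝ
  p_pos : 0 < p
  p_lt_one : p < 1
  /-- the detection radius -/
  r : ℝ
  area_ball : ∀ x : Sphere d, area d (Metric.closedBall x r) = ENNReal.ofReal p
  /-- the probability space -/
  Ω : Type u
  mΩ : MeasurableSpace Ω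
  /-- the probability measure -/
  P : Measure Ω
  prob : IsProbabilityMeasure P
  /-- the positions of the vertices -/
  V : ℕ → Ω → Sphere d
  /-- the targets of the edges -/
  v : ℕ → ℕ → Ω → ℕ
  isGPM : IsGPM P d m δ r V v

attribute [instance] Model.mΩ Model.prob

namespace Model

variable {m : ℕ} {δ : ℝ}

/-- The joint law of the process and of an independent uniform point of the sphere. -/
noncomputable def Q (M : Model.{u} m δ) : Measure (M.Ω × Sphere M.d) := M.P.prod (area M.d)

/-- The weight that a new vertex at `z.2` sees in its detection region after `s` vertices. -/
noncomputable def W (M : Model.{u} m δ) (s : ℕ) (z : M.Ω × Sphere M.d) : ℝ :=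
  regionWeight m δ M.r M.V M.v s z

instance (M : Model.{u} m δ) : IsProbabilityMeasure (area M.d) := M.isGPM.isProbabilityMeasure_area

instance (M : Model.{u} m δ) : IsProbabilityMeasure M.Q := by
  unfold Q; infer_instance

theorem integral_near_eq (M : Model.{u} m δ) (x : Sphere M.d) :
    ∫ y, near M.r x y ∂(area M.d) = M.p := by
  rw [integral_near, measureReal_def, M.area_ball, ENNReal.toReal_ofReal M.p_pos.le]

theorem r_nonneg (M : Model.{u} m δ) : 0 ≤ M.r := by
  by_contra hr
  have hne : Nonempty (Sphere M.d) := by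
    by_contra hemp
    rw [not_nonempty_iff] at hemp
    have h1 := measure_univ (μ := area M.d)
    rw [Set.eq_empty_of_isEmpty Set.univ, measure_empty] at h1
    exact zero_ne_one h1
  obtain ⟨x⟩ := hne
  have h1 := M.area_ball x
  rw [Metric.closedBall_eq_empty.2 (not_le.1 hr), measure_empty] at h1
  exact (ENNReal.ofReal_pos.2 M.p_pos).ne h1

end Model

variable {m : ℕ} {δ : ℝ}

/-- The expected number `p n` of vertices in a detection region, for the vertex number
`n = s + 1`. -/
noncomputable def scale (𝓒 : Set (Model.{u} m δ)) (i : 𝓒 × ℕ) : ℝ := i.1.1.p * ((i.2 : ℝ) + 1)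

/-- The probability that a new vertex sees a weight below `m p n / w` decays uniformly over the
family `𝓒`. -/
def LowerTail (𝓒 : Set (Model.{u} m δ)) (γ w : ℝ) : Prop :=
  Decays γ (scale 𝓒) fun i => i.1.1.Q.real {z | w * i.1.1.W i.2 z < m * scale 𝓒 i}

/-- The probability that a new vertex sees a weight above `m p n / a` decays uniformly over the
family `𝓒`. With the reciprocal of the bound as parameter, there is no bound at `a = 0`. -/
def UpperTail (𝓒 : Set (Model.{u} m δ)) (γ a : ℝ) : Prop :=
  Decays γ (scale 𝓒) fun i => i.1.1.Q.real {z | m * scale 𝓒 i < a * i.1.1.W i.2 z}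

theorem scale_pos (𝓒 : Set (Model.{u} m δ)) (i : 𝓒 × ℕ) : 0 < scale 𝓒 i :=
  mul_pos i.1.1.p_pos (by positivity)

theorem scale_nonneg (𝓒 : Set (Model.{u} m δ)) (i : 𝓒 × ℕ) : 0 ≤ scale 𝓒 i := (scale_pos 𝓒 i).le

theorem scale_le (𝓒 : Set (Model.{u} m δ)) (i : 𝓒 × ℕ) : scale 𝓒 i ≤ (i.2 : ℝ) + 1 :=
  mul_le_of_le_one_left (by positivity) i.1.1.p_lt_one.le

theorem Model.W_nonneg (hδ : 0 < δ) (M : Model.{u} m δ) (s : ℕ) (z : M.Ω × Sphere M.d) :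
    0 ≤ M.W s z := regionWeight_nonneg hδ s z

theorem upperTail_of_nonpos (hδ : 0 < δ) (𝓒 : Set (Model.{u} m δ)) (γ : ℝ) {a : ℝ} (ha : a ≤ 0) :
    UpperTail 𝓒 γ a := by
  refine ⟨1, 1, one_pos, one_pos, fun i => ?_⟩
  have h1 : {z | m * scale 𝓒 i < a * i.1.1.W i.2 z} = ∅ := by
    refine Set.eq_empty_of_forall_notMem fun z hz => ?_
    have h2 : 0 ≤ m * scale 𝓒 i := mul_nonneg (by positivity) (scale_nonneg 𝓒 i)
    have h3 : a * i.1.1.W i.2 z ≤ 0 :=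
      mul_nonpos_of_nonpos_of_nonneg ha (i.1.1.W_nonneg hδ _ _)
    have h4 : m * scale 𝓒 i < a * i.1.1.W i.2 z := hz
    linarith
  simp only [h1, measureReal_empty]
  positivity

theorem decays_exp {ι : Type*} {q : ι → ℝ} (γ : ℝ) {C c : ℝ} (hC : 0 < C) (hc : 0 < c) :
    Decays γ q (fun i => C * Real.exp (-c * q i ^ γ)) := ⟨C, c, hC, hc, fun _ => le_rfl⟩

/-- The number `⌊η n⌋` is of the order of `n`. -/
theorem floor_mul_facts {η : ℝ} (hη0 : 0 < η) (hη : η ≤ 1 / 2) {N : ℕ}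
    (hN : 2 / η ≤ (N : ℝ) + 1) :
    1 ≤ ⌊η * ((N : ℝ) + 1)⌋₊ ∧ ⌊η * ((N : ℝ) + 1)⌋₊ ≤ N ∧
      (⌊η * ((N : ℝ) + 1)⌋₊ : ℝ) ≤ η * ((N : ℝ) + 1) ∧
      η * ((N : ℝ) + 1) ≤ (⌊η * ((N : ℝ) + 1)⌋₊ : ℝ) + 1 ∧
      η / 2 * ((N : ℝ) + 1) ≤ (⌊η * ((N : ℝ) + 1)⌋₊ : ℝ) := by
  have h1 : 2 ≤ η * ((N : ℝ) + 1) := by rwa [div_le_iff₀' hη0] at hN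
  have h2 := Nat.floor_le (by positivity : 0 ≤ η * ((N : ℝ) + 1))
  have h3 := (Nat.lt_floor_add_one (η * ((N : ℝ) + 1))).le
  refine ⟨Nat.le_floor (by push_cast; linarith), ?_, h2, h3, by linarith⟩
  have h4 : η * ((N : ℝ) + 1) < ((N + 1 : ℕ) : ℝ) := by
    push_cast
    nlinarith [(Nat.cast_nonneg N : (0 : ℝ) ≤ N)]
  have := (Nat.floor_lt (by positivity)).2 h4
  omega

theorem rpow_div_le {N s : ℕ} {η θ : ℝ} (hη0 : 0 < η) (hθ1 : θ ≤ 1) (hs : 1 ≤ s)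
    (hsN : s ≤ N) (h : η / 2 * ((N : ℝ) + 1) ≤ s) : ((N : ℝ) / s) ^ θ ≤ 2 / η := by
  have hs0 : (0 : ℝ) < s := by exact_mod_cast hs
  have h1 : (1 : ℝ) ≤ (N : ℝ) / s := by
    rw [le_div_iff₀ hs0, one_mul]; exact_mod_cast hsN
  calc ((N : ℝ) / s) ^ θ ≤ ((N : ℝ) / s) ^ (1 : ℝ) := Real.rpow_le_rpow_of_exponent_le h1 hθ1
    _ = (N : ℝ) / s := Real.rpow_one _
    _ ≤ 2 / η := by
      rw [div_le_div_iff₀ hs0 hη0]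
      have : (0 : ℝ) ≤ η := hη0.le
      nlinarith

theorem succ_mul_rpow_div_le {N s : ℕ} {η θ θ' : ℝ} (hθ0 : 0 ≤ θ) (hθ : θ ≤ θ')
    (hθ1 : θ' < 1) (hs : 1 ≤ s) (hsN : s ≤ N) (h : (s : ℝ) ≤ η * ((N : ℝ) + 1)) :
    ((s : ℝ) + 1) * ((N : ℝ) / s) ^ θ ≤ 2 * η ^ (1 - θ') * ((N : ℝ) + 1) := by
  have hs0 : (0 : ℝ) < s := by exact_mod_cast hs
  have hs1 : (1 : ℝ) ≤ s := by exact_mod_cast hs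
  have hsN' : (s : ℝ) ≤ N := by exact_mod_cast hsN
  set n : ℝ := (N : ℝ) + 1 with hn
  have hn0 : 0 < n := by positivity
  have h1 : (1 : ℝ) ≤ n / s := by
    rw [le_div_iff₀ hs0]; linarith
  have h2 : ((N : ℝ) / s) ^ θ ≤ (n / s) ^ θ' := by
    calc ((N : ℝ) / s) ^ θ ≤ ((N : ℝ) / s) ^ θ' :=
          Real.rpow_le_rpow_of_exponent_le (by rw [le_div_iff₀ hs0]; linarith) hθ
      _ ≤ _ := by
          refine Real.rpow_le_rpow (by positivity) ?_ (hθ0.trans hθ)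
          gcongr; linarith
  have h3 : (s : ℝ) * (n / s) ^ θ' = n * (s / n) ^ (1 - θ') := by
    rw [Real.div_rpow hn0.le hs0.le, Real.div_rpow hs0.le hn0.le, Real.rpow_sub hs0,
      Real.rpow_sub hn0, Real.rpow_one, Real.rpow_one]
    have := Real.rpow_pos_of_pos hs0 θ'
    have := Real.rpow_pos_of_pos hn0 θ'
    field_simp
  have h4 : ((s : ℝ) / n) ^ (1 - θ') ≤ η ^ (1 - θ') :=
    Real.rpow_le_rpow (by positivity) ((div_le_iff₀ hn0).2 h) (by linarith)
  calc _ ≤ (2 * (s : ℝ)) * (n / s) ^ θ' := by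
        refine mul_le_mul (by linarith) h2 (by positivity) (by positivity)
    _ = 2 * (n * (s / n) ^ (1 - θ')) := by rw [← h3]; ring
    _ ≤ 2 * (n * η ^ (1 - θ')) := by gcongr
    _ = _ := by ring

/-! ### Alternating upper and lower bounds -/

theorem exists_small {f : ℝ → ℝ} (hf : Continuous f) (h0 : 0 < f 0) :
    ∃ κ, 0 < κ ∧ κ < 1 ∧ 0 < f κ := by
  have h1 : ∀ᶠ κ in nhdsWithin (0 : ℝ) (Set.Ioi 0), 0 < f κ :=
    (hf.tendsto 0).eventually (lt_mem_nhds h0) |>.filter_mono nhdsWithin_le_nhds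
  obtain ⟨κ, h2, h3⟩ := (h1.and (Ioo_mem_nhdsGT (zero_lt_one' ℝ))).exists
  exact ⟨κ, h3.1, h3.2, h2⟩

theorem exists_rpow_le {x a : ℝ} (hx : 0 < x) (ha : 0 < a) :
    ∃ η : ℝ, 0 < η ∧ η ≤ 1 / 2 ∧ η ^ a ≤ x := by
  refine ⟨min (1 / 2) (x ^ a⁻¹), lt_min (by norm_num) (by positivity), min_le_left _ _, ?_⟩
  calc (min (1 / 2) (x ^ a⁻¹)) ^ a ≤ (x ^ a⁻¹) ^ a :=
        Real.rpow_le_rpow (le_min (by norm_num) (by positivity)) (min_le_right _ _) ha.le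
    _ = x := Real.rpow_inv_rpow hx.le ha.ne'

theorem exp_neg_mul_rpow_le {c η q x γ : ℝ} (hc : 0 ≤ c) (hη : 0 ≤ η) (hq : 0 ≤ q) (hγ : 0 ≤ γ)
    (h : η * q ≤ x) : Real.exp (-c * x ^ γ) ≤ Real.exp (-(c * η ^ γ) * q ^ γ) := by
  have h1 : η ^ γ * q ^ γ ≤ x ^ γ := by
    rw [← Real.mul_rpow hη hq]
    exact Real.rpow_le_rpow (mul_nonneg hη hq) h hγ
  rw [Real.exp_le_exp, neg_mul, neg_mul, neg_le_neg_iff, mul_assoc]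
  exact mul_le_mul_of_nonneg_left h1 hc

/-- The contribution of one vertex to the error term of the lower tail. -/
theorem integral_exceptional_le {𝓒 : Set (Model.{u} m δ)} {γ a C c c' η : ℝ}
    (hγ0 : 0 < γ) (hγ1 : γ ≤ 1) (ha1 : a ≤ 1) (hC : 0 ≤ C) (hc : 0 ≤ c) (hη0 : 0 < η)
    (hc'1 : c' ≤ c * η ^ γ) (hc'2 : c' ≤ η)
    (hβ : ∀ i : 𝓒 × ℕ, i.1.1.Q.real {z | m * scale 𝓒 i < a * i.1.1.W i.2 z}
      ≤ C * Real.exp (-c * scale 𝓒 i ^ γ)) (M : 𝓒) {j N : ℕ} (hjN : j ≤ N)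
    (hj : η * ((N : ℝ) + 1) ≤ (j : ℝ) + 1) (hq1 : 1 ≤ scale 𝓒 (M, N)) :
    a / ((j : ℝ) + 1) * ∫ z, Set.indicator
          {z | m * M.1.p * ((j : ℝ) + 1) < a * regionWeight m δ M.1.r M.1.V M.1.v j z}
          (fun z => regionCount M.1.r M.1.V j z + 1) z ∂(M.1.P.prod (area M.1.d))
        ≤ (η * ((N : ℝ) + 1))⁻¹ * (8 * (scale 𝓒 (M, N) *
            (C * Real.exp (-c' * scale 𝓒 (M, N) ^ γ)))
          + Real.exp 1 * Real.exp (-c' * scale 𝓒 (M, N) ^ γ)) := by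
  have hp0 := M.1.p_pos
  have hjN' : (j : ℝ) ≤ N := by exact_mod_cast hjN
  have hset : {z | m * M.1.p * ((j : ℝ) + 1) < a * regionWeight m δ M.1.r M.1.V M.1.v j z}
      = {z | m * scale 𝓒 (M, j) < a * M.1.W j z} := by rw [mul_assoc]; rfl
  have hmeas : MeasurableSet
      {z | m * M.1.p * ((j : ℝ) + 1) < a * regionWeight m δ M.1.r M.1.V M.1.v j z} :=
    measurableSet_lt measurable_const
      ((M.1.isGPM.trajectoryMeasurable (n := j) le_rfl).regionWeight.const_mul _)
  have h1 := M.1.isGPM.integral_indicator_count_le hp0 M.1.integral_near_eq j hmeas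
  have h2 := hβ (M, j)
  have hqj1 : η * scale 𝓒 (M, N) ≤ scale 𝓒 (M, j) := by
    calc η * (M.1.p * ((N : ℝ) + 1)) = M.1.p * (η * ((N : ℝ) + 1)) := by ring
      _ ≤ M.1.p * ((j : ℝ) + 1) := mul_le_mul_of_nonneg_left hj hp0.le
  have hqj2 : scale 𝓒 (M, j) ≤ scale 𝓒 (M, N) :=
    mul_le_mul_of_nonneg_left (add_le_add_left hjN' 1) hp0.le
  have hq0 : 0 ≤ scale 𝓒 (M, N) := zero_le_one.trans hq1
  have hqj0 : 0 ≤ scale 𝓒 (M, j) := scale_nonneg 𝓒 _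
  rw [show M.1.p * ((j : ℝ) + 1) = scale 𝓒 (M, j) from rfl] at h1
  rw [hset] at h1 ⊢
  generalize scale 𝓒 (M, j) = qj at *
  generalize scale 𝓒 (M, N) = q at *
  have hqγ0 : 0 ≤ q ^ γ := Real.rpow_nonneg hq0 _
  have hβj : Real.exp (-c * qj ^ γ) ≤ Real.exp (-c' * q ^ γ) := by
    refine (exp_neg_mul_rpow_le hc hη0.le hq0 hγ0.le hqj1).trans (Real.exp_le_exp.2 ?_)
    exact mul_le_mul_of_nonneg_right (neg_le_neg hc'1) hqγ0
  have hej : Real.exp (-qj) ≤ Real.exp (-c' * q ^ γ) := by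
    have h3 : q ^ γ ≤ q := by
      calc q ^ γ ≤ q ^ (1 : ℝ) := Real.rpow_le_rpow_of_exponent_le hq1 hγ1
        _ = q := Real.rpow_one q
    rw [Real.exp_le_exp, neg_mul, neg_le_neg_iff]
    exact (mul_le_mul hc'2 h3 hqγ0 hη0.le).trans hqj1
  have h5 : 8 * qj * (M.1.P.prod (area M.1.d)).real {z | m * qj < a * M.1.W j z}
      ≤ 8 * (q * (C * Real.exp (-c' * q ^ γ))) := by
    rw [mul_assoc]
    refine mul_le_mul_of_nonneg_left (mul_le_mul hqj2 ?_ measureReal_nonneg hq0) (by norm_num)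
    exact h2.trans (mul_le_mul_of_nonneg_left hβj hC)
  have h6 : a / ((j : ℝ) + 1) ≤ (η * ((N : ℝ) + 1))⁻¹ := by
    rw [div_eq_mul_inv]
    calc a * ((j : ℝ) + 1)⁻¹ ≤ 1 * ((j : ℝ) + 1)⁻¹ :=
          mul_le_mul_of_nonneg_right ha1 (by positivity)
      _ ≤ _ := by
          rw [one_mul]
          exact inv_anti₀ (by positivity) hj
  refine mul_le_mul h6 (h1.trans (add_le_add h5
    (mul_le_mul_of_nonneg_left hej (Real.exp_pos 1).le))) ?_ (by positivity)
  exact integral_nonneg fun z => Set.indicator_nonneg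
    (fun z _ => add_nonneg (regionCount_nonneg _ _) zero_le_one) z

/-- If detection regions have a weight of at most `m p n / a`, then the weight of a region grows by
at least `m (1 + δ) p` plus `a / n` times itself, so that it is at least `m p n (1 + δ) / (1 - a)`
asymptotically. -/
theorem lowerTail_of_upperTail (hm : 1 ≤ m) (hδ : 0 < δ) {𝓒 : Set (Model.{u} m δ)} {γ a w : ℝ}
    (hγ0 : 0 < γ) (hγ1 : γ ≤ 1) (ha0 : 0 ≤ a) (ha1 : a < 1) (hU : UpperTail 𝓒 γ a)
    (hw : (1 - a) / (1 + δ) < w) : LowerTail 𝓒 γ w := by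
  have hm0 : (0 : ℝ) < m := by exact_mod_cast hm
  have hw0 : 0 < w := lt_of_le_of_lt (div_nonneg (by linarith) (by linarith)) hw
  -- `κ` is the relative error of the exponential inequalities
  obtain ⟨κ, hκ0, hκ1, hκ⟩ := exists_small
    (f := fun κ => w * ((1 - κ) ^ 2 * (1 + δ)) - (1 - (1 - κ) * a)) (by fun_prop) (by
      rw [div_lt_iff₀ (by linarith)] at hw
      simp only [sub_zero, one_pow, one_mul]
      linarith)
  set θ := (1 - κ) * a with hθdef
  have hκ' : 0 ≤ 1 - κ := by linarith
  have hθ0 : 0 ≤ θ := by positivity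
  have hθa : θ ≤ a := mul_le_of_le_one_left ha0 (by linarith)
  have hθ1 : θ < 1 := hθa.trans_lt ha1
  have h1θ : 0 < 1 - θ := by linarith
  set g := (1 - κ) ^ 2 * (1 + δ) / (1 - θ) - 1 / w with hg
  have hg0 : 0 < g := by
    rw [hg, sub_pos, div_lt_div_iff₀ hw0 h1θ]
    linarith
  -- the process is started at the time `s = ⌊η n⌋`, since the contribution of the first `s`
  -- vertices is negligible
  obtain ⟨η, hη0, hη1, hη⟩ := exists_rpow_le (x := κ / 2) (a := 1 - a) (by linarith) (by linarith)
  obtain ⟨C, c, hC, hc, hβ⟩ := hU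
  set c' := min (c * η ^ γ) η with hc'
  have hc'0 : 0 < c' := lt_min (by positivity) hη0
  -- the factor `exp (lam * b)` may use up half of the decay `c'` of the error terms
  set l := min (κ * η / (2 * (m * (2 + δ)))) (c' * w / (2 * m)) with hl
  have hl0 : 0 < l := lt_min (by positivity) (by positivity)
  have hq := scale_nonneg 𝓒
  refine Decays.of_large (G := fun i => 1 * Real.exp (-(l * (m * g)) * scale 𝓒 i ^ γ)
      + η⁻¹ * (8 * (scale 𝓒 i * (C * Real.exp (-(c' / 2) * scale 𝓒 i ^ γ)))
        + Real.exp 1 * Real.exp (-(c' / 2) * scale 𝓒 i ^ γ)))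
    hγ0.le hq (B := 1) (fun i => measureReal_le_one) (2 / η) ?_ ?_
  · refine Decays.add hq (decays_exp γ one_pos (by positivity))
      (Decays.const_mul (by positivity) ?_)
    exact Decays.add hq (Decays.const_mul (by norm_num)
      (Decays.id_mul hγ0 hq (decays_exp γ hC (by positivity))))
      (decays_exp γ (Real.exp_pos 1) (by positivity))
  rintro ⟨⟨M, hM⟩, N⟩ hi
  set q := scale 𝓒 (⟨M, hM⟩, N) with hqdef
  have hqeq : q = M.p * ((N : ℝ) + 1) := rfl
  have hp0 := M.p_pos
  have hn0 : (0 : ℝ) < (N : ℝ) + 1 := by positivity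
  obtain ⟨hs1, hsN, hsη, hsη', hsη2⟩ := floor_mul_facts hη0 hη1 (hi.trans (scale_le 𝓒 _))
  set s := ⌊η * ((N : ℝ) + 1)⌋₊ with hs
  have hq1 : 1 ≤ q := le_trans (by rw [le_div_iff₀ hη0]; linarith) hi
  have hq0 : 0 < q := by linarith
  -- for `γ < 1` the errors decay slowly, so that `lam` has to be small: `lam * q` is of
  -- order `q ^ γ`
  set lam := l * q ^ (γ - 1) with hlam
  have hlam0 : 0 ≤ lam := by positivity
  have hlaml : lam ≤ l := mul_le_of_le_one_right hl0.le
    (Real.rpow_le_one_of_one_le_of_nonpos hq1 (by linarith))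
  have hlamq : lam * q = l * q ^ γ := by
    rw [hlam, mul_assoc, Real.rpow_sub_one hq0.ne', div_mul_cancel₀ _ hq0.ne']
  have hcond : lam * (((N : ℝ) / s) ^ θ * (m * (2 + δ))) ≤ κ := by
    have h1 := rpow_div_le hη0 hθ1.le hs1 hsN hsη2
    calc _ ≤ κ * η / (2 * (m * (2 + δ))) * (2 / η * (m * (2 + δ))) := by
          refine mul_le_mul (hlaml.trans (min_le_left _ _))
            (mul_le_mul_of_nonneg_right h1 (by positivity)) (by positivity) (by positivity)
      _ = κ := by field_simp
  have key := M.isGPM.lower_tail_le hm hδ M.r_nonneg hp0 M.integral_near_eq ha0 hκ0.le hκ1.le hθ1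
    hs1 hsN hlam0 hcond (m * q / w)
  have hsub : M.Q.real {z | w * M.W N z < m * q}
      ≤ (M.P.prod (area M.d)).real {z | regionWeight m δ M.r M.V M.v N z ≤ m * q / w} := by
    refine measureReal_mono fun z hz => ?_
    have h1 : w * M.W N z < m * q := hz
    change M.W N z ≤ m * q / w
    rw [le_div_iff₀ hw0]
    linarith
  refine hsub.trans (key.trans (add_le_add ?_ ?_))
  · rw [one_mul, Real.exp_le_exp, neg_mul, neg_le_neg_iff]
    have h1 := succ_mul_rpow_div_le hθ0 hθa ha1 hs1 hsN hsη
    have h2 : ((s : ℝ) + 1) * ((N : ℝ) / s) ^ θ ≤ κ * ((N : ℝ) + 1) :=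
      h1.trans (mul_le_mul_of_nonneg_right (by linarith) hn0.le)
    have h3 : m * q * g ≤ (1 - κ) * (m * (1 + δ) * M.p) * (((N : ℝ) + 1)
            - ((s : ℝ) + 1) * ((N : ℝ) / s) ^ θ) / (1 - θ) - m * q / w := by
      have h4 : (1 - κ) * (m * (1 + δ) * M.p) * ((1 - κ) * ((N : ℝ) + 1)) / (1 - θ) - m * q / w
          = m * q * g := by rw [hg, hqeq]; ring
      rw [← h4]
      gcongr
      linarith
    calc l * (m * g) * q ^ γ = m * g * (lam * q) := by rw [hlamq]; ring
      _ = lam * (m * q * g) := by ring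
      _ ≤ _ := mul_le_mul_of_nonneg_left h3 hlam0
  · set T := Real.exp (-c' * q ^ γ) with hT
    have hqγ0 : 0 ≤ q ^ γ := by positivity
    have hterm : ∀ j ∈ Finset.Ico s N, a / ((j : ℝ) + 1) * ∫ z, Set.indicator
          {z | m * M.p * ((j : ℝ) + 1) < a * regionWeight m δ M.r M.V M.v j z}
          (fun z => regionCount M.r M.V j z + 1) z ∂(M.P.prod (area M.d))
        ≤ (η * ((N : ℝ) + 1))⁻¹ * (8 * (q * (C * T)) + Real.exp 1 * T) := fun j hj => by
      rw [Finset.mem_Ico] at hj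
      have hsj : (s : ℝ) ≤ j := by exact_mod_cast hj.1
      exact integral_exceptional_le hγ0 hγ1 ha1.le hC.le hc.le hη0 (min_le_left _ _)
        (min_le_right _ _) hβ ⟨M, hM⟩ hj.2.le (hsη'.trans (add_le_add_left hsj 1)) hq1
    have hsum := Finset.sum_le_sum hterm
    rw [Finset.sum_const, Nat.card_Ico, nsmul_eq_mul] at hsum
    have hcard : ((N - s : ℕ) : ℝ) * ((η * ((N : ℝ) + 1))⁻¹ * (8 * (q * (C * T)) + Real.exp 1 * T))
        ≤ η⁻¹ * (8 * (q * (C * T)) + Real.exp 1 * T) := by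
      have h1 : ((N - s : ℕ) : ℝ) ≤ (N : ℝ) + 1 := by
        have : ((N - s : ℕ) : ℝ) ≤ N := by exact_mod_cast Nat.sub_le N s
        linarith
      have h2 : 0 ≤ (η * ((N : ℝ) + 1))⁻¹ * (8 * (q * (C * T)) + Real.exp 1 * T) := by positivity
      calc _ ≤ ((N : ℝ) + 1) * ((η * ((N : ℝ) + 1))⁻¹ * (8 * (q * (C * T)) + Real.exp 1 * T)) :=
            mul_le_mul_of_nonneg_right h1 h2
        _ = _ := by field_simp
    have hexp : Real.exp (lam * (m * q / w)) ≤ Real.exp (c' / 2 * q ^ γ) := by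
      refine Real.exp_le_exp.2 ?_
      calc lam * (m * q / w) = m / w * (lam * q) := by ring
        _ = m / w * l * q ^ γ := by rw [hlamq]; ring
        _ ≤ m / w * (c' * w / (2 * m)) * q ^ γ := by
            gcongr
            exact min_le_right _ _
        _ = c' / 2 * q ^ γ := by field_simp
    have hTT : Real.exp (c' / 2 * q ^ γ) * T = Real.exp (-(c' / 2) * q ^ γ) := by
      rw [hT, ← Real.exp_add]; ring_nf
    calc _ ≤ Real.exp (c' / 2 * q ^ γ) * (η⁻¹ * (8 * (q * (C * T)) + Real.exp 1 * T)) :=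
          mul_le_mul hexp (hsum.trans hcard) (Finset.sum_nonneg fun j _ =>
            mul_nonneg (by positivity) (integral_nonneg fun z => Set.indicator_nonneg
              (fun z _ => add_nonneg (regionCount_nonneg _ _) zero_le_one) z)) (Real.exp_pos _).le
      _ = η⁻¹ * (8 * (q * (C * (Real.exp (c' / 2 * q ^ γ) * T)))
          + Real.exp 1 * (Real.exp (c' / 2 * q ^ γ) * T)) := by ring
      _ = _ := by rw [hTT]

/-- The sum of the probabilities of exceptional vertices between the times `s` and `N`. -/
theorem sum_lowerTail_le {𝓒 : Set (Model.{u} m δ)} {γ w C c : ℝ}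
    (hγ0 : 0 < γ) (hC : 0 < C) (hc : 0 < c)
    (hβ : ∀ i : 𝓒 × ℕ, i.1.1.Q.real {z | w * i.1.1.W i.2 z < m * scale 𝓒 i}
      ≤ C * Real.exp (-c * scale 𝓒 i ^ γ)) (M : 𝓒) {s N : ℕ} {x : ℝ} (hx0 : 0 ≤ x)
    (hx : x ≤ M.1.p * ((s : ℝ) + 1)) :
    m * M.1.p * ∑ j ∈ Finset.Ico s N, (M.1.P.prod (area M.1.d)).real
            {z | w * regionWeight m δ M.1.r M.1.V M.1.v j z < m * M.1.p * ((j : ℝ) + 1)}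
      ≤ m * (scale 𝓒 (M, N) * (C * Real.exp (-c * x ^ γ))) := by
  have hp0 := M.1.p_pos
  have hterm : ∀ j ∈ Finset.Ico s N, (M.1.P.prod (area M.1.d)).real
            {z | w * regionWeight m δ M.1.r M.1.V M.1.v j z < m * M.1.p * ((j : ℝ) + 1)}
        ≤ C * Real.exp (-c * x ^ γ) := fun j hj => by
    have hset : {z | w * regionWeight m δ M.1.r M.1.V M.1.v j z < m * M.1.p * ((j : ℝ) + 1)}
        = {z | w * M.1.W j z < m * scale 𝓒 (M, j)} := by rw [mul_assoc]; rfl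
    rw [hset]
    refine (hβ (M, j)).trans (mul_le_mul_of_nonneg_left (Real.exp_le_exp.2 ?_) hC.le)
    have hsj : (s : ℝ) ≤ j := by exact_mod_cast (Finset.mem_Ico.1 hj).1
    have h1 : x ≤ scale 𝓒 (M, j) := hx.trans (mul_le_mul_of_nonneg_left (by linarith) hp0.le)
    have h2 := Real.rpow_le_rpow hx0 h1 hγ0.le
    nlinarith
  have hsum := Finset.sum_le_sum hterm
  rw [Finset.sum_const, Nat.card_Ico, nsmul_eq_mul] at hsum
  have h1 : ((N - s : ℕ) : ℝ) ≤ (N : ℝ) + 1 := by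
    have : ((N - s : ℕ) : ℝ) ≤ N := by exact_mod_cast Nat.sub_le N s
    linarith
  have h2 : 0 ≤ C * Real.exp (-c * x ^ γ) := by positivity
  calc _ ≤ m * M.1.p * (((N : ℝ) + 1) * (C * Real.exp (-c * x ^ γ))) :=
        mul_le_mul_of_nonneg_left (hsum.trans (mul_le_mul_of_nonneg_right h1 h2)) (by positivity)
    _ = _ := by simp only [scale]; ring

/-- If detection regions have a weight of at least `m p n / w`, then the weight of a region grows by
at most `m (1 + δ) p` plus `w / n` times itself, so that it is at most `m p n (1 + δ) / (1 - w)`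
asymptotically. The crude bound with the parameter `a₀` serves at the initial time only. -/
theorem upperTail_of_lowerTail (hm : 1 ≤ m) (hδ : 0 < δ) {𝓒 : Set (Model.{u} m δ)}
    {γ a₀ a w : ℝ} (hγ0 : 0 < γ) (hγ1 : γ ≤ 1) (ha₀ : 0 < a₀) (hU : UpperTail 𝓒 γ a₀)
    (hw0 : 0 ≤ w) (hL : LowerTail 𝓒 γ w) (ha0 : 0 < a) (ha : a < (1 - w) / (1 + δ)) :
    UpperTail 𝓒 γ a := by
  have hm0 : (0 : ℝ) < m := by exact_mod_cast hm
  -- `κ` is the relative error of the exponential inequalities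
  obtain ⟨κ, hκ0, hκ1, hκ⟩ := exists_small
    (f := fun κ => (1 - (1 + κ) * w) - a * ((1 + κ) * (1 + δ))) (by fun_prop) (by
      rw [lt_div_iff₀ (by linarith)] at ha
      simp only [add_zero, one_mul]
      linarith)
  set θ := (1 + κ) * w with hθdef
  have hθ0 : 0 ≤ θ := by positivity
  have hθ1 : θ < 1 := by
    have : 0 < a * ((1 + κ) * (1 + δ)) := by positivity
    linarith
  have h1θ : 0 < 1 - θ := by linarith
  set g := (1 / a - (1 + κ) * (1 + δ) / (1 - θ)) / 2 with hg
  have hg0 : 0 < g := by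
    refine div_pos (sub_pos.2 ?_) two_pos
    rw [div_lt_div_iff₀ h1θ ha0]
    linarith
  -- the process is started at the time `s = ⌊η n⌋`, when the crude bound is small enough
  obtain ⟨η, hη0, hη1, hη⟩ := exists_rpow_le (x := g * a₀ / 2) (a := 1 - θ) (by positivity) h1θ
  obtain ⟨C₀, c₀, hC₀, hc₀, hβ₀⟩ := hU
  obtain ⟨C, c, hC, hc, hβ⟩ := hL
  set lam := κ * η / (2 * (m * (2 + δ))) with hlam
  have hlam0 : 0 < lam := by positivity
  have hq := scale_nonneg 𝓒
  refine Decays.of_large (G := fun i => C₀ * Real.exp (-(c₀ * η ^ γ) * scale 𝓒 i ^ γ)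
      + m * (scale 𝓒 i * (C * Real.exp (-(c * η ^ γ) * scale 𝓒 i ^ γ)))
      + 1 * Real.exp (-(lam * (m * g)) * scale 𝓒 i ^ γ))
    hγ0.le hq (B := 1) (fun i => measureReal_le_one) (2 / η) ?_ ?_
  · refine Decays.add hq (Decays.add hq (decays_exp γ hC₀ (by positivity)) ?_)
      (decays_exp γ one_pos (by positivity))
    exact Decays.const_mul hm0 (Decays.id_mul hγ0 hq (decays_exp γ hC (by positivity)))
  rintro ⟨⟨M, hM⟩, N⟩ hi
  set q := scale 𝓒 (⟨M, hM⟩, N) with hqdef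
  have hqeq : q = M.p * ((N : ℝ) + 1) := rfl
  have hp0 := M.p_pos
  have hn0 : (0 : ℝ) < (N : ℝ) + 1 := by positivity
  obtain ⟨hs1, hsN, hsη, hsη', hsη2⟩ := floor_mul_facts hη0 hη1 (hi.trans (scale_le 𝓒 _))
  set s := ⌊η * ((N : ℝ) + 1)⌋₊ with hs
  have hq1 : 1 ≤ q := le_trans (by rw [le_div_iff₀ hη0]; linarith) hi
  have hq0 : 0 < q := by linarith
  have hqs : η * q ≤ M.p * ((s : ℝ) + 1) := by
    rw [hqeq]
    calc η * (M.p * ((N : ℝ) + 1)) = M.p * (η * ((N : ℝ) + 1)) := by ring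
      _ ≤ M.p * ((s : ℝ) + 1) := mul_le_mul_of_nonneg_left hsη' hp0.le
  have hcond : lam * (((N : ℝ) / s) ^ θ * (m * (2 + δ))) ≤ κ := by
    have h1 := rpow_div_le hη0 hθ1.le hs1 hsN hsη2
    calc _ ≤ lam * (2 / η * (m * (2 + δ))) := by gcongr
      _ = κ := by rw [hlam]; field_simp
  set X := m * (M.p * ((s : ℝ) + 1)) / a₀ with hX
  have key := M.isGPM.upper_tail_le hm hδ M.r_nonneg hp0 M.integral_near_eq hw0 hκ0.le hκ1.le hθ1
    hs1 hsN hlam0.le hcond (X := X) (by positivity) (m * q / a)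
  have hsub : M.Q.real {z | m * q < a * M.W N z}
      ≤ (M.P.prod (area M.d)).real {z | m * q / a ≤ regionWeight m δ M.r M.V M.v N z} := by
    refine measureReal_mono fun z hz => ?_
    have h1 : m * q < a * M.W N z := hz
    change m * q / a ≤ M.W N z
    rw [div_le_iff₀ ha0]
    linarith
  refine hsub.trans (key.trans (add_le_add (add_le_add ?_ ?_) ?_))
  · have h1 : (M.P.prod (area M.d)).real {z | X < regionWeight m δ M.r M.V M.v s z}
        ≤ M.Q.real {z | m * scale 𝓒 (⟨M, hM⟩, s) < a₀ * M.W s z} := by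
      refine measureReal_mono fun z hz => ?_
      have h2 : m * (M.p * ((s : ℝ) + 1)) / a₀ < M.W s z := hz
      rw [div_lt_iff₀ ha₀] at h2
      change m * (M.p * ((s : ℝ) + 1)) < a₀ * M.W s z
      linarith
    refine h1.trans ((hβ₀ (⟨M, hM⟩, s)).trans (mul_le_mul_of_nonneg_left
      (exp_neg_mul_rpow_le hc₀.le hη0.le hq0.le hγ0.le hqs) hC₀.le))
  · have h1 := sum_lowerTail_le hγ0 hC hc hβ ⟨M, hM⟩ (N := N) (by positivity : 0 ≤ η * q) hqs
    refine h1.trans (le_of_eq ?_)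
    rw [Real.mul_rpow hη0.le hq0.le, ← mul_assoc (-c), neg_mul]
  · rw [one_mul, Real.exp_le_exp, neg_mul, neg_le_neg_iff]
    have h1 := succ_mul_rpow_div_le hθ0 le_rfl hθ1 hs1 hsN hsη
    have h2 : ((N : ℝ) / s) ^ θ * X ≤ m * q * g := by
      calc ((N : ℝ) / s) ^ θ * X
          = m * M.p / a₀ * (((s : ℝ) + 1) * ((N : ℝ) / s) ^ θ) := by rw [hX]; ring
        _ ≤ m * M.p / a₀ * (2 * η ^ (1 - θ) * ((N : ℝ) + 1)) := by gcongr
        _ ≤ m * M.p / a₀ * (2 * (g * a₀ / 2) * ((N : ℝ) + 1)) := by gcongr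
        _ = m * q * g := by rw [hqeq]; field_simp
    have h3 : m * q * g ≤ m * q / a - (1 + κ) * (m * (1 + δ) * M.p) * ((N : ℝ) + 1) / (1 - θ)
        - ((N : ℝ) / s) ^ θ * X := by
      have h4 : m * q / a - (1 + κ) * (m * (1 + δ) * M.p) * ((N : ℝ) + 1) / (1 - θ)
          = m * q * (2 * g) := by rw [hg, hqeq]; ring
      rw [h4]; linarith
    have h5 : q ^ γ ≤ q := by
      calc q ^ γ ≤ q ^ (1 : ℝ) := Real.rpow_le_rpow_of_exponent_le hq1 hγ1
        _ = q := Real.rpow_one q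
    calc lam * (m * g) * q ^ γ ≤ lam * (m * g) * q := by gcongr
      _ = lam * (m * q * g) := by ring
      _ ≤ _ := mul_le_mul_of_nonneg_left h3 hlam0.le

/-- A crude upper bound when the detection regions of twice the radius have comparable area. -/
theorem upperTail_of_double (hδ : 0 < δ) {𝓒 : Set (Model.{u} m δ)} {K : ℝ} (hK : 1 ≤ K)
    (h : ∀ M ∈ 𝓒, ∀ x, ∫ y, near (2 * M.r) x y ∂(area M.d) ≤ K * M.p) :
    UpperTail 𝓒 1 (1 / (4 * K * (2 + δ) + (1 + δ))) := by
  refine Decays.of_large (B := 1) zero_le_one (scale_nonneg 𝓒) (fun i => measureReal_le_one) 1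
    (decays_exp 1 one_pos one_pos) fun i hi => ?_
  have key := i.1.1.isGPM.upper_tail_le_of_double hδ i.1.1.r_nonneg i.1.1.p_pos hK
    (h i.1.1 i.1.2) i.2 hi
  have hpos : 0 < 4 * K * (2 + δ) + (1 + δ) := by positivity
  rw [Real.rpow_one, one_mul, neg_one_mul]
  refine le_trans (measureReal_mono fun z hz => ?_) key
  have h1 : m * scale 𝓒 i < 1 / (4 * K * (2 + δ) + (1 + δ)) * i.1.1.W i.2 z := hz
  rw [one_div, ← div_eq_inv_mul, lt_div_iff₀ hpos] at h1
  exact h1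

/-- Repeated passage between upper and lower bounds on the weights brings both as close to
`(2 + δ) m p n` as desired: with `u = 1 / (2 + δ)`, an upper bound with parameter `u - D`
yields lower bounds with parameter close to `u + D / (1 + δ)` and then upper bounds with parameter
close to `u - D / (1 + δ) ^ 2`. -/
theorem upperTail_of_lt (hm : 1 ≤ m) (hδ : 0 < δ) {𝓒 : Set (Model.{u} m δ)} {γ a₀ : ℝ}
    (hγ0 : 0 < γ) (hγ1 : γ ≤ 1) (ha₀ : 0 < a₀) (hU : UpperTail 𝓒 γ a₀) {a : ℝ}
    (ha : a < 1 / (2 + δ)) : UpperTail 𝓒 γ a := by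
  have h2δ : 0 < 2 + δ := by linarith
  have h1δ : 1 < 1 + δ := by linarith
  set u₀ := 1 / (2 + δ) with hu
  have hu0 : 0 < u₀ := by positivity
  have hu1 : u₀ * (2 + δ) = 1 := by rw [hu]; field_simp
  have hu2 : u₀ < 1 := by nlinarith
  have key : ∀ k : ℕ, ∀ a, u₀ * ((1 + δ) ^ 2)⁻¹ ^ k < u₀ - a → UpperTail 𝓒 γ a := by
    intro k
    induction k with
    | zero =>
      intro a h
      exact upperTail_of_nonpos hδ 𝓒 γ (by simp only [pow_zero, mul_one] at h; linarith)
    | succ k ih =>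
      intro a h
      rcases le_or_gt a 0 with ha0 | ha0
      · exact upperTail_of_nonpos hδ 𝓒 γ ha0
      have h1 : u₀ * ((1 + δ) ^ 2)⁻¹ ^ k < (u₀ - a) * (1 + δ) ^ 2 := by
        rw [pow_succ, ← mul_assoc, ← div_eq_mul_inv, div_lt_iff₀ (by positivity)] at h
        exact h
      obtain ⟨D, hD1, hD2⟩ := exists_between h1
      have hD0 : 0 < D := lt_trans (by positivity) hD1
      have hUD := ih (u₀ - D) (by linarith)
      have hUa : UpperTail 𝓒 γ (max (u₀ - D) 0) := by
        rcases le_total (u₀ - D) 0 with h2 | h2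
        · rw [max_eq_right h2]; exact upperTail_of_nonpos hδ 𝓒 γ le_rfl
        · rwa [max_eq_left h2]
      have h3 : (1 - max (u₀ - D) 0) / (1 + δ) < u₀ + (u₀ - a) * (1 + δ) := by
        rw [div_lt_iff₀ (by linarith)]
        have := le_max_left (u₀ - D) 0
        nlinarith
      obtain ⟨w, hw1, hw2⟩ := exists_between h3
      have hmax : max (u₀ - D) 0 < 1 := max_lt (by linarith) one_pos
      have hw0 : 0 ≤ w := (div_nonneg (by linarith) (by linarith)).trans hw1.le
      refine upperTail_of_lowerTail hm hδ hγ0 hγ1 ha₀ hU hw0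
        (lowerTail_of_upperTail hm hδ hγ0 hγ1 (le_max_right _ _) hmax hUa hw1) ha0 ?_
      rw [lt_div_iff₀ (by linarith)]
      nlinarith
  have hlim : Filter.Tendsto (fun k : ℕ => u₀ * ((1 + δ) ^ 2)⁻¹ ^ k) Filter.atTop (nhds (u₀ * 0)) :=
    (tendsto_pow_atTop_nhds_zero_of_lt_one (by positivity)
      (inv_lt_one_of_one_lt₀ (by nlinarith))).const_mul _
  rw [mul_zero] at hlim
  obtain ⟨k, hk⟩ := (hlim.eventually (gt_mem_nhds (sub_pos.2 ha))).exists
  exact key k a hk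

theorem lowerTail_of_lt (hm : 1 ≤ m) (hδ : 0 < δ) {𝓒 : Set (Model.{u} m δ)} {γ a₀ : ℝ}
    (hγ0 : 0 < γ) (hγ1 : γ ≤ 1) (ha₀ : 0 < a₀) (hU : UpperTail 𝓒 γ a₀) {w : ℝ}
    (hw : 1 / (2 + δ) < w) : LowerTail 𝓒 γ w := by
  have h2δ : 0 < 2 + δ := by linarith
  have hu0 : 0 < 1 / (2 + δ) := by positivity
  have hu1 : 1 / (2 + δ) * (2 + δ) = 1 := by field_simp
  have hu2 : 1 / (2 + δ) < 1 := by rw [div_lt_one h2δ]; linarith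
  have h1 : max (1 - w * (1 + δ)) 0 < 1 / (2 + δ) := max_lt (by nlinarith) hu0
  obtain ⟨a, ha1, ha2⟩ := exists_between h1
  refine lowerTail_of_upperTail hm hδ hγ0 hγ1 ((le_max_right _ _).trans ha1.le)
    (ha2.trans hu2) (upperTail_of_lt hm hδ hγ0 hγ1 ha₀ hU ha2) ?_
  rw [div_lt_iff₀ (by linarith)]
  linarith [(le_max_left _ _).trans_lt ha1]

/-- A time `s ≤ N` at which `p s` is of the order of `y`. -/
theorem exists_intermediate_time {p y : ℝ} {N : ℕ} (hp0 : 0 < p) (hp1 : p < 1) (hy1 : 1 ≤ y)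
    (hyN : 4 * y ≤ p * ((N : ℝ) + 1)) :
    ∃ s : ℕ, 1 ≤ s ∧ s ≤ N ∧ y ≤ p * s ∧ p * ((s : ℝ) + 1) ≤ 3 * y := by
  have hsy' : p * ((⌈y / p⌉₊ : ℝ) + 1) ≤ 3 * y := by
    have h1 : (⌈y / p⌉₊ : ℝ) ≤ y / p + 1 := (Nat.ceil_lt_add_one (by positivity)).le
    calc p * ((⌈y / p⌉₊ : ℝ) + 1) ≤ p * (y / p + 1 + 1) := by gcongr
      _ = y + 2 * p := by field_simp; ring
      _ ≤ 3 * y := by linarith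
  refine ⟨⌈y / p⌉₊, Nat.one_le_ceil_iff.2 (by positivity), ?_, ?_, hsy'⟩
  · have h2 := lt_of_mul_lt_mul_left
      (show p * ((⌈y / p⌉₊ : ℝ) + 1) < p * ((N : ℝ) + 1) by linarith) hp0.le
    have h3 : (⌈y / p⌉₊ : ℝ) ≤ N := by linarith
    exact_mod_cast h3
  · have := Nat.le_ceil (y / p)
    rwa [div_le_iff₀' hp0] at this

theorem four_mul_rpow_le {q σ : ℝ} (hq : 16 ≤ q) (hσ : σ ≤ 1 / 2) : 4 * q ^ σ ≤ q := by
  have h1 : q ^ σ ≤ q ^ (1 / 2 : ℝ) := Real.rpow_le_rpow_of_exponent_le (by linarith) hσ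
  rw [← Real.sqrt_eq_rpow] at h1
  have h2 : 4 ≤ Real.sqrt q := Real.le_sqrt_of_sq_le (by linarith)
  nlinarith [Real.sq_sqrt (by linarith : (0 : ℝ) ≤ q)]

/-- A crude upper bound without any hypothesis on the dimension: the quadratic bound on the weights
at a time `s` with `p s` of the order of a small power of `p N` is propagated up to time `N`. -/
theorem exists_upperTail (hm : 1 ≤ m) (hδ : 0 < δ) (𝓒 : Set (Model.{u} m δ)) :
    ∃ γ a : ℝ, 0 < γ ∧ γ ≤ 1 ∧ 0 < a ∧ UpperTail 𝓒 γ a := by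
  have hm0 : (0 : ℝ) < m := by exact_mod_cast hm
  -- The share `m (1 + δ)` that each new vertex adds gives the lower bound `m (1 + δ) p n`, and
  -- hence a growth exponent `θ < 1`.
  obtain ⟨w, hw1, hw2⟩ := exists_between (show 1 / (1 + δ) < 1 by
    rw [div_lt_one (by linarith)]; linarith)
  have hw0 : 0 < w := lt_trans (by positivity) hw1
  obtain ⟨C, c, hC, hc, hβ⟩ : LowerTail 𝓒 1 w :=
    lowerTail_of_upperTail hm hδ one_pos le_rfl le_rfl zero_lt_one
      (upperTail_of_nonpos hδ 𝓒 1 le_rfl) (by simpa using hw1)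
  obtain ⟨κ, hκ0, hκ1, hκ⟩ := exists_small (f := fun κ => 1 - (1 + κ) * w) (by fun_prop)
    (by simp only [add_zero, one_mul]; linarith)
  set θ := (1 + κ) * w with hθdef
  have hθ0 : 0 < θ := by positivity
  have hθ1 : θ < 1 := by linarith
  have h1θ : 0 < 1 - θ := by linarith
  -- with `p s` of order `q ^ σ`, the quadratic bound at time `s` is of order `q ^ (2 σ)`
  set σ := (1 - θ) / 2 with hσdef
  have hσ0 : 0 < σ := by positivity
  have hσ1 : σ < 1 / 2 := by rw [hσdef]; linarith
  have hσ2 : θ * (1 - σ) + (σ + σ) ≤ 1 := by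
    have h1 : θ * (1 - σ) + (σ + σ) = 1 - θ * σ := by rw [hσdef]; ring
    rw [h1]; linarith [mul_pos hθ0 hσ0]
  have hσ3 : σ ≤ 1 - θ * (1 - σ) := by
    have h1 : 1 - θ * (1 - σ) = σ + σ + θ * σ := by rw [hσdef]; ring
    rw [h1]; linarith [mul_pos hθ0 hσ0]
  -- the terms stand for the exponential decay, the new vertices and the weight at time `s`, where
  -- `153 = 17 * 3 ^ 2`
  set A := 1 + (1 + κ) * (1 + δ) / (1 - θ) + 153 * (2 + δ) with hA
  have hA0 : 0 < A := by positivity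
  have hq := scale_nonneg 𝓒
  refine ⟨σ, 1 / A, hσ0, by linarith, by positivity, ?_⟩
  refine Decays.of_large (G := fun i => (1 * Real.exp (-1 * scale 𝓒 i ^ σ)
      + 3 * (scale 𝓒 i * (Real.exp 1 * Real.exp (-1 * scale 𝓒 i ^ σ))))
      + m * (scale 𝓒 i * (C * Real.exp (-c * scale 𝓒 i ^ σ)))
      + 1 * Real.exp (-(κ / (2 + δ)) * scale 𝓒 i ^ σ))
    hσ0.le hq (B := 1) (fun i => measureReal_le_one) 16 ?_ ?_
  · refine Decays.add hq (Decays.add hq (Decays.add hq (decays_exp σ one_pos one_pos) ?_) ?_)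
      (decays_exp σ one_pos (by positivity))
    · exact Decays.const_mul (by norm_num)
        (Decays.id_mul hσ0 hq (decays_exp σ (Real.exp_pos 1) one_pos))
    · exact Decays.const_mul hm0 (Decays.id_mul hσ0 hq (decays_exp σ hC hc))
  rintro ⟨⟨M, hM⟩, N⟩ hi
  set q := scale 𝓒 (⟨M, hM⟩, N) with hqdef
  have hqeq : q = M.p * ((N : ℝ) + 1) := rfl
  have hp0 := M.p_pos
  have hp1 := M.p_lt_one
  have hq0 : 0 < q := by linarith
  have hq1 : 1 ≤ q := by linarith
  set y := q ^ σ with hy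
  have hy1 : 1 ≤ y := Real.one_le_rpow hq1 hσ0.le
  have hy0 : 0 < y := by linarith
  have hyq : 4 * y ≤ q := four_mul_rpow_le hi hσ1.le
  obtain ⟨s, hs1, hsN, hsy, hsy'⟩ := exists_intermediate_time hp0 hp1 hy1 hyq
  have hs0 : (0 : ℝ) < s := by exact_mod_cast hs1
  set x := M.p * ((s : ℝ) + 1) with hx
  have hyx : y ≤ x := hsy.trans (mul_le_mul_of_nonneg_left (le_add_of_nonneg_right zero_le_one)
    hp0.le)
  have hx0 : 0 < x := by linarith
  -- the ratio `N / s` is at most `q ^ (1 - σ)`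
  have hR : ((N : ℝ) / s) ^ θ ≤ q ^ (θ * (1 - σ)) := by
    have h1 : ((N : ℕ) : ℝ) / s ≤ q ^ (1 - σ) := by
      rw [Real.rpow_sub hq0, Real.rpow_one, div_le_div_iff₀ hs0 hy0]
      have h2 : (N : ℝ) * y ≤ N * (M.p * s) := mul_le_mul_of_nonneg_left hsy (by positivity)
      have h3 : (N : ℝ) * M.p ≤ q := by rw [hqeq]; linarith
      calc (N : ℝ) * y ≤ N * M.p * s := by linarith
        _ ≤ q * s := mul_le_mul_of_nonneg_right h3 hs0.le
    calc ((N : ℝ) / s) ^ θ ≤ (q ^ (1 - σ)) ^ θ := Real.rpow_le_rpow (by positivity) h1 hθ0.le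
      _ = _ := by rw [← Real.rpow_mul hq0.le, mul_comm]
  set lam := κ / (m * (2 + δ)) * q ^ (-(θ * (1 - σ))) with hlam
  have hlam0 : 0 ≤ lam := by positivity
  have hcond : lam * (((N : ℝ) / s) ^ θ * (m * (2 + δ))) ≤ κ := by
    calc _ ≤ lam * (q ^ (θ * (1 - σ)) * (m * (2 + δ))) := by gcongr
      _ = κ * (q ^ (-(θ * (1 - σ))) * q ^ (θ * (1 - σ))) := by rw [hlam]; field_simp
      _ = κ := by rw [← Real.rpow_add hq0]; simp
  set X := 17 * (m * (2 + δ)) * x ^ 2 with hX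
  have hX0 : 0 ≤ X := by positivity
  have key := M.isGPM.upper_tail_le hm hδ M.r_nonneg hp0 M.integral_near_eq hw0.le hκ0.le hκ1.le
    hθ1 hs1 hsN hlam0 hcond hX0 (m * q * A)
  have hsub : M.Q.real {z | m * q < 1 / A * M.W N z}
      ≤ (M.P.prod (area M.d)).real {z | m * q * A ≤ regionWeight m δ M.r M.V M.v N z} := by
    refine measureReal_mono fun z hz => ?_
    have h1 : m * q < 1 / A * M.W N z := hz
    rw [one_div, ← div_eq_inv_mul, lt_div_iff₀ hA0] at h1
    exact h1.le
  have hexpx : Real.exp (-x) ≤ Real.exp (-1 * y) := Real.exp_le_exp.2 (by linarith only [hyx])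
  refine hsub.trans (key.trans (add_le_add (add_le_add ?_ ?_) ?_))
  · refine (M.isGPM.upper_tail_le_sq hδ M.r_nonneg hp0 M.integral_near_eq s
      (hy1.trans hyx)).trans (add_le_add (by rw [one_mul]; exact hexpx) ?_)
    calc x * (Real.exp 1 * Real.exp (-x)) ≤ (3 * q) * (Real.exp 1 * Real.exp (-1 * y)) := by
          refine mul_le_mul (hsy'.trans (by linarith only [hyq, hy0])) ?_ (by positivity)
            (by positivity)
          exact mul_le_mul_of_nonneg_left hexpx (Real.exp_pos 1).le
      _ = _ := by ring
  · have h1 := sum_lowerTail_le one_pos hC hc hβ ⟨M, hM⟩ (N := N) hy0.le hyx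
    rw [Real.rpow_one] at h1
    exact h1
  · rw [one_mul, Real.exp_le_exp, neg_mul, neg_le_neg_iff]
    have h1 : ((N : ℝ) / s) ^ θ * X ≤ m * q * (153 * (2 + δ)) := by
      have h2 : x ^ 2 ≤ 9 * (y * y) := by
        calc x ^ 2 ≤ (3 * y) ^ 2 := pow_le_pow_left₀ hx0.le hsy' 2
          _ = _ := by ring
      have h3 : q ^ (θ * (1 - σ)) * (y * y) ≤ q := by
        rw [hy, ← Real.rpow_add hq0, ← Real.rpow_add hq0]
        calc _ ≤ q ^ (1 : ℝ) := Real.rpow_le_rpow_of_exponent_le hq1 hσ2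
          _ = q := Real.rpow_one q
      calc ((N : ℝ) / s) ^ θ * X
          ≤ q ^ (θ * (1 - σ)) * (17 * (m * (2 + δ)) * (9 * (y * y))) := by
            rw [hX]; gcongr
        _ = 153 * (m * (2 + δ)) * (q ^ (θ * (1 - σ)) * (y * y)) := by ring
        _ ≤ 153 * (m * (2 + δ)) * q := by gcongr
        _ = _ := by ring
    have h4 : m * q ≤ m * q * A - (1 + κ) * (m * (1 + δ) * M.p) * ((N : ℝ) + 1) / (1 - θ)
        - ((N : ℝ) / s) ^ θ * X := by
      have h5 : m * q * A - (1 + κ) * (m * (1 + δ) * M.p) * ((N : ℝ) + 1) / (1 - θ)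
          = m * q + m * q * (153 * (2 + δ)) := by rw [hA, hqeq]; ring
      rw [h5]; linarith
    have h6 : q ^ σ ≤ q ^ (1 - θ * (1 - σ)) := Real.rpow_le_rpow_of_exponent_le hq1 hσ3
    calc κ / (2 + δ) * q ^ σ ≤ κ / (2 + δ) * q ^ (1 - θ * (1 - σ)) := by gcongr
      _ = lam * (m * q) := by
          rw [hlam, sub_eq_add_neg, Real.rpow_add hq0, Real.rpow_one]; field_simp
      _ ≤ _ := mul_le_mul_of_nonneg_left h4 hlam0

/-! ### Concentration -/

/-- The share of the new vertex is `m (1 + δ)` in `regionWeight` and `m (2 + δ)` in `L`. -/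
theorem L_succ {X : Type*} [PseudoMetricSpace X] {Ω : Type*} (r : ℝ) (V : ℕ → Ω → X)
    (v : ℕ → ℕ → Ω → ℕ) (s : ℕ) (ω : Ω) :
    L m δ r (fun a => V a ω) (fun a l => v a l ω) (s + 1)
      = regionWeight m δ r V v s (ω, V (s + 1) ω) + m := by
  rw [L, regionWeight, load_one, mass, Finset.sum_filter, Nat.add_sub_cancel]
  have h1 : ∀ k ∈ Finset.Icc 1 s, (if dist (V k ω) (V (s + 1) ω) ≤ r
      then weight m δ (fun a l => v a l ω) s m k else 0)
      = near r (V (s + 1) ω) (V k ω) * weight m δ (fun a l => v a l ω) s m k := fun k _ => by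
    rw [near, dist_comm]; split_ifs <;> simp
  rw [Finset.sum_congr rfl h1]
  ring

/-- The position of a new vertex may be replaced by an independent uniform point. -/
theorem IsGPM.measureReal_newest {Ω : Type*} [mΩ : MeasurableSpace Ω] {P : Measure Ω}
    [IsProbabilityMeasure P] {d m : ℕ} {δ r : ℝ} {V : ℕ → Ω → Sphere d} {v : ℕ → ℕ → Ω → ℕ}
    (h : IsGPM P d m δ r V v) (s : ℕ) {I : Set ℝ} (hI : MeasurableSet I) :
    P.real {ω | regionWeight m δ r V v s (ω, V (s + 1) ω) ∈ I}
      = (P.prod (area d)).real {z | regionWeight m δ r V v s z ∈ I} := by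
  have hV := h.measurable_position (s + 1) (by omega)
  have hle := h.history_le (n := s) le_rfl
  have hindep := h.indep (s + 1) (by omega)
  rw [Nat.add_sub_cancel] at hindep
  have hWhist : Measurable[(history m V v s m).prod inferInstance] (regionWeight m δ r V v s) :=
    @TrajectoryMeasurable.regionWeight d m δ r Ω (history m V v s m) V v s
      (trajectoryMeasurable_history m V v s m)
  have hW : Measurable (regionWeight m δ r V v s) :=
    (h.trajectoryMeasurable (n := s) le_rfl).regionWeight
  have hf : Measurable (Set.indicator I fun _ => (1 : ℝ)) := measurable_const.indicator hI
  have key := integral_indep hV hle hindep (hf.comp hWhist)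
  rw [h.uniform (s + 1) (by omega)] at key
  have e1 : ∫ ω, ((Set.indicator I fun _ => (1 : ℝ)) ∘ regionWeight m δ r V v s) (ω, V (s + 1) ω) ∂P
      = P.real {ω | regionWeight m δ r V v s (ω, V (s + 1) ω) ∈ I} :=
    integral_indicator_one ((hW.comp (measurable_id.prodMk hV)) hI)
  have e2 : ∫ z, ((Set.indicator I fun _ => (1 : ℝ)) ∘ regionWeight m δ r V v s) z
        ∂(P.prod (area d)) = (P.prod (area d)).real {z | regionWeight m δ r V v s z ∈ I} :=
    integral_indicator_one (hW hI)
  rw [← e1, ← e2]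
  exact key

/-- Concentration of `L(n)`, uniformly over a family of processes with a crude upper bound. -/
theorem concentration_of_upperTail (hm : 1 ≤ m) (hδ : 0 < δ) {ε : ℝ} (hε : 0 < ε)
    {𝓒 : Set (Model.{u} m δ)} {γ a₀ : ℝ} (hγ0 : 0 < γ) (hγ1 : γ ≤ 1) (ha₀ : 0 < a₀)
    (hU : UpperTail 𝓒 γ a₀) :
    ∃ C c : ℝ, 0 < C ∧ 0 < c ∧ ∀ M ∈ 𝓒, ∀ n : ℕ, 1 ≤ n →
      1 - C * Real.exp (-c * ((n : ℝ) * M.p) ^ γ) ≤ M.P.real {ω |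
        (2 + δ - ε) * m * M.p * n ≤ L m δ M.r (fun a => M.V a ω) (fun a l => M.v a l ω) n ∧
        L m δ M.r (fun a => M.V a ω) (fun a l => M.v a l ω) n ≤ (2 + δ + ε) * m * M.p * n} := by
  have hm0 : (0 : ℝ) < m := by exact_mod_cast hm
  -- the minimum keeps the lower constant positive for large `ε`
  have hε' : 0 < min ε 1 := lt_min hε one_pos
  have hA : 0 < 2 + δ - min ε 1 := by linarith [min_le_right ε 1]
  have hB : 0 < 2 + δ + ε / 2 := by positivity
  have hlow : LowerTail 𝓒 γ (1 / (2 + δ - min ε 1)) :=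
    lowerTail_of_lt hm hδ hγ0 hγ1 ha₀ hU (one_div_lt_one_div_of_lt hA (by linarith))
  have hupp : UpperTail 𝓒 γ (1 / (2 + δ + ε / 2)) :=
    upperTail_of_lt hm hδ hγ0 hγ1 ha₀ hU (one_div_lt_one_div_of_lt (by linarith) (by linarith))
  have key : Decays γ (scale 𝓒) fun i => 1 - i.1.1.Q.real {z |
      (2 + δ - ε) * (m * scale 𝓒 i) ≤ i.1.1.W i.2 z + m ∧
      i.1.1.W i.2 z + m ≤ (2 + δ + ε) * (m * scale 𝓒 i)} := by
    refine Decays.of_large (B := 1) hγ0.le (scale_nonneg 𝓒)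
      (fun i => sub_le_self _ measureReal_nonneg) (2 / ε)
      (Decays.add (scale_nonneg 𝓒) hlow hupp) fun i hi => ?_
    have hW : Measurable (i.1.1.W i.2) :=
      (i.1.1.isGPM.trajectoryMeasurable (n := i.2) le_rfl).regionWeight
    have hmeas : MeasurableSet {z | (2 + δ - ε) * (m * scale 𝓒 i) ≤ i.1.1.W i.2 z + m ∧
        i.1.1.W i.2 z + m ≤ (2 + δ + ε) * (m * scale 𝓒 i)} :=
      (measurableSet_le measurable_const (hW.add_const _)).inter
        (measurableSet_le (hW.add_const _) measurable_const)
    rw [← probReal_compl_eq_one_sub hmeas]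
    refine le_trans (measureReal_mono fun z hz => ?_) (measureReal_union_le _ _)
    have hmq : 0 ≤ m * scale 𝓒 i := mul_nonneg hm0.le (scale_nonneg 𝓒 i)
    rcases lt_or_ge (i.1.1.W i.2 z + m) ((2 + δ - ε) * (m * scale 𝓒 i)) with h1 | h1
    · refine Or.inl ?_
      change 1 / (2 + δ - min ε 1) * i.1.1.W i.2 z < m * scale 𝓒 i
      rw [one_div, ← div_eq_inv_mul, div_lt_iff₀ hA]
      have h2 : (2 + δ - ε) * (m * scale 𝓒 i) ≤ (2 + δ - min ε 1) * (m * scale 𝓒 i) :=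
        mul_le_mul_of_nonneg_right (by linarith [min_le_left ε 1]) hmq
      linarith
    · refine Or.inr ?_
      have h2 : (2 + δ + ε) * (m * scale 𝓒 i) < i.1.1.W i.2 z + m :=
        lt_of_not_ge fun h3 => hz ⟨h1, h3⟩
      change m * scale 𝓒 i < 1 / (2 + δ + ε / 2) * i.1.1.W i.2 z
      rw [one_div, ← div_eq_inv_mul, lt_div_iff₀ hB]
      -- the weight `m` of the new vertex is absorbed, since `p n` is large
      have h3 : (m : ℝ) ≤ ε / 2 * (m * scale 𝓒 i) := by
        rw [div_le_iff₀' hε] at hi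
        nlinarith
      linarith
  obtain ⟨C, c, hC, hc, hb⟩ := key
  refine ⟨C, c, hC, hc, fun M hM n hn => ?_⟩
  obtain ⟨s, rfl⟩ : ∃ s, n = s + 1 := ⟨n - 1, by omega⟩
  have h1 := hb (⟨M, hM⟩, s)
  have hscale : scale 𝓒 (⟨M, hM⟩, s) = ((s + 1 : ℕ) : ℝ) * M.p := by
    simp only [scale]; push_cast; ring
  have h2 := M.isGPM.measureReal_newest s
    (I := {t | (2 + δ - ε) * (m * scale 𝓒 (⟨M, hM⟩, s)) ≤ t + m ∧
      t + m ≤ (2 + δ + ε) * (m * scale 𝓒 (⟨M, hM⟩, s))})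
    ((measurableSet_le measurable_const (measurable_id.add_const _)).inter
      (measurableSet_le (measurable_id.add_const _) measurable_const))
  have h3 : ∀ x : ℝ, x * m * M.p * ((s + 1 : ℕ) : ℝ) = x * (m * scale 𝓒 (⟨M, hM⟩, s)) :=
    fun x => by rw [hscale]; ring
  simp only [L_succ, h3]
  rw [← hscale]
  have h4 : M.P.real {ω | (2 + δ - ε) * (m * scale 𝓒 (⟨M, hM⟩, s))
        ≤ regionWeight m δ M.r M.V M.v s (ω, M.V (s + 1) ω) + m ∧
        regionWeight m δ M.r M.V M.v s (ω, M.V (s + 1) ω) + m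
          ≤ (2 + δ + ε) * (m * scale 𝓒 (⟨M, hM⟩, s))}
      = M.Q.real {z | (2 + δ - ε) * (m * scale 𝓒 (⟨M, hM⟩, s)) ≤ M.W s z + m ∧
        M.W s z + m ≤ (2 + δ + ε) * (m * scale 𝓒 (⟨M, hM⟩, s))} := h2
  rw [h4]
  linarith

theorem concentration (hm : 1 ≤ m) (hδ : 0 < δ) {ε : ℝ} (hε : 0 < ε) :
    ∃ C c γ : ℝ, 0 < C ∧ 0 < c ∧ 0 < γ ∧ ∀ (M : Model.{u} m δ) (n : ℕ), 1 ≤ n →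
      1 - C * Real.exp (-c * ((n : ℝ) * M.p) ^ γ) ≤ M.P.real {ω |
        (2 + δ - ε) * m * M.p * n ≤ L m δ M.r (fun a => M.V a ω) (fun a l => M.v a l ω) n ∧
        L m δ M.r (fun a => M.V a ω) (fun a l => M.v a l ω) n ≤ (2 + δ + ε) * m * M.p * n} := by
  obtain ⟨γ, a, hγ0, hγ1, ha, hU⟩ := exists_upperTail hm hδ (Set.univ : Set (Model.{u} m δ))
  obtain ⟨C, c, hC, hc, hb⟩ := concentration_of_upperTail hm hδ hε hγ0 hγ1 ha hU
  exact ⟨C, c, γ, hC, hc, hγ0, fun M => hb M (Set.mem_univ _)⟩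

theorem concentration_of_dimension (hm : 1 ≤ m) (hδ : 0 < δ) {ε : ℝ} (hε : 0 < ε) (d : ℕ) :
    ∃ C c : ℝ, 0 < C ∧ 0 < c ∧ ∀ M : Model.{u} m δ, M.d = d → ∀ n : ℕ, 1 ≤ n →
      1 - C * Real.exp (-c * ((n : ℝ) * M.p)) ≤ M.P.real {ω |
        (2 + δ - ε) * m * M.p * n ≤ L m δ M.r (fun a => M.V a ω) (fun a l => M.v a l ω) n ∧
        L m δ M.r (fun a => M.V a ω) (fun a l => M.v a l ω) n ≤ (2 + δ + ε) * m * M.p * n} := by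
  have hK : (1 : ℝ) ≤ 5 ^ (d + 1) := one_le_pow₀ (by norm_num)
  have hU : UpperTail {M : Model.{u} m δ | M.d = d} 1 _ :=
    upperTail_of_double hδ hK fun M hM x => by
      rw [integral_near, ← show M.d = d from hM]
      exact area_double_le M.r_nonneg M.p_pos M.area_ball x
  obtain ⟨C, c, hC, hc, hb⟩ := concentration_of_upperTail hm hδ hε one_pos le_rfl
    (by positivity) hU
  refine ⟨C, c, hC, hc, fun M hM n hn => ?_⟩
  have := hb M hM n hn
  rwa [Real.rpow_one] at this

end GPM

theorem theorem2p1 (m : ℕ) (hm : 1 ≤ m) (δ : ℝ) (hδ : 0 < δ) (ε : ℝ) (hε : 0 < ε) :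
    (∃ C₁ C₂ C₃ : ℝ, 0 < C₁ ∧ 0 < C₂ ∧ 0 < C₃ ∧
      ∀ (d : ℕ), 1 ≤ d → ∀ (p : ℝ), 0 < p → p < 1 →
      ∀ (r : ℝ), (∀ x : GPM.Sphere d, GPM.area d (Metric.closedBall x r) = ENNReal.ofReal p) →
      ∀ (Ω : Type*) [MeasurableSpace Ω] (P : MeasureTheory.Measure Ω)
        [MeasureTheory.IsProbabilityMeasure P]
        (V : ℕ → Ω → GPM.Sphere d) (v : ℕ → ℕ → Ω → ℕ), GPM.IsGPM P d m δ r V v →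
      ∀ (n : ℕ), 1 ≤ n →
        1 - C₁ * Real.exp (-C₂ * ((n : ℝ) * p) ^ C₃) ≤
          P.real {ω |
            (2 + δ - ε) * m * p * n ≤ GPM.L m δ r (fun a => V a ω) (fun a l => v a l ω) n ∧
            GPM.L m δ r (fun a => V a ω) (fun a l => v a l ω) n ≤ (2 + δ + ε) * m * p * n}) ∧
    (∀ (d : ℕ), 1 ≤ d → ∃ C₁ C₂ : ℝ, 0 < C₁ ∧ 0 < C₂ ∧
      ∀ (p : ℝ), 0 < p → p < 1 →
      ∀ (r : ℝ), (∀ x : GPM.Sphere d, GPM.area d (Metric.closedBall x r) = ENNReal.ofReal p) →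
      ∀ (Ω : Type*) [MeasurableSpace Ω] (P : MeasureTheory.Measure Ω)
        [MeasureTheory.IsProbabilityMeasure P]
        (V : ℕ → Ω → GPM.Sphere d) (v : ℕ → ℕ → Ω → ℕ), GPM.IsGPM P d m δ r V v →
      ∀ (n : ℕ), 1 ≤ n →
        1 - C₁ * Real.exp (-C₂ * ((n : ℝ) * p)) ≤
          P.real {ω |
            (2 + δ - ε) * m * p * n ≤ GPM.L m δ r (fun a => V a ω) (fun a l => v a l ω) n ∧
            GPM.L m δ r (fun a => V a ω) (fun a l => v a l ω) n ≤ (2 + δ + ε) * m * p * n}) := by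
  refine ⟨?_, fun d hd => ?_⟩
  · obtain ⟨C, c, γ, hC, hc, hγ, h⟩ := GPM.concentration hm hδ hε
    exact ⟨C, c, γ, hC, hc, hγ, fun d _ p hp0 hp1 r hr Ω mΩ P hP V v hG =>
      h ⟨d, p, hp0, hp1, r, hr, Ω, mΩ, P, hP, V, v, hG⟩⟩
  · obtain ⟨C, c, hC, hc, h⟩ := GPM.concentration_of_dimension hm hδ hε d
    exact ⟨C, c, hC, hc, fun p hp0 hp1 r hr Ω mΩ P hP V v hG =>
      h ⟨d, p, hp0, hp1, r, hr, Ω, mΩ, P, hP, V, v, hG⟩ rfl⟩
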